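/- **Setting.** Let $u:\mathbb R\to\mathbb R$ be bounded and continuous, $U_\infty=\|u\|_\infty$, and let $\alpha\in(0,1)$. For integers $N\ge1$, $M=\alpha N$ and a real $\gamma$ with $0\le\gamma\le N$, let $g_{i,k}$ (standard Gaussian) and $\gamma_{i,k}$ (Bernoulli with parameter $\gamma/N$), $i\le N$, $k\le M$, be independent random variables. For $\sigma\in\{-1,1\}^N$ put $$-H_{N,M}(\sigma)=\sum_{k\le M}u\Big(\sum_{i\le N}g_{i,k}\gamma_{i,k}\sigma_i\Big),\qquad \langle f\rangle=\frac{\sum_\sigma f(\sigma)e^{-H_{N,M}(\sigma)}}{\sum_\sigma e^{-H_{N,M}(\sigma)}}$$ (the diluted perceptron Hamiltonian with all $\eta_k=1$). For $\theta\ge0$ and $\tau=(\tau_1,\dots,\tau_\theta)\in\mathbb Z_{\ge0}^\theta$, let $t_k=\tau_1+\dots+\tau_k$ and $$\xi_{\theta,\tau}(\sigma_1,\dots,\sigma_{t_\theta},\varepsilon)=\exp\sum_{k=1}^\theta u\Big(\sum_{i=1}^{\tau_k}\bar g_{i,k}\sigma_{t_{k-1}+i}+\bar g_k\varepsilon\Big)$$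 with $\bar g_{i,k},\bar g_k$ i.i.d. standard Gaussian. For a probability measure $\mu$ on $[-1,1]$, let $T_{\theta,\tau}(\mu)$ be the law of $\langle \mathbf{Av}\,\varepsilon\,\xi_{\theta,\tau}\rangle_X/\langle \mathbf{Av}\,\xi_{\theta,\tau}\rangle_X$, where $\mathbf{Av}$ is the average over $\varepsilon=\pm1$, $X_1,\dots,X_{t_\theta}$ are i.i.d. of law $\mu$, independent of the Gaussian variables, and $\langle\cdot\rangle_x$ is the average with respect to the product measure on $\{-1,1\}^{t_\theta}$ under which $\sigma_i$ has mean $x_i$ (for $\theta=0$ this law is $\delta_0$). Put $$T(\mu)=\sum_{\theta\ge0}\ \sum_{\tau_1,\dots,\tau_\theta\ge0}e^{-\alpha\gamma}\frac{(\alpha\gamma)^\theta}{\theta!}\,e^{-\theta\gamma}\frac{\gamma^{\tau_1+\dots+\tau_\theta}}{\tau_1!\cdots\tau_\theta!}\,T_{\theta,\tau}(\mu).$$ **Theorem.** Let $\gamma_0>0$ be such that $$4U_\infty\,\alpha\gamma_0^2\,e^{4U_\infty}\,e^{\alpha\gamma_0(e^{4U_\infty}-1)}\big(3+2\gamma_0+\alpha(\gamma_0^2+\gamma_0^3)e^{4U_\infty}\big)<1,$$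 and let $C_0>0$ satisfy $C_0\,\alpha\,\gamma_0^6\,U_\infty\,e^{2U_\infty}\le1$. Then there is a constant $K>0$, not depending on $m$, $N$ and $\gamma$, such that for every $0\le\gamma\le\gamma_0$ the equation $\mu=T(\mu)$ has a unique solution $\mu_{\alpha,\gamma}$ among the probability measures on $[-1,1]$, and the following holds for all integers $N\ge1$ with $N\ge\gamma$ and $M=\alpha N$ an integer, and all integers $0\le m\le N$. On a suitable enlargement of the probability space that carries the $g_{i,k}$ and the $\gamma_{i,k}$, there are i.i.d. random variables $z_1,\dots,z_m$ with law $\mu_{\alpha,\gamma}$ such that $$\mathbf E\Big[\sum_{i\le m}\big|\langle\sigma_i\rangle-z_i\big|\Big]\le\frac{Km^3}{N}.$$ Moreover, the transportation-cost (Wasserstein) distance, for the metric $\sum_{i\le m}|x_i-y_i|$, between the joint law of $(\langle\sigma_1\rangle,\dots,\langle\sigma_m\rangle)$ and $\mu_{\alpha,\gamma}^{\otimes m}$ is at most $Km^3/N$. -/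

import Mathlib

open MeasureTheory ProbabilityTheory
open scoped ENNReal

universe v

noncomputable section

namespace DilutedPerceptron

/-- The value in `{-1, 1}` of a spin; configurations are functions into `Bool`. -/
def spin (s : Bool) : ℝ := if s then 1 else -1

/-! ### The model -/

/-- `-H_{N,M}(σ) = ∑_{k ≤ M} η_k u(∑_{i ≤ N} g_{i,k} γ_{i,k} σ_i)` for a realization `g`, `b`
of the Gaussian variables `g_{i,k}` and of the Bernoulli variables `γ_{i,k}`. -/
def negHamiltonian {N M : ℕ} (u : ℝ → ℝ) (η : Fin M → ℝ) (g b : Fin N → Fin M → ℝ)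
    (σ : Fin N → Bool) : ℝ :=
  ∑ k, η k * u (∑ i, g i k * b i k * spin (σ i))

/-- The partition function. -/
def partitionFunction {N M : ℕ} (u : ℝ → ℝ) (η : Fin M → ℝ) (g b : Fin N → Fin M → ℝ) : ℝ :=
  ∑ σ, Real.exp (negHamiltonian u η g b σ)

/-- The Gibbs average `⟨f⟩` of a function of one configuration. -/
def gibbsAverage {N M : ℕ} (u : ℝ → ℝ) (η : Fin M → ℝ) (g b : Fin N → Fin M → ℝ)
    (f : (Fin N → Bool) → ℝ) : ℝ :=
  (partitionFunction u η g b)⁻¹ * ∑ σ, f σ * Real.exp (negHamiltonian u η g b σ)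

/-- The magnetization `⟨σ_i⟩`. -/
def magnetization {N M : ℕ} (u : ℝ → ℝ) (η : Fin M → ℝ) (g b : Fin N → Fin M → ℝ)
    (i : Fin N) : ℝ :=
  gibbsAverage u η g b (fun σ => spin (σ i))

/-- The random variables `g_{i,k}` are standard Gaussian, the `γ_{i,k}` (here `b i k`) are
Bernoulli with parameter `p`, and all these variables are independent. -/
structure IsDisorder {Ω : Type*} [MeasurableSpace Ω] (P : Measure Ω) {N M : ℕ}
    (p : unitInterval) (g b : Fin N → Fin M → Ω → ℝ) : Prop where
  gaussian : ∀ i k, HasLaw (g i k) (gaussianReal 0 1) P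
  bernoulli : ∀ i k, HasLaw (b i k) (bernoulliMeasure (1 : ℝ) 0 p) P
  indep : iIndepFun
    (fun j : (Fin N × Fin M) ⊕ (Fin N × Fin M) =>
      Sum.elim (fun q => g q.1 q.2) (fun q => b q.1 q.2) j) P

/-- The first `m` magnetizations, as a random vector. -/
def magnetizations {Ω : Type*} {N M m : ℕ} (u : ℝ → ℝ) (η : Fin M → ℝ)
    (g b : Fin N → Fin M → Ω → ℝ) (hm : m ≤ N) (ω : Ω) : Fin m → ℝ :=
  fun i => magnetization u η (fun j k => g j k ω) (fun j k => b j k ω) (Fin.castLE hm i)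

/-! ### The operator `T` on probability measures on `[-1,1]` -/

/-- The set of the pairs `(k, i)` with `k ≤ θ`, `i ≤ τ_k`. The pair `(k, i)` stands for the
position `τ_1 + ⋯ + τ_{k-1} + i`. -/
abbrev Slot {θ : ℕ} (τ : Fin θ → ℕ) : Type := (k : Fin θ) × Fin (τ k)

/-- `ξ_{θ,τ} = exp ∑_{k ≤ θ} u(∑_{i ≤ τ_k} g_{i,k} σ_{(k,i)} + g_k ε)`. -/
def xi (u : ℝ → ℝ) {θ : ℕ} (τ : Fin θ → ℕ) (g : Slot τ → ℝ) (h : Fin θ → ℝ)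
    (σ : Slot τ → Bool) (ε : Bool) : ℝ :=
  Real.exp (∑ k, u (∑ i : Fin (τ k), g ⟨k, i⟩ * spin (σ ⟨k, i⟩) + h k * spin ε))

/-- `⟨f⟩_x`: the average of `f` with respect to the product measure on `{-1,1}^ι` under which the
`i`-th spin has mean `x i`, where `|x i| ≤ 1`. -/
def productAverage {ι : Type*} [Fintype ι] [DecidableEq ι] (x : ι → ℝ)
    (f : (ι → Bool) → ℝ) : ℝ :=
  ∑ σ, f σ * ∏ i, ((1 + spin (σ i) * x i) / 2)

/-- The average over `ε = ±1`. -/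
def spinAverage (f : Bool → ℝ) : ℝ := (f true + f false) / 2

/-- `⟨Av ε ξ_{θ,τ}⟩_x / ⟨Av ξ_{θ,τ}⟩_x`. -/
def cavityRatio (u : ℝ → ℝ) {θ : ℕ} (τ : Fin θ → ℕ) (g : Slot τ → ℝ) (h : Fin θ → ℝ)
    (x : Slot τ → ℝ) : ℝ :=
  productAverage x (fun σ => spinAverage (fun ε => spin ε * xi u τ g h σ ε)) /
    productAverage x (fun σ => spinAverage (fun ε => xi u τ g h σ ε))

/-- `T_{θ,τ}(μ)`: the law of the cavity ratio at i.i.d. random points of law `μ`, independent of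
the i.i.d. standard Gaussian variables in `ξ_{θ,τ}`. For `θ = 0` the ratio is `0`, and this is the
Dirac measure at `0`. -/
def opTau (u : ℝ → ℝ) {θ : ℕ} (τ : Fin θ → ℕ) (μ : Measure ℝ) : Measure ℝ :=
  ((Measure.pi (fun _ : Slot τ => μ)).prod
    ((Measure.pi (fun _ : Slot τ => gaussianReal 0 1)).prod
      (Measure.pi (fun _ : Fin θ => gaussianReal 0 1)))).map
    (fun y => cavityRatio u τ y.2.1 y.2.2 y.1)

/-- The weights `κ(θ, τ_1, …, τ_θ)`. -/
def kappa (α γ : ℝ) {θ : ℕ} (τ : Fin θ → ℕ) : ℝ :=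
  Real.exp (-(α * γ)) * ((α * γ) ^ θ / (θ.factorial : ℝ)) * Real.exp (-(θ * γ)) *
    (γ ^ (∑ l, τ l) / ∏ l, ((τ l).factorial : ℝ))

/-- `T(μ) = ∑_θ ∑_τ κ(θ, τ) T_{θ,τ}(μ)`. -/
def opT (u : ℝ → ℝ) (α γ : ℝ) (μ : Measure ℝ) : Measure ℝ :=
  Measure.sum (fun q : (θ : ℕ) × (Fin θ → ℕ) =>
    ENNReal.ofReal (kappa α γ q.2) • opTau u q.2 μ)

/-- `μ` is a probability measure on `[-1,1]` with `T(μ) = μ`. -/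
structure IsFixedLaw (u : ℝ → ℝ) (α γ : ℝ) (μ : Measure ℝ) : Prop where
  prob : IsProbabilityMeasure μ
  supp : ∀ᵐ x ∂μ, x ∈ Set.Icc (-1 : ℝ) 1
  fixed : opT u α γ μ = μ

/-! ### Transportation cost -/

/-- The transportation-cost distance on `ℝ^m` for the metric `d(x, y) = ∑_i |x_i - y_i|`: the
infimum of the cost over all couplings of `μ` and `ν`. -/
def transportDist {m : ℕ} (μ ν : Measure (Fin m → ℝ)) : ℝ≥0∞ :=
  ⨅ (π : Measure ((Fin m → ℝ) × (Fin m → ℝ)))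
    (_ : π.map Prod.fst = μ ∧ π.map Prod.snd = ν),
    ∫⁻ q, ENNReal.ofReal (∑ i, |q.1 i - q.2 i|) ∂π

end DilutedPerceptron

end

/-! The theorem expresses a weak dependence between spins of a sparse random system. Put `c = (exp
(2‖u‖) - 1) / 2`. The log-odds of a spin split over the clauses that contain it, and the share of a
clause is a log-ratio of averages, in a system without that clause, of functions with values in
`[exp (-‖u‖), exp ‖u‖]`. Iterating this, a change of some clauses moves the mean of a spin by at
most a sum over self-avoiding paths from the spin to these clauses, each further step costing a
factor `c` (`FactorPair.abs_mag_sub_le`). This bound is deterministic. A path never reuses a clause,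
so the Bernoulli variables along it are independent, and the expected sum behaves like a geometric
series of ratio `c * α * γ ^ 2` (`ex_infl_le`).

Now remove a set `Q` of `m` spins together with its clauses. With high probability no clause
contains two spins of `Q`, and the neighbours of `Q` are connected to each other only by paths whose
expected total weight is of order `1 / N`. Under the Gibbs measure the neighbours are then almost
independent, with the means of the reduced system, and the mean of `i ∈ Q` is almost `tanh` of half
of a sum of clause log-ratios at these means (`abs_sysMag_sub_tanh_le`). If the neighbouring means
are replaced by independent variables of law `μ`, the result is a family of independent cavity
fields, whose law differs from `T(μ) = μ` only by the replacement of binomial by Poisson numbers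
(`near_cavityLaw`).

The replacement is an induction on the set of spins (`hasCoupling_sysMag`). The neighbours of `Q`
form a random set of spins of the smaller system, whose size has first and second moments controlled
by `m`, and an error made there is multiplied by `c`; under the smallness assumption the bound of
order `(m + m ^ 2) / N` reproduces itself with a factor `1 / 2`. The delicate point is that the set
of neighbours depends on the disorder. The array is therefore assembled from independent copies
(`sel`), so that the neighbours and the removed clauses are read off the copies, whereas the reduced
system lives on a fresh independent array (`hasCoupling_cavityLaw`).

The law `μ` exists and is unique because `T` contracts the transportation cost by the factor `c * α
* γ ^ 2` (`near_opT`). Disintegrating the final coupling realizes the variables `z_i` on an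
enlargement of the given space (`exists_enlargement`). -/

open scoped NNReal

set_option linter.unusedSectionVars false

noncomputable section

namespace DilutedPerceptron

/-! ### Gibbs averages of finite spin systems and influence along self-avoiding paths. -/

section Gibbs

variable {V E : Type*} [Fintype V] [DecidableEq V] [DecidableEq E]

/-- The average of `φ` for the probability proportional to the weight `G`. -/
def avg (G φ : (V → Bool) → ℝ) : ℝ := (∑ σ, φ σ * G σ) / ∑ σ, G σ

/-- The mean of the spin at `v` for the probability proportional to the weight `G`. -/
def mag (G : (V → Bool) → ℝ) (v : V) : ℝ := avg G (fun σ => spin (σ v))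

/-- The function `φ` with the spin at `w` frozen to `ε`. -/
def pin {β : Type*} (φ : (V → Bool) → β) (w : V) (ε : Bool) : (V → Bool) → β :=
  fun σ => φ (Function.update σ w ε)

/-- `φ` does not depend on the spin at `v`. -/
def Ind {β : Type*} (φ : (V → Bool) → β) (v : V) : Prop := ∀ ε, pin φ v ε = φ

lemma Ind.pin {β : Type*} {φ : (V → Bool) → β} {v : V} (h : Ind φ v) (w : V) (ε : Bool) :
    Ind (pin φ w ε) v := by
  intro δ
  rcases eq_or_ne v w with rfl | hvw
  · funext σ; simp [DilutedPerceptron.pin]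
  · funext σ
    simp only [DilutedPerceptron.pin]
    rw [Function.update_comm hvw]
    exact congrFun (h δ) _

lemma ind_pin_self {β : Type*} (φ : (V → Bool) → β) (w : V) (ε : Bool) : Ind (pin φ w ε) w := by
  intro δ; funext σ; simp [pin]

lemma Ind.pin_eq {β : Type*} {φ : (V → Bool) → β} {v : V} (h : Ind φ v) (ε : Bool) :
    DilutedPerceptron.pin φ v ε = φ := h ε

lemma eq_of_forall_ind {β : Type*} {φ : (V → Bool) → β} (h : ∀ v, Ind φ v) (σ τ : V → Bool) :
    φ σ = φ τ := by
  have : ∀ T : Finset V, φ (T.piecewise σ τ) = φ τ := by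
    intro T
    induction T using Finset.induction_on with
    | empty => simp
    | insert v T hv ih =>
      rw [Finset.piecewise_insert]
      exact (congrFun (h v (σ v)) _).trans ih
  simpa using this Finset.univ

/-- Pinned functions remain functions of the whole configuration, hence the factor `2`, which
cancels in every ratio. Pairing each configuration with the one flipped at `w` gives the identity.
-/
lemma sum_pin_add_sum_pin (F : (V → Bool) → ℝ) (w : V) :
    ∑ σ, pin F w true σ + ∑ σ, pin F w false σ = 2 * ∑ σ, F σ := by
  have hinv : Function.Involutive (fun σ : V → Bool => Function.update σ w (!σ w)) := by
    intro σ; simp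
  have h1 : ∑ σ, F (Function.update σ w (!σ w)) = ∑ σ, F σ :=
    Equiv.sum_comp hinv.toPerm F
  rw [two_mul]
  nth_rewrite 2 [← h1]
  rw [← Finset.sum_add_distrib, ← Finset.sum_add_distrib]
  refine Finset.sum_congr rfl fun σ _ => ?_
  simp only [pin]
  cases h : σ w
  · have : Function.update σ w false = σ := by rw [← h]; exact Function.update_eq_self w σ
    rw [this]; simp [add_comm]
  · have : Function.update σ w true = σ := by rw [← h]; exact Function.update_eq_self w σ
    rw [this]; simp

lemma sum_weight_pos {G : (V → Bool) → ℝ} (hG : ∀ σ, 0 < G σ) : 0 < ∑ σ, G σ :=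
  Finset.sum_pos (fun σ _ => hG σ) Finset.univ_nonempty

lemma mag_eq (G : (V → Bool) → ℝ) (w : V) :
    mag G w = (∑ σ, pin G w true σ - ∑ σ, pin G w false σ) /
      (∑ σ, pin G w true σ + ∑ σ, pin G w false σ) := by
  have h := sum_pin_add_sum_pin (fun σ => spin (σ w) * G σ) w
  have h2 := sum_pin_add_sum_pin G w
  have e1 : ∑ σ, pin (fun σ => spin (σ w) * G σ) w true σ = ∑ σ, pin G w true σ := by
    simp [pin, spin]
  have e2 : ∑ σ, pin (fun σ => spin (σ w) * G σ) w false σ = -∑ σ, pin G w false σ := by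
    simp [pin, spin]
  rw [e1, e2] at h
  rw [h2, mag, avg, ← sub_eq_add_neg] at *
  rw [h, mul_div_mul_left _ _ (by norm_num)]

/-- Conditioning on the spin at `w`, which equals `±1` with probability `(1 ± mag G w) / 2`. -/
lemma avg_eq_pin {G : (V → Bool) → ℝ} (hG : ∀ σ, 0 < G σ) (φ : (V → Bool) → ℝ) (w : V) :
    avg G φ = (1 + mag G w) / 2 * avg (pin G w true) (pin φ w true) +
      (1 - mag G w) / 2 * avg (pin G w false) (pin φ w false) := by
  have h := sum_pin_add_sum_pin (fun σ => φ σ * G σ) w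
  have h2 := sum_pin_add_sum_pin G w
  have p1 : 0 < ∑ σ, pin G w true σ := sum_weight_pos fun σ => hG _
  have p2 : 0 < ∑ σ, pin G w false σ := sum_weight_pos fun σ => hG _
  rw [mag_eq, avg, avg, avg]
  have e : ∀ ε, ∑ σ, pin φ w ε σ * pin G w ε σ = ∑ σ, pin (fun σ => φ σ * G σ) w ε σ :=
    fun ε => rfl
  rw [e, e]
  set a := ∑ σ, pin G w true σ
  set b := ∑ σ, pin G w false σ
  have p3 : ∑ σ, G σ = (a + b) / 2 := by linarith
  have p4 : ∑ σ, φ σ * G σ = (∑ σ, pin (fun σ => φ σ * G σ) w true σ +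
    ∑ σ, pin (fun σ => φ σ * G σ) w false σ) / 2 := by linarith
  rw [p3, p4]
  field_simp
  ring

lemma avg_mem {G φ : (V → Bool) → ℝ} (hG : ∀ σ, 0 < G σ) {lo hi : ℝ}
    (h : ∀ σ, lo ≤ φ σ ∧ φ σ ≤ hi) : lo ≤ avg G φ ∧ avg G φ ≤ hi := by
  have hp := sum_weight_pos hG
  rw [avg, le_div_iff₀ hp, div_le_iff₀ hp, Finset.mul_sum, Finset.mul_sum]
  exact ⟨Finset.sum_le_sum fun σ _ => mul_le_mul_of_nonneg_right (h σ).1 (hG σ).le,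
    Finset.sum_le_sum fun σ _ => mul_le_mul_of_nonneg_right (h σ).2 (hG σ).le⟩

lemma abs_mag_lt_one {G : (V → Bool) → ℝ} (hG : ∀ σ, 0 < G σ) (w : V) : |mag G w| < 1 := by
  have p1 : 0 < ∑ σ, pin G w true σ := sum_weight_pos fun σ => hG _
  have p2 : 0 < ∑ σ, pin G w false σ := sum_weight_pos fun σ => hG _
  rw [mag_eq, abs_div, abs_of_pos (add_pos p1 p2), div_lt_one (add_pos p1 p2), abs_lt]
  constructor <;> linarith

/-- Comparison of two Gibbs measures, through the comparison of the means of single spins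
under all possible pinnings of the other spins. -/
theorem abs_avg_sub_avg_le
    (Rel : Finset V → ((V → Bool) → ℝ) → ((V → Bool) → ℝ) → Prop) (J : V → ℝ)
    (hpos : ∀ W G G', Rel W G G' → (∀ σ, 0 < G σ) ∧ ∀ σ, 0 < G' σ)
    (hmag : ∀ W w G G', w ∉ W → Rel (insert w W) G G' → |mag G w - mag G' w| ≤ J w)
    (hpin : ∀ W w G G', w ∉ W → Rel (insert w W) G G' → ∀ ε, Rel W (pin G w ε) (pin G' w ε))
    (W : Finset V) {lo hi : ℝ} (hlohi : lo ≤ hi) : ∀ (G G' φ : (V → Bool) → ℝ), Rel W G G' →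
    (∀ v, v ∉ W → Ind φ v) → (∀ σ, lo ≤ φ σ ∧ φ σ ≤ hi) →
    |avg G φ - avg G' φ| ≤ (hi - lo) / 2 * ∑ w ∈ W, J w := by
  induction W using Finset.induction_on with
  | empty =>
    intro G G' φ hR hφ _
    have hc : ∀ σ, φ σ = φ (fun _ => true) :=
      fun σ => eq_of_forall_ind (fun v => hφ v (Finset.notMem_empty v)) _ _
    have : ∀ G : (V → Bool) → ℝ, (∀ σ, 0 < G σ) → avg G φ = φ (fun _ => true) := by
      intro G hG
      rw [avg, Finset.sum_congr rfl (fun σ _ => by rw [hc σ]), ← Finset.mul_sum,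
        mul_div_assoc, div_self (sum_weight_pos hG).ne', mul_one]
    rw [this G (hpos _ _ _ hR).1, this G' (hpos _ _ _ hR).2]
    simp
  | insert w W hw ih =>
    intro G G' φ hR hφ hb
    obtain ⟨hG, hG'⟩ := hpos _ _ _ hR
    have hi' : ∀ ε, ∀ v, v ∉ W → Ind (pin φ w ε) v := by
      intro ε v hv
      rcases eq_or_ne v w with rfl | hvw
      · exact ind_pin_self _ _ _
      · exact (hφ v (by simp [hv, hvw])).pin _ _
    have hb' : ∀ ε σ, lo ≤ pin φ w ε σ ∧ pin φ w ε σ ≤ hi := fun ε σ => hb _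
    have it := ih _ _ _ (hpin _ _ _ _ hw hR true) (hi' true) (hb' true)
    have jf := ih _ _ _ (hpin _ _ _ _ hw hR false) (hi' false) (hb' false)
    have hJ := hmag _ _ _ _ hw hR
    have a1 := avg_mem (G := pin G w true) (fun σ => hG _) (hb' true)
    have a2 := avg_mem (G := pin G w false) (fun σ => hG _) (hb' false)
    have m := abs_lt.1 (abs_mag_lt_one hG' w)
    rw [avg_eq_pin hG φ w, avg_eq_pin hG' φ w, Finset.sum_insert hw]
    set p := mag G w
    set q := mag G' w
    set A := avg (pin G w true) (pin φ w true)
    set B := avg (pin G w false) (pin φ w false)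
    set A' := avg (pin G' w true) (pin φ w true)
    set B' := avg (pin G' w false) (pin φ w false)
    set D := (hi - lo) / 2 * ∑ w ∈ W, J w
    -- The first term is the change of the law of the spin at `w`, weighted by half of an
    -- oscillation that is at most `hi - lo`; the second mixes changes of the conditional averages,
    -- to which the induction hypothesis applies.
    have e : (1 + p) / 2 * A + (1 - p) / 2 * B - ((1 + q) / 2 * A' + (1 - q) / 2 * B') =
        (p - q) * ((A - B) / 2) + ((1 + q) / 2 * (A - A') + (1 - q) / 2 * (B - B')) := by ring
    rw [e, mul_add]
    refine (abs_add_le _ _).trans (add_le_add ?_ ?_)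
    · rw [abs_mul, mul_comm]
      refine mul_le_mul ?_ hJ (abs_nonneg _) (by linarith)
      rw [abs_le]; constructor <;> linarith
    · change _ ≤ D
      refine (abs_add_le _ _).trans ?_
      rw [abs_mul, abs_mul, abs_of_nonneg (by linarith : 0 ≤ (1 + q) / 2),
        abs_of_nonneg (by linarith : 0 ≤ (1 - q) / 2)]
      have h1 := mul_le_mul_of_nonneg_left it (by linarith : 0 ≤ (1 + q) / 2)
      have h2 := mul_le_mul_of_nonneg_left jf (by linarith : 0 ≤ (1 - q) / 2)
      linarith

/-- Apply `log t ≤ t - 1` to `t = a / b` and bound `1 / b` by `exp U`. -/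
lemma abs_log_sub_log_le {U a b : ℝ} (ha : Real.exp (-U) ≤ a) (hb : Real.exp (-U) ≤ b) :
    |Real.log a - Real.log b| ≤ Real.exp U * |a - b| := by
  have key : ∀ a b : ℝ, Real.exp (-U) ≤ a → Real.exp (-U) ≤ b →
      Real.log a - Real.log b ≤ Real.exp U * |a - b| := by
    intro a b ha hb
    have pa := (Real.exp_pos _).trans_le ha
    have pb := (Real.exp_pos _).trans_le hb
    rw [← Real.log_div pa.ne' pb.ne']
    refine (Real.log_le_sub_one_of_pos (div_pos pa pb)).trans ?_
    have h1 : a / b - 1 = (1 / b) * (a - b) := by field_simp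
    have h2 : 1 / b ≤ Real.exp U := by
      rw [div_le_iff₀ pb]
      have := mul_le_mul_of_nonneg_left hb (Real.exp_pos U).le
      rwa [← Real.exp_add, add_neg_cancel, Real.exp_zero] at this
    rw [h1]
    calc (1 / b) * (a - b) ≤ (1 / b) * |a - b| :=
          mul_le_mul_of_nonneg_left (le_abs_self _) (by positivity)
      _ ≤ _ := mul_le_mul_of_nonneg_right h2 (abs_nonneg _)
  rw [abs_le]
  have h1 := key a b ha hb
  have h2 := key b a hb ha
  rw [abs_sub_comm] at h2
  constructor <;> linarith

lemma abs_tanh_sub_tanh_le (x y : ℝ) : |Real.tanh x - Real.tanh y| ≤ |x - y| := by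
  have hd : ∀ x : ℝ, HasDerivAt Real.tanh (1 / Real.cosh x ^ 2) x := by
    intro x
    have h := (Real.hasDerivAt_sinh x).div (Real.hasDerivAt_cosh x) (Real.cosh_pos x).ne'
    have e : Real.tanh = Real.sinh / Real.cosh := by
      funext x; simp [Real.tanh_eq_sinh_div_cosh]
    rw [e]
    refine h.congr_deriv ?_
    congr 1
    linear_combination Real.cosh_sq x
  have := Convex.norm_image_sub_le_of_norm_hasDerivWithin_le (C := 1) (s := Set.univ)
    (f := Real.tanh) (fun x _ => (hd x).hasDerivWithinAt) (fun x _ => by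
      rw [Real.norm_of_nonneg (by positivity), div_le_one (by have := Real.cosh_pos x; positivity)]
      nlinarith [Real.one_le_cosh x]) convex_univ (Set.mem_univ y) (Set.mem_univ x)
  simpa using this

/-- The mean of a spin is `tanh` of half of its log-odds. Log-odds are additive over clauses, and
`tanh` loses nothing because it is `1`-Lipschitz. -/
lemma div_add_eq_tanh {a b : ℝ} (ha : 0 < a) (hb : 0 < b) :
    (a - b) / (a + b) = Real.tanh ((Real.log a - Real.log b) / 2) := by
  obtain ⟨x, rfl⟩ : ∃ x, a = Real.exp x := ⟨_, (Real.exp_log ha).symm⟩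
  obtain ⟨y, rfl⟩ : ∃ x, b = Real.exp x := ⟨_, (Real.exp_log hb).symm⟩
  rw [Real.log_exp, Real.log_exp, Real.tanh_eq, ]
  have h1 : Real.exp x = Real.exp ((x + y) / 2) * Real.exp ((x - y) / 2) := by
    rw [← Real.exp_add]; ring_nf
  have h2 : Real.exp y = Real.exp ((x + y) / 2) * Real.exp (-((x - y) / 2)) := by
    rw [← Real.exp_add]; ring_nf
  rw [h1, h2, ← mul_sub, ← mul_add, mul_div_mul_left _ _ (Real.exp_pos _).ne']

/-- Telescoping along an order of the clauses, `β k` being those that come before `k`. The order is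
fixed before `F`, so that two systems can be expanded along the same order and compared term by
term. -/
lemma exists_hybrid (Es : Finset E) : ∃ β : E → Finset E, (∀ k ∈ Es, k ∉ β k) ∧
    ∀ F : Finset E → ℝ, F ∅ - F Es = ∑ k ∈ Es, (F (β k) - F (insert k (β k))) := by
  induction Es using Finset.induction_on with
  | empty => exact ⟨fun _ => ∅, by simp, by simp⟩
  | insert k Es hk ih =>
    obtain ⟨β, h1, h2⟩ := ih
    refine ⟨Function.update β k Es, ?_, ?_⟩
    · intro l hl
      rcases eq_or_ne l k with rfl | hlk
      · simpa using hk
      · simpa [hlk] using h1 l (by simpa [hlk] using hl)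
    · intro F
      rw [Finset.sum_insert hk]
      have : ∑ l ∈ Es, (F (Function.update β k Es l) - F (insert l (Function.update β k Es l))) =
          ∑ l ∈ Es, (F (β l) - F (insert l (β l))) :=
        Finset.sum_congr rfl fun l hl => by
          rw [Function.update_of_ne (ne_of_mem_of_not_mem hl hk)]
      rw [this, ← h2]
      simp

/-- The weight that is the product of the factors `f k` for `k ∈ Es`. -/
def prodWeight (Es : Finset E) (f : E → (V → Bool) → ℝ) : (V → Bool) → ℝ :=
  fun σ => ∏ k ∈ Es, f k σ

/-- The factors `f l`, `l ≠ k`, with the spin at `s` frozen to a value that depends on `l`. -/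
def hybrid (Es : Finset E) (f : E → (V → Bool) → ℝ) (s : V) (k : E) (B : Finset E) :
    (V → Bool) → ℝ :=
  prodWeight (Es.erase k) (fun l => pin (f l) s (decide (l ∉ B)))

/-- The logarithm of the odds at a spin splits over the clauses that contain it. -/
lemma exists_mag_prodWeight_eq (Es : Finset E) (s : V) : ∃ β : E → Finset E,
    ∀ f : E → (V → Bool) → ℝ, (∀ k ∈ Es, ∀ σ, 0 < f k σ) →
    mag (prodWeight Es f) s = Real.tanh ((∑ k ∈ Es,
      (Real.log (avg (hybrid Es f s k (β k)) (pin (f k) s true)) -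
        Real.log (avg (hybrid Es f s k (β k)) (pin (f k) s false)))) / 2) := by
  obtain ⟨β, hβ, hF⟩ := exists_hybrid Es
  refine ⟨β, fun f hf => ?_⟩
  -- In `Z B` the clauses of `B` see the spin at `s` equal to `-1` and the others see `+1`. The two
  -- extremes `Z ∅` and `Z Es` are the weights of the two values of this spin.
  set Z : Finset E → ℝ := fun B => ∑ σ, ∏ l ∈ Es, pin (f l) s (decide (l ∉ B)) σ with hZ
  have hZpos : ∀ B, 0 < Z B := fun B =>
    sum_weight_pos fun σ => Finset.prod_pos fun l hl => hf l hl _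
  have e1 : ∑ σ, pin (prodWeight Es f) s true σ = Z ∅ := by simp [hZ, pin, prodWeight]
  have e2 : ∑ σ, pin (prodWeight Es f) s false σ = Z Es := by
    simp only [hZ, pin, prodWeight]
    refine Finset.sum_congr rfl fun σ _ => Finset.prod_congr rfl fun l hl => ?_
    simp [hl]
  rw [mag_eq, e1, e2, div_add_eq_tanh (hZpos _) (hZpos _), hF (fun B => Real.log (Z B))]
  congr 2
  refine Finset.sum_congr rfl fun k hk => ?_
  have hGpos : ∀ σ, 0 < hybrid Es f s k (β k) σ := fun σ =>
    Finset.prod_pos fun l hl => hf l (Finset.mem_of_mem_erase hl) _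
  have hp : ∀ ε, 0 < ∑ σ, pin (f k) s ε σ * hybrid Es f s k (β k) σ := fun ε =>
    sum_weight_pos fun σ => mul_pos (hf k hk _) (hGpos σ)
  have hden := sum_weight_pos hGpos
  -- Between two consecutive sets only the clause `k` changes. Dividing both partition functions by
  -- that of `hybrid`, from which `k` is absent, turns them into averages.
  have z1 : Z (β k) = ∑ σ, pin (f k) s true σ * hybrid Es f s k (β k) σ := by
    simp only [hZ, hybrid, prodWeight]
    refine Finset.sum_congr rfl fun σ _ => ?_
    rw [← Finset.mul_prod_erase _ _ hk]
    simp [hβ k hk]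
  have z2 : Z (insert k (β k)) = ∑ σ, pin (f k) s false σ * hybrid Es f s k (β k) σ := by
    simp only [hZ, hybrid, prodWeight]
    refine Finset.sum_congr rfl fun σ _ => ?_
    rw [← Finset.mul_prod_erase _ _ hk]
    congr 1
    · simp
    · refine Finset.prod_congr rfl fun l hl => ?_
      simp [Finset.ne_of_mem_erase hl]
  rw [avg, avg, Real.log_div (hp _).ne' hden.ne', Real.log_div (hp _).ne' hden.ne', z1, z2]
  ring

/-- A sum over the self-avoiding paths that leave `s`. -/
def infl (c : ℝ≥0) (b : V → E → Bool) (a : E → ℝ≥0) : ℕ → Finset V → Finset E → V → ℝ≥0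
  -- The natural number bounds the length of the paths; as each step erases a clause, any value from
  -- `Es.card` on gives the full sum.
  | 0, _, _, _ => 0
  | r + 1, Vs, Es, s => ∑ k ∈ Es, if b s k then
      a k + c * ∑ s' ∈ Vs.erase s, if b s' k then infl c b a r (Vs.erase s) (Es.erase k) s' else 0
      else 0

/-- Two systems of factors, with the same dependencies, that agree at the clauses `k` with
`a k < 2 U`. -/
structure FactorPair (U : ℝ) (b : V → E → Bool) (a : E → ℝ≥0) (Vs : Finset V) (Es : Finset E)
    (f f' : E → (V → Bool) → ℝ) : Prop where
  bdd : ∀ k ∈ Es, ∀ σ, (Real.exp (-U) ≤ f k σ ∧ f k σ ≤ Real.exp U) ∧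
    (Real.exp (-U) ≤ f' k σ ∧ f' k σ ≤ Real.exp U)
  ind : ∀ k ∈ Es, ∀ v ∈ Vs, b v k = false → Ind (f k) v ∧ Ind (f' k) v
  -- The number `2 * U` bounds the whole effect of one clause on half of the log-odds, so a changed
  -- clause may depend on spins outside `Vs`. An unchanged clause may not, since the paths that
  -- continue through it use only spins of `Vs`.
  eq : ∀ k ∈ Es, 2 * U ≤ a k ∨ (f k = f' k ∧ ∀ v, v ∉ Vs → Ind (f k) v)

variable {U : ℝ} {b : V → E → Bool} {a : E → ℝ≥0} {Vs : Finset V} {Es : Finset E}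
  {f f' : E → (V → Bool) → ℝ}

/-- Serves two situations: `s` leaves the spin set after its log-odds have been expanded, with
frozen values that vary with the clause, or `s` is pinned to one value while the spin set is kept.
-/
lemma FactorPair.pin_mono (h : FactorPair U b a Vs Es f f') {Es' : Finset E} (hE : Es' ⊆ Es)
    {Vs' : Finset V} (hV : Vs' ⊆ Vs) (s : V) (hs : Vs ⊆ insert s Vs') (ε : E → Bool) :
    FactorPair U b a Vs' Es' (fun l => pin (f l) s (ε l)) (fun l => pin (f' l) s (ε l)) where
  bdd k hk σ := h.bdd k (hE hk) _
  ind k hk v hv hb := ⟨(h.ind k (hE hk) v (hV hv) hb).1.pin _ _,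
    (h.ind k (hE hk) v (hV hv) hb).2.pin _ _⟩
  eq k hk := by
    refine (h.eq k (hE hk)).imp id fun ⟨h1, h2⟩ => ⟨by simp only [h1], fun v hv => ?_⟩
    rcases eq_or_ne v s with rfl | hvs
    · exact ind_pin_self _ _ _
    · exact (h2 v fun hv' => hv ((Finset.mem_insert.1 (hs hv')).resolve_left hvs)).pin _ _

lemma abs_log_le_of_mem {x : ℝ} (h : Real.exp (-U) ≤ x ∧ x ≤ Real.exp U) : |Real.log x| ≤ U := by
  have p := (Real.exp_pos _).trans_le h.1
  rw [abs_le]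
  exact ⟨by simpa using Real.log_le_log (Real.exp_pos _) h.1, by simpa using Real.log_le_log p h.2⟩

/-- The origin of the constant `c`: the Lipschitz constant `exp U` of the logarithm times half of
the oscillation is `(exp (2 * U) - 1) / 2`. -/
lemma abs_log_avg_sub_le {G G' φ : (V → Bool) → ℝ} (hG : ∀ σ, 0 < G σ) (hG' : ∀ σ, 0 < G' σ)
    (hφ : ∀ σ, Real.exp (-U) ≤ φ σ ∧ φ σ ≤ Real.exp U) {S : ℝ}
    (h : |avg G φ - avg G' φ| ≤ (Real.exp U - Real.exp (-U)) / 2 * S) :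
    |Real.log (avg G φ) - Real.log (avg G' φ)| ≤ (Real.exp (2 * U) - 1) / 2 * S := by
  refine (abs_log_sub_log_le (avg_mem hG hφ).1 (avg_mem hG' hφ).1).trans ?_
  refine (mul_le_mul_of_nonneg_left h (Real.exp_pos U).le).trans (le_of_eq ?_)
  have e1 : Real.exp (2 * U) = Real.exp U * Real.exp U := by rw [← Real.exp_add]; ring_nf
  have e2 : Real.exp U * Real.exp (-U) = 1 := by rw [← Real.exp_add]; simp
  rw [e1]
  linear_combination (- S / 2) * e2

/-- Changing the factors of a set of clauses changes the mean of a spin by at most the sum of the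
weights of the self-avoiding paths from this spin to these clauses. -/
theorem FactorPair.abs_mag_sub_le (hU : 0 ≤ U) {c : ℝ≥0}
    (hc : (c : ℝ) = (Real.exp (2 * U) - 1) / 2) (r : ℕ) :
    ∀ (Vs : Finset V) (Es : Finset E) (f f' : E → (V → Bool) → ℝ) (s : V), Es.card ≤ r → s ∈ Vs →
    FactorPair U b a Vs Es f f' →
    |mag (prodWeight Es f) s - mag (prodWeight Es f') s| ≤ infl c b a r Vs Es s := by
  induction r with
  | zero =>
    intro Vs Es f f' s hr _ _
    rw [Finset.card_eq_zero.1 (Nat.le_zero.1 hr)]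
    have e : (fun _ => 1 : (V → Bool) → ℝ) = prodWeight (∅ : Finset E) f := by
      funext σ; simp [prodWeight]
    have e' : (fun _ => 1 : (V → Bool) → ℝ) = prodWeight (∅ : Finset E) f' := by
      funext σ; simp [prodWeight]
    rw [← e, ← e']
    simp [infl]
  | succ r ih =>
    intro Vs Es f f' s hr hs h
    have hpos : ∀ k ∈ Es, ∀ σ, 0 < f k σ := fun k hk σ =>
      (Real.exp_pos _).trans_le (h.bdd k hk σ).1.1
    have hpos' : ∀ k ∈ Es, ∀ σ, 0 < f' k σ := fun k hk σ =>
      (Real.exp_pos _).trans_le (h.bdd k hk σ).2.1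
    obtain ⟨β, hβ⟩ := exists_mag_prodWeight_eq Es s
    rw [hβ f hpos, hβ f' hpos']
    refine (abs_tanh_sub_tanh_le _ _).trans ?_
    rw [← sub_div, ← Finset.sum_sub_distrib, abs_div, abs_two, div_le_iff₀ two_pos]
    refine (Finset.abs_sum_le_sum_abs _ _).trans ?_
    rw [infl]
    push_cast
    rw [Finset.sum_mul]
    refine Finset.sum_le_sum fun k hk => ?_
    have hG : ∀ σ, 0 < hybrid Es f s k (β k) σ := fun σ =>
      Finset.prod_pos fun l hl => hpos l (Finset.mem_of_mem_erase hl) _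
    have hG' : ∀ σ, 0 < hybrid Es f' s k (β k) σ := fun σ =>
      Finset.prod_pos fun l hl => hpos' l (Finset.mem_of_mem_erase hl) _
    cases hb : b s k
    · have h1 := (h.ind k hk s hs hb).1
      have h2 := (h.ind k hk s hs hb).2
      simp [h1.pin_eq, h2.pin_eq]
    · have hnn : (0 : ℝ) ≤ c * ∑ s' ∈ Vs.erase s,
          (if b s' k then infl c b a r (Vs.erase s) (Es.erase k) s' else 0 : ℝ≥0) := by positivity
      simp only [if_true]
      push_cast at hnn ⊢
      -- At a changed clause each of the four logarithms lies in `[-U, U]`, which gives `4 * U ≤ 2 *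
      -- a k`. At an unchanged clause the same function is averaged for two measures.
      rcases h.eq k hk with hk' | ⟨hff, hout⟩
      · have b1 := abs_le.1 (abs_log_le_of_mem
          (avg_mem (φ := pin (f k) s true) hG fun σ => (h.bdd k hk _).1))
        have b2 := abs_le.1 (abs_log_le_of_mem
          (avg_mem (φ := pin (f k) s false) hG fun σ => (h.bdd k hk _).1))
        have b3 := abs_le.1 (abs_log_le_of_mem
          (avg_mem (φ := pin (f' k) s true) hG' fun σ => (h.bdd k hk _).2))
        have b4 := abs_le.1 (abs_log_le_of_mem
          (avg_mem (φ := pin (f' k) s false) hG' fun σ => (h.bdd k hk _).2))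
        rw [abs_le]
        constructor <;> nlinarith
      · set W := (Vs.erase s).filter (fun s' => b s' k = true) with hW
        set J : V → ℝ := fun s' => infl c b a r (Vs.erase s) (Es.erase k) s' with hJ
        have key : ∀ ε, |Real.log (avg (hybrid Es f s k (β k)) (pin (f k) s ε)) -
            Real.log (avg (hybrid Es f' s k (β k)) (pin (f k) s ε))| ≤
            (Real.exp (2 * U) - 1) / 2 * ∑ s' ∈ W, J s' := by
          intro ε
          have hbd : ∀ σ, Real.exp (-U) ≤ pin (f k) s ε σ ∧ pin (f k) s ε σ ≤ Real.exp U :=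
            fun σ => (h.bdd k hk _).1
          refine abs_log_avg_sub_le hG hG' hbd ?_
          -- The relation retains only that both weights come from a factor pair without `s` and
          -- `k`. Pinning preserves this, and the induction hypothesis then bounds the change of
          -- every conditional mean by the paths that start from the neighbour.
          refine abs_avg_sub_avg_le (fun W' G G' => W' ⊆ W ∧ ∃ h h' : E → (V → Bool) → ℝ,
            FactorPair U b a (Vs.erase s) (Es.erase k) h h' ∧ G = prodWeight (Es.erase k) h ∧
            G' = prodWeight (Es.erase k) h') J ?_ ?_ ?_ W ?_ _ _ _ ?_ ?_ hbd
          · rintro W' _ _ ⟨_, h, h', hh, rfl, rfl⟩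
            exact ⟨fun σ => Finset.prod_pos fun l hl =>
              (Real.exp_pos _).trans_le (hh.bdd l hl σ).1.1, fun σ => Finset.prod_pos fun l hl =>
              (Real.exp_pos _).trans_le (hh.bdd l hl σ).2.1⟩
          · rintro W' w _ _ _ ⟨hsub, h, h', hh, rfl, rfl⟩
            refine ih _ _ _ _ _ ?_ ?_ hh
            · rw [Finset.card_erase_of_mem hk]; omega
            · exact (Finset.mem_filter.1 (hsub (Finset.mem_insert_self _ _))).1
          · rintro W' w _ _ _ ⟨hsub, h, h', hh, rfl, rfl⟩ ε
            exact ⟨(Finset.subset_insert _ _).trans hsub, _, _,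
              hh.pin_mono subset_rfl subset_rfl w (Finset.subset_insert _ _) (fun _ => ε), rfl, rfl⟩
          · exact Real.exp_le_exp.2 (by linarith)
          · refine ⟨subset_rfl, _, _, h.pin_mono (Finset.erase_subset k Es)
              (Finset.erase_subset s Vs) s ?_ _, rfl, rfl⟩
            rw [Finset.insert_erase hs]
          · intro v hv
            rcases eq_or_ne v s with rfl | hvs
            · exact ind_pin_self _ _ _
            · refine Ind.pin ?_ _ _
              by_cases hvV : v ∈ Vs
              · refine (h.ind k hk v hvV ?_).1
                by_contra hvb
                exact hv (by simp [hW, hvs, hvV, hvb])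
              · exact hout v hvV
        have k1 := abs_le.1 (key true)
        have k2 := abs_le.1 (key false)
        rw [← hff]
        have e : ∑ s' ∈ Vs.erase s,
            ((if b s' k then infl c b a r (Vs.erase s) (Es.erase k) s' else 0 : ℝ≥0) : ℝ) =
            ∑ s' ∈ W, J s' := by
          rw [hW, Finset.sum_filter]
          refine Finset.sum_congr rfl fun s' _ => ?_
          split_ifs <;> simp [hJ]
        rw [e, hc]
        have := (a k).coe_nonneg
        rw [abs_le]
        constructor <;> linarith

end Gibbs

/-! ### Product measures on spins and the log-ratio of a single clause. -/

section ProductAverage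

variable {V : Type*} [Fintype V] [DecidableEq V]

lemma spin_mul_mem {x : ℝ} (hx : |x| ≤ 1) (ε : Bool) : 0 ≤ (1 + spin ε * x) / 2 := by
  have := abs_le.1 hx
  cases ε <;> simp [spin] <;> linarith

lemma pin_prod (q : V → Bool → ℝ) (w : V) (ε : Bool) (σ : V → Bool) :
    pin (fun σ => ∏ v, q v (σ v)) w ε σ = q w ε * ∏ v ∈ Finset.univ.erase w, q v (σ v) := by
  simp only [pin]
  rw [← Finset.mul_prod_erase _ _ (Finset.mem_univ w)]
  congr 1
  · simp
  · exact Finset.prod_congr rfl fun v hv => by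
      rw [Function.update_of_ne (Finset.ne_of_mem_erase hv)]

lemma sum_mul_prod_erase (x : V → ℝ) (φ : (V → Bool) → ℝ) (w : V) (hφ : Ind φ w) :
    ∑ σ, φ σ * ∏ v ∈ Finset.univ.erase w, ((1 + spin (σ v) * x v) / 2) =
      2 * productAverage x φ := by
  rw [productAverage,
    ← sum_pin_add_sum_pin (fun σ => φ σ * ∏ v, ((1 + spin (σ v) * x v) / 2)) w,
    ← Finset.sum_add_distrib]
  refine Finset.sum_congr rfl fun σ => ?_
  intro _
  have e : ∀ ε, pin (fun σ => φ σ * ∏ v, ((1 + spin (σ v) * x v) / 2)) w ε σ =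
      φ σ * ((1 + spin ε * x w) / 2 *
        ∏ v ∈ Finset.univ.erase w, ((1 + spin (σ v) * x v) / 2)) := by
    intro ε
    rw [← pin_prod (fun v ε => (1 + spin ε * x v) / 2)]
    change pin φ w ε σ * _ = _
    rw [hφ.pin_eq]
    rfl
  rw [e, e]
  simp only [spin]
  simp
  ring

lemma productAverage_eq_pin (x : V → ℝ) (φ : (V → Bool) → ℝ) (w : V) :
    productAverage x φ = (1 + x w) / 2 * productAverage x (pin φ w true) +
      (1 - x w) / 2 * productAverage x (pin φ w false) := by
  have h := sum_pin_add_sum_pin (fun σ => φ σ * ∏ v, ((1 + spin (σ v) * x v) / 2)) w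
  have e : ∀ ε, ∑ σ, pin (fun σ => φ σ * ∏ v, ((1 + spin (σ v) * x v) / 2)) w ε σ =
      (1 + spin ε * x w) / 2 * (2 * productAverage x (pin φ w ε)) := by
    intro ε
    rw [← sum_mul_prod_erase x _ w (ind_pin_self φ w ε), Finset.mul_sum]
    refine Finset.sum_congr rfl fun σ _ => ?_
    have := pin_prod (fun v ε => (1 + spin ε * x v) / 2) w ε σ
    change pin φ w ε σ * pin (fun σ => ∏ v, ((1 + spin (σ v) * x v) / 2)) w ε σ = _
    rw [this]
    ring
  have s1 : spin true = 1 := by simp [spin]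
  have s2 : spin false = -1 := by simp [spin]
  rw [e, e, s1, s2, ← productAverage] at h
  linarith

lemma sum_productWeight (x : V → ℝ) : ∑ σ : V → Bool, ∏ v, ((1 + spin (σ v) * x v) / 2) = 1 := by
  have := (Finset.prod_univ_sum (fun _ : V => (Finset.univ : Finset Bool))
    (fun v ε => (1 + spin ε * x v) / 2)).symm
  rw [Fintype.piFinset_univ] at this
  rw [this]
  refine Finset.prod_eq_one fun v _ => ?_
  simp [spin]
  ring

lemma productAverage_mem {x : V → ℝ} (hx : ∀ v, |x v| ≤ 1) {φ : (V → Bool) → ℝ} {lo hi : ℝ}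
    (h : ∀ σ, lo ≤ φ σ ∧ φ σ ≤ hi) : lo ≤ productAverage x φ ∧ productAverage x φ ≤ hi := by
  have hw : ∀ σ : V → Bool, 0 ≤ ∏ v, ((1 + spin (σ v) * x v) / 2) := fun σ =>
    Finset.prod_nonneg fun v _ => spin_mul_mem (hx v) _
  constructor
  · calc lo = ∑ σ : V → Bool, lo * ∏ v, ((1 + spin (σ v) * x v) / 2) := by
          rw [← Finset.mul_sum, sum_productWeight, mul_one]
      _ ≤ _ := Finset.sum_le_sum fun σ _ => mul_le_mul_of_nonneg_right (h σ).1 (hw σ)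
  · calc productAverage x φ ≤ ∑ σ : V → Bool, hi * ∏ v, ((1 + spin (σ v) * x v) / 2) :=
          Finset.sum_le_sum fun σ _ => mul_le_mul_of_nonneg_right (h σ).2 (hw σ)
      _ = hi := by rw [← Finset.mul_sum, sum_productWeight, mul_one]

lemma productAverage_const (x : V → ℝ) (r : ℝ) : productAverage x (fun _ => r) = r := by
  rw [productAverage, ← Finset.mul_sum, sum_productWeight, mul_one]

/-- The comparison of `abs_avg_sub_avg_le` for product measures. Pinning leaves the other means
unchanged, and means equal to `±1`, where the weight is no longer positive, are allowed. -/
lemma abs_productAverage_sub_le {x y : V → ℝ} (hx : ∀ v, |x v| ≤ 1) (hy : ∀ v, |y v| ≤ 1)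
    {lo hi : ℝ} (W : Finset V) : ∀ φ : (V → Bool) → ℝ,
    (∀ v, v ∉ W → Ind φ v) → (∀ σ, lo ≤ φ σ ∧ φ σ ≤ hi) →
    |productAverage x φ - productAverage y φ| ≤ (hi - lo) / 2 * ∑ w ∈ W, |x w - y w| := by
  induction W using Finset.induction_on with
  | empty =>
    intro φ hφ _
    have hc : φ = fun _ => φ (fun _ => true) := funext fun σ =>
      eq_of_forall_ind (fun v => hφ v (Finset.notMem_empty v)) _ _
    rw [hc, productAverage_const, productAverage_const]
    simp
  | insert w W hw ih =>
    intro φ hφ hb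
    have hi' : ∀ ε, ∀ v, v ∉ W → Ind (pin φ w ε) v := by
      intro ε v hv
      rcases eq_or_ne v w with rfl | hvw
      · exact ind_pin_self _ _ _
      · exact (hφ v (by simp [hv, hvw])).pin _ _
    have hb' : ∀ ε σ, lo ≤ pin φ w ε σ ∧ pin φ w ε σ ≤ hi := fun ε σ => hb _
    have it := ih _ (hi' true) (hb' true)
    have jf := ih _ (hi' false) (hb' false)
    have a1 := productAverage_mem hx (hb' true)
    have a2 := productAverage_mem hx (hb' false)
    have m := abs_le.1 (hy w)
    rw [productAverage_eq_pin x φ w, productAverage_eq_pin y φ w, Finset.sum_insert hw]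
    set p := x w
    set q := y w
    set A := productAverage x (pin φ w true)
    set B := productAverage x (pin φ w false)
    set A' := productAverage y (pin φ w true)
    set B' := productAverage y (pin φ w false)
    set D := (hi - lo) / 2 * ∑ w ∈ W, |x w - y w|
    have e : (1 + p) / 2 * A + (1 - p) / 2 * B - ((1 + q) / 2 * A' + (1 - q) / 2 * B') =
        (p - q) * ((A - B) / 2) + ((1 + q) / 2 * (A - A') + (1 - q) / 2 * (B - B')) := by ring
    rw [e, mul_add]
    refine (abs_add_le _ _).trans (add_le_add ?_ ?_)
    · rw [abs_mul, mul_comm]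
      refine mul_le_mul_of_nonneg_right ?_ (abs_nonneg _)
      rw [abs_le]; constructor <;> linarith
    · change _ ≤ D
      refine (abs_add_le _ _).trans ?_
      rw [abs_mul, abs_mul, abs_of_nonneg (by linarith : 0 ≤ (1 + q) / 2),
        abs_of_nonneg (by linarith : 0 ≤ (1 - q) / 2)]
      have h1 := mul_le_mul_of_nonneg_left it (by linarith : 0 ≤ (1 + q) / 2)
      have h2 := mul_le_mul_of_nonneg_left jf (by linarith : 0 ≤ (1 - q) / 2)
      linarith

lemma productAverage_eq_avg (x : V → ℝ) (φ : (V → Bool) → ℝ) :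
    productAverage x φ = avg (fun σ => ∏ v, ((1 + spin (σ v) * x v) / 2)) φ := by
  rw [avg, sum_productWeight, div_one, productAverage]

/-- The other factors need only be positive, not normalized; a pinned coordinate can thus carry a
constant factor. -/
lemma mag_prod {q : V → Bool → ℝ} (hq : ∀ v ε, 0 < q v ε) {w : V} {t : ℝ}
    (hw : ∀ ε, q w ε = (1 + spin ε * t) / 2) : mag (fun σ => ∏ v, q v (σ v)) w = t := by
  rw [mag_eq]
  simp only [pin_prod, ← Finset.mul_sum]
  have : 0 < ∑ σ : V → Bool, ∏ v ∈ Finset.univ.erase w, q v (σ v) :=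
    sum_weight_pos fun σ => Finset.prod_pos fun v _ => hq _ _
  rw [← sub_mul, ← add_mul, mul_div_mul_right _ _ this.ne', hw, hw]
  simp [spin]
  ring

/-- The factor of a clause with the neighbours `W` and the additional field `h ε`. -/
def clauseFactor (u : ℝ → ℝ) (W : Finset V) (g : V → ℝ) (h : ℝ) (ε : Bool) (σ : V → Bool) : ℝ :=
  Real.exp (u (∑ v ∈ W, g v * spin (σ v) + h * spin ε))

/-- The contribution of a clause to the logarithm of the odds of a spin, when the means of the
neighbours are `x` and the neighbours are independent. -/
def clauseLog (u : ℝ → ℝ) (W : Finset V) (g : V → ℝ) (h : ℝ) (x : V → ℝ) : ℝ :=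
  Real.log (productAverage x (clauseFactor u W g h true)) -
    Real.log (productAverage x (clauseFactor u W g h false))

lemma exp_mem {u : ℝ → ℝ} {U : ℝ} (hu : ∀ t, |u t| ≤ U) (t : ℝ) :
    Real.exp (-U) ≤ Real.exp (u t) ∧ Real.exp (u t) ≤ Real.exp U :=
  ⟨Real.exp_le_exp.2 (abs_le.1 (hu t)).1, Real.exp_le_exp.2 (abs_le.1 (hu t)).2⟩

lemma ind_clauseFactor {u : ℝ → ℝ} {W : Finset V} {g : V → ℝ} {h : ℝ} {ε : Bool} {v : V}
    (hv : v ∉ W) : Ind (clauseFactor u W g h ε) v := by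
  intro δ
  funext σ
  simp only [pin, clauseFactor]
  congr 3
  refine Finset.sum_congr rfl fun w hw => ?_
  rw [Function.update_of_ne (ne_of_mem_of_not_mem hw hv)]

/-- Each of the two values of the cavity spin contributes the constant of `abs_log_avg_sub_le`. The
sum is halved later, inside `tanh`. -/
lemma abs_clauseLog_sub_le {u : ℝ → ℝ} {U : ℝ} (hu : ∀ t, |u t| ≤ U) (W : Finset V) (g : V → ℝ)
    (h : ℝ) {x y : V → ℝ} (hx : ∀ v, |x v| ≤ 1) (hy : ∀ v, |y v| ≤ 1) :
    |clauseLog u W g h x - clauseLog u W g h y| ≤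
      (Real.exp (2 * U) - 1) * ∑ w ∈ W, |x w - y w| := by
  have key : ∀ ε, |Real.log (productAverage x (clauseFactor u W g h ε)) -
      Real.log (productAverage y (clauseFactor u W g h ε))| ≤
      (Real.exp (2 * U) - 1) / 2 * ∑ w ∈ W, |x w - y w| := by
    intro ε
    have hb : ∀ σ : V → Bool, Real.exp (-U) ≤ clauseFactor u W g h ε σ ∧
      clauseFactor u W g h ε σ ≤ Real.exp U := fun σ => exp_mem hu _
    refine (abs_log_sub_log_le (productAverage_mem hx hb).1 (productAverage_mem hy hb).1).trans ?_
    have h3 := abs_productAverage_sub_le hx hy W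
      (clauseFactor u W g h ε) (fun v hv => ind_clauseFactor hv) hb
    refine (mul_le_mul_of_nonneg_left h3 (Real.exp_pos U).le).trans (le_of_eq ?_)
    have e1 : Real.exp (2 * U) = Real.exp U * Real.exp U := by rw [← Real.exp_add]; ring_nf
    have e2 : Real.exp U * Real.exp (-U) = 1 := by rw [← Real.exp_add]; simp
    rw [e1]
    linear_combination (- (∑ w ∈ W, |x w - y w|) / 2) * e2
  have k1 := abs_le.1 (key true)
  have k2 := abs_le.1 (key false)
  rw [clauseLog, clauseLog, abs_le]
  constructor <;> linarith

end ProductAverage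

/-! ### The mean of a spin compared with its cavity expression. -/

section Systems

variable {V E : Type*} [Fintype V] [DecidableEq V] [DecidableEq E]

/-- The factor of the clause `k` in the system with the set of spins `Vs`. -/
def factor (u : ℝ → ℝ) (Vs : Finset V) (y : V × E → Bool × ℝ) (k : E) (σ : V → Bool) : ℝ :=
  Real.exp (u (∑ v ∈ Vs.filter (fun v => (y (v, k)).1 = true), (y (v, k)).2 * spin (σ v)))

/-- The magnetization at `v` of the system with the spins `Vs` and the clauses `Es`. -/
def sysMag (u : ℝ → ℝ) (Vs : Finset V) (Es : Finset E) (y : V × E → Bool × ℝ) (v : V) : ℝ :=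
  mag (prodWeight Es (factor u Vs y)) v

/-- The clauses that contain a spin of `Q`. -/
def touched (Q : Finset V) (Es : Finset E) (b : V → E → Bool) : Finset E :=
  Es.filter (fun k => ∃ i ∈ Q, b i k = true)

/-- The spins of `Vs` that belong to the clause `k`. -/
def nbhd (Vs : Finset V) (b : V → E → Bool) (k : E) : Finset V := Vs.filter (fun v => b v k = true)

/-- The clauses at which the cavity system is perturbed, seen from the spin `s` of the
clause `k`. -/
def perturbed (U : ℝ≥0) (Q Vs : Finset V) (b : V → E → Bool) (k : E) (s : V) (l : E) : ℝ≥0 :=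
  if (∃ i ∈ Q, b i l = true) ∨ ∃ s' ∈ (nbhd Vs b k).erase s, b s' l = true then 2 * U else 0

/-- The array of the Booleans in `y`. -/
def bools (y : V × E → Bool × ℝ) (v : V) (k : E) : Bool := (y (v, k)).1

lemma ind_factor {u : ℝ → ℝ} {Vs : Finset V} {y : V × E → Bool × ℝ} {k : E} {v : V}
    (hv : v ∉ nbhd Vs (bools y) k) : Ind (factor u Vs y k) v := by
  intro δ
  funext σ
  simp only [pin, factor]
  congr 2
  refine Finset.sum_congr rfl fun w hw => ?_
  rw [Function.update_of_ne (ne_of_mem_of_not_mem hw hv)]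

lemma abs_sysMag_lt_one (u : ℝ → ℝ) (Vs : Finset V) (Es : Finset E) (y : V × E → Bool × ℝ)
    (v : V) : |sysMag u Vs Es y v| < 1 :=
  abs_mag_lt_one (fun _ => Finset.prod_pos fun _ _ => Real.exp_pos _) v

/-- The magnetization at a spin `i` of `Q` whose clauses contain no other spin of `Q`, in terms of
the magnetizations of the system with `Q` and its clauses removed. -/
theorem abs_sysMag_sub_tanh_le {u : ℝ → ℝ} {U c : ℝ≥0} (hu : ∀ t, |u t| ≤ U)
    (hc : (c : ℝ) = (Real.exp (2 * U) - 1) / 2) {Vs Q : Finset V} {Es : Finset E}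
    (y : V × E → Bool × ℝ) {i : V} (hi : i ∈ Q) (hQ : Q ⊆ Vs)
    (hgood : ∀ k ∈ Es, bools y i k = true → ∀ j ∈ Q, bools y j k = true → j = i) :
    |sysMag u Vs Es y i - Real.tanh ((∑ k ∈ Es, if bools y i k then
        clauseLog u (nbhd (Vs \ Q) (bools y) k) (fun v => (y (v, k)).2) (y (i, k)).2
          (sysMag u (Vs \ Q) (Es \ touched Q Es (bools y)) y) else 0) / 2)| ≤
      c * ∑ k ∈ Es, if bools y i k then ∑ s ∈ nbhd (Vs \ Q) (bools y) k,
        (infl c (bools y) (perturbed U Q (Vs \ Q) (bools y) k s) Es.card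
          ((Vs \ Q) \ (nbhd (Vs \ Q) (bools y) k).erase s) (Es.erase k) s : ℝ) else 0 := by
  set b := bools y with hb
  set Vs' := Vs \ Q with hVs'
  set T := touched Q Es b with hT
  set x := sysMag u Vs' (Es \ T) y with hx
  set f := factor u Vs y with hf
  -- The reduced system, written over all of `Es`: a touched clause gets the factor `1`. Both
  -- systems then have the same clauses and differ only where `perturbed` equals `2 * U`.
  set f₀ : E → (V → Bool) → ℝ := fun k => if k ∈ T then fun _ => 1 else factor u Vs' y k with hf₀
  have hU : (0 : ℝ) ≤ U := U.2
  have hfpos : ∀ k ∈ Es, ∀ σ, 0 < f k σ := fun k _ σ => Real.exp_pos _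
  have hfbd : ∀ k σ, Real.exp (-U) ≤ f k σ ∧ f k σ ≤ Real.exp U := fun k σ => exp_mem hu _
  have hf₀bd : ∀ k σ, Real.exp (-U) ≤ f₀ k σ ∧ f₀ k σ ≤ Real.exp U := by
    intro k σ
    simp only [hf₀]
    split_ifs
    · exact ⟨Real.exp_le_one_iff.2 (by linarith), Real.one_le_exp hU⟩
    · exact exp_mem hu _
  have hf₀ind : ∀ k v, v ∉ nbhd Vs' b k → Ind (f₀ k) v := by
    intro k v hv
    simp only [hf₀]
    split_ifs
    · intro ε; rfl
    · exact ind_factor hv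
  have hff₀ : ∀ k ∈ Es, k ∉ T → f k = f₀ k := by
    intro k hk hkT
    simp only [hf₀, hkT, if_false]
    funext σ
    simp only [hf, factor]
    congr 3
    ext v
    simp only [Finset.mem_filter, hVs', Finset.mem_sdiff]
    refine ⟨fun ⟨h1, h2⟩ => ⟨⟨h1, fun hvQ => hkT ?_⟩, h2⟩, fun ⟨h1, h2⟩ => ⟨h1.1, h2⟩⟩
    exact Finset.mem_filter.2 ⟨hk, v, hvQ, h2⟩
  obtain ⟨β, hβ⟩ := exists_mag_prodWeight_eq Es i
  rw [sysMag, hβ f hfpos]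
  refine (abs_tanh_sub_tanh_le _ _).trans ?_
  rw [← sub_div, ← Finset.sum_sub_distrib, abs_div, abs_two, div_le_iff₀ two_pos]
  refine (Finset.abs_sum_le_sum_abs _ _).trans ?_
  rw [Finset.mul_sum, Finset.sum_mul]
  refine Finset.sum_le_sum fun k hk => ?_
  cases hik : b i k
  · have hi' : Ind (f k) i := ind_factor (by
      simp only [nbhd, Finset.mem_filter, not_and]
      intro _
      simp [← hb, hik])
    simp [hi'.pin_eq]
  · simp only [if_true]
    have hkT : k ∈ T := Finset.mem_filter.2 ⟨hk, i, hi, hik⟩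
    set S := nbhd Vs' b k with hS
    have hG : ∀ σ, 0 < hybrid Es f i k (β k) σ := fun σ =>
      Finset.prod_pos fun l hl => hfpos l (Finset.mem_of_mem_erase hl) _
    set Gx : (V → Bool) → ℝ := fun σ => ∏ v, ((1 + spin (σ v) * x v) / 2) with hGx
    have hxlt : ∀ v, |x v| < 1 := fun v => abs_sysMag_lt_one _ _ _ _ _
    have hxpos : ∀ v ε, 0 < (1 + spin ε * x v) / 2 := by
      intro v ε
      have := abs_lt.1 (hxlt v)
      cases ε <;> simp [spin] <;> linarith
    have hGxpos : ∀ σ, 0 < Gx σ := fun σ => Finset.prod_pos fun v _ => hxpos _ _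
    -- Since `i` is the only spin of `Q` in `k`, the pinned factor depends only on the neighbours
    -- outside `Q`.
    have hpinf : ∀ ε, pin (f k) i ε =
        clauseFactor u S (fun v => (y (v, k)).2) (y (i, k)).2 ε := by
      intro ε
      funext σ
      simp only [pin, hf, factor, clauseFactor]
      congr 2
      have hset : Vs.filter (fun v => (y (v, k)).1 = true) = insert i S := by
        ext v
        simp only [hS, nbhd, Finset.mem_filter, Finset.mem_insert, hVs', Finset.mem_sdiff]
        constructor
        · rintro ⟨h1, h2⟩
          by_cases hvQ : v ∈ Q
          · exact Or.inl (hgood k hk hik v hvQ h2)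
          · exact Or.inr ⟨⟨h1, hvQ⟩, h2⟩
        · rintro (rfl | ⟨h1, h2⟩)
          · exact ⟨hQ hi, hik⟩
          · exact ⟨h1.1, h2⟩
      have hiS : i ∉ S := by simp [hS, nbhd, hVs', hi]
      rw [hset, Finset.sum_insert hiS, add_comm]
      congr 1
      · refine Finset.sum_congr rfl fun v hv => ?_
        rw [Function.update_of_ne (ne_of_mem_of_not_mem hv hiS)]
      · simp
    -- The clause `k` is touched, so its factor in `f₀` is `1` and erasing it changes nothing.
    have hxmag : ∀ w, x w = mag (prodWeight (Es.erase k) f₀) w := by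
      intro w
      simp only [hx, sysMag]
      congr 1
      funext σ
      simp only [prodWeight]
      rw [Finset.prod_congr rfl (fun l (hl : l ∈ Es \ T) => show factor u Vs' y l σ = f₀ l σ by
        simp [hf₀, (Finset.mem_sdiff.1 hl).2])]
      refine Finset.prod_subset ?_ ?_
      · intro l hl
        rw [Finset.mem_sdiff] at hl
        exact Finset.mem_erase.2 ⟨fun h => hl.2 (h ▸ hkT), hl.1⟩
      · intro l hl hl'
        have : l ∈ T := by
          by_contra hlT
          exact hl' (Finset.mem_sdiff.2 ⟨Finset.mem_of_mem_erase hl, hlT⟩)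
        simp [hf₀, this]
    set J : V → ℝ := fun s => infl c b (perturbed U Q Vs' b k s) Es.card (Vs' \ S.erase s)
      (Es.erase k) s with hJ
    have key : ∀ ε, |Real.log (avg (hybrid Es f i k (β k)) (pin (f k) i ε)) -
        Real.log (avg Gx (pin (f k) i ε))| ≤ (Real.exp (2 * U) - 1) / 2 * ∑ s ∈ S, J s := by
      intro ε
      have hbd : ∀ σ, Real.exp (-U) ≤ pin (f k) i ε σ ∧ pin (f k) i ε σ ≤ Real.exp U :=
        fun σ => hfbd k _
      refine abs_log_avg_sub_le hG hGxpos hbd ?_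
      -- The true measure is compared with the product measure of means `x` by revealing the spins
      -- of `S` in turn. Here `W` holds the spins not yet revealed: they still have mean `x` in the
      -- product, and a clause factor can differ from `f₀` only if the clause is touched or contains
      -- a revealed spin.
      refine abs_avg_sub_avg_le (fun W G G' => W ⊆ S ∧ (∃ h : E → (V → Bool) → ℝ,
        (∀ l σ, Real.exp (-U) ≤ h l σ ∧ h l σ ≤ Real.exp U) ∧
        (∀ l, ∀ v ∈ Vs', b v l = false → Ind (h l) v) ∧
        (∀ l ∈ Es.erase k, l ∈ T ∨ (∃ s ∈ S, s ∉ W ∧ b s l = true) ∨ h l = f₀ l) ∧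
        G = prodWeight (Es.erase k) h) ∧ ∃ q : V → Bool → ℝ, (∀ v ε, 0 < q v ε) ∧
        (∀ w ∈ W, ∀ ε, q w ε = (1 + spin ε * x w) / 2) ∧ G' = fun σ => ∏ v, q v (σ v))
        J ?_ ?_ ?_ S ?_ _ _ _ ?_ ?_ hbd
      · rintro W _ _ ⟨_, ⟨h, h1, _, _, rfl⟩, q, hq, _, rfl⟩
        exact ⟨fun σ => Finset.prod_pos fun l _ => (Real.exp_pos _).trans_le (h1 l σ).1,
          fun σ => Finset.prod_pos fun v _ => hq _ _⟩
      · rintro W w _ _ hw ⟨hsub, ⟨h, h1, h2, h3, rfl⟩, q, hq, hqw, rfl⟩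
        -- The number `x w` is itself a mean in the system `f₀`, so two systems of factors are
        -- compared. The other spins of `S` leave the spin set, which is possible because every
        -- clause that contains one of them counts as perturbed.
        rw [mag_prod hq (hqw w (Finset.mem_insert_self _ _)), hxmag]
        have hwS : w ∈ S := hsub (Finset.mem_insert_self _ _)
        refine FactorPair.abs_mag_sub_le hU hc _ _ _ _ _ _ (Finset.card_le_card
          (Finset.erase_subset _ _)) ?_ ⟨?_, ?_, ?_⟩
        · simp only [Finset.mem_sdiff, Finset.mem_erase, ne_eq, not_true, false_and,
            not_false_iff, and_true]
          exact (Finset.mem_filter.1 hwS).1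
        · exact fun l _ σ => ⟨h1 l σ, hf₀bd l σ⟩
        · intro l _ v hv hvl
          refine ⟨h2 l v (Finset.mem_sdiff.1 hv).1 hvl, hf₀ind l v ?_⟩
          simp [nbhd, hvl]
        · intro l hl
          by_cases hpert : (∃ i ∈ Q, b i l = true) ∨ ∃ s' ∈ S.erase w, b s' l = true
          · left
            simp only [perturbed]
            rw [if_pos hpert]
            push_cast
            exact le_rfl
          · right
            have hlT : l ∉ T := fun h => hpert (Or.inl (Finset.mem_filter.1 h).2)
            have hhl : h l = f₀ l := by
              rcases h3 l hl with h | ⟨s, hs, hsW, hsl⟩ | h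
              · exact absurd h hlT
              · exact absurd (Or.inr ⟨s, Finset.mem_erase.2 ⟨fun e => hsW (by simp [e]), hs⟩, hsl⟩)
                  hpert
              · exact h
            refine ⟨hhl, fun v hv => ?_⟩
            rw [hhl]
            refine hf₀ind l v fun hvn => ?_
            have hvn' := Finset.mem_filter.1 hvn
            have : v ∈ S.erase w := by
              by_contra hc'
              exact hv (Finset.mem_sdiff.2 ⟨hvn'.1, hc'⟩)
            exact hpert (Or.inr ⟨v, this, hvn'.2⟩)
      · rintro W w _ _ hw ⟨hsub, ⟨h, h1, h2, h3, rfl⟩, q, hq, hqw, rfl⟩ δ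
        refine ⟨(Finset.subset_insert _ _).trans hsub, ⟨fun l => pin (h l) w δ,
          fun l σ => h1 l _, fun l v hv hvl => (h2 l v hv hvl).pin _ _, ?_, rfl⟩,
          fun v ε => if v = w then q w δ else q v ε, ?_, ?_, ?_⟩
        · intro l hl
          rcases h3 l hl with h | ⟨s, hs, hsW, hsl⟩ | h
          · exact Or.inl h
          · exact Or.inr (Or.inl ⟨s, hs, fun h => hsW (Finset.mem_insert_of_mem h), hsl⟩)
          · cases hwl : b w l
            · refine Or.inr (Or.inr ?_)
              simp only [h]
              exact hf₀ind l w (by simp [nbhd, hwl]) δ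
            · exact Or.inr (Or.inl ⟨w, hsub (Finset.mem_insert_self _ _), hw, hwl⟩)
        · intro v ε
          dsimp only
          split_ifs <;> exact hq _ _
        · intro v hv ε
          simp only [if_neg (ne_of_mem_of_not_mem hv hw)]
          exact hqw v (Finset.mem_insert_of_mem hv) ε
        · funext σ
          simp only [pin]
          refine Finset.prod_congr rfl fun v _ => ?_
          by_cases hvw : v = w
          · subst hvw; simp
          · simp [hvw]
      · exact Real.exp_le_exp.2 (by linarith)
      · refine ⟨subset_rfl, ⟨fun l => pin (f l) i (decide (l ∉ β k)), fun l σ => hfbd l _,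
          fun l v hv hvl => Ind.pin (ind_factor (by simp [nbhd, ← hb, hvl])) _ _, ?_, rfl⟩,
          fun v ε => (1 + spin ε * x v) / 2, hxpos, fun _ _ _ => rfl, rfl⟩
        intro l hl
        by_cases hlT : l ∈ T
        · exact Or.inl hlT
        · refine Or.inr (Or.inr ?_)
          simp only
          rw [hff₀ l (Finset.mem_of_mem_erase hl) hlT]
          refine hf₀ind l i ?_ _
          simp [nbhd, hVs', hi]
      · intro v hv
        rw [hpinf]
        exact ind_clauseFactor hv
    have k1 := abs_le.1 (key true)
    have k2 := abs_le.1 (key false)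
    rw [clauseLog, productAverage_eq_avg, productAverage_eq_avg, ← hpinf, ← hpinf, hc]
    rw [abs_le]
    constructor <;> linarith

end Systems

/-! ### Expectations over the Bernoulli variables. -/

section Expectation

/-- Resampling a coordinate of a family of independent variables. -/
lemma map_update_pi {ι X : Type*} [Fintype ι] [DecidableEq ι] [MeasurableSpace X]
    (ν : ι → Measure X) [∀ i, IsProbabilityMeasure (ν i)] (q : ι) :
    ((Measure.pi ν).prod (ν q)).map (fun z => Function.update z.1 q z.2) = Measure.pi ν := by
  have hm : Measurable (fun z : (ι → X) × X => Function.update z.1 q z.2) := by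
    refine measurable_pi_lambda _ fun i => ?_
    rcases eq_or_ne i q with rfl | h
    · simpa using measurable_snd
    · simp only [ne_eq, h, not_false_eq_true, Function.update_of_ne]
      exact (measurable_pi_apply i).comp measurable_fst
  refine (Measure.pi_eq fun s hs => ?_).symm
  rw [Measure.map_apply hm (MeasurableSet.univ_pi hs)]
  have : (fun z : (ι → X) × X => Function.update z.1 q z.2) ⁻¹' Set.univ.pi s =
      (Set.univ.pi (Function.update s q Set.univ)) ×ˢ s q := by
    ext ⟨y, x⟩
    simp only [Set.mem_preimage, Set.mem_univ_pi, Set.mem_prod]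
    constructor
    · intro h
      refine ⟨fun i => ?_, by simpa using h q⟩
      rcases eq_or_ne i q with rfl | hi
      · simp
      · simpa [hi] using h i
    · rintro ⟨h1, h2⟩ i
      rcases eq_or_ne i q with rfl | hi
      · simpa using h2
      · simpa [hi] using h1 i
  rw [this, Measure.prod_prod, Measure.pi_pi, ← Finset.mul_prod_erase _ _ (Finset.mem_univ q),
    ← Finset.mul_prod_erase _ (fun i => ν i (s i)) (Finset.mem_univ q)]
  simp only [Function.update_self, measure_univ, one_mul]
  rw [mul_comm]
  congr 1
  exact Finset.prod_congr rfl fun i hi => by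
    rw [Function.update_of_ne (Finset.ne_of_mem_erase hi)]

/-- The law of an entry of the disorder: a Bernoulli and an independent Gaussian variable. -/
def siteLaw (p : unitInterval) : Measure (Bool × ℝ) :=
  (bernoulliMeasure true false p).prod (gaussianReal 0 1)

instance (p : unitInterval) : IsProbabilityMeasure (siteLaw p) := by
  unfold siteLaw; infer_instance

lemma siteLaw_true (p : unitInterval) :
    siteLaw p {v | v.1 = true} = (unitInterval.toNNReal p : ℝ≥0∞) := by
  have : {v : Bool × ℝ | v.1 = true} = {true} ×ˢ Set.univ := by ext ⟨a, b⟩; simp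
  rw [this, siteLaw, Measure.prod_prod, measure_univ, mul_one, bernoulliMeasure_apply]
  · simp
  · exact measurableSet_singleton _

variable {V E : Type*} [Fintype V] [Fintype E] [DecidableEq V] [DecidableEq E]

/-- The law of the disorder. -/
def arrayLaw (V E : Type*) [Fintype V] [Fintype E] (p : unitInterval) :
    Measure (V × E → Bool × ℝ) := Measure.pi fun _ => siteLaw p

instance (p : unitInterval) : IsProbabilityMeasure (arrayLaw V E p) := by
  unfold arrayLaw; infer_instance

lemma measurable_bools : Measurable (bools : (V × E → Bool × ℝ) → V → E → Bool) :=
  measurable_pi_lambda _ fun v => measurable_pi_lambda _ fun k =>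
    measurable_fst.comp (measurable_pi_apply (v, k))

lemma measurable_comp_bools {β : Type*} [MeasurableSpace β] (F : (V → E → Bool) → β) :
    Measurable fun y : V × E → Bool × ℝ => F (bools y) :=
  (measurable_of_countable F).comp measurable_bools

/-- The expectation of a function of the Bernoulli variables. -/
def ex (p : unitInterval) (F : (V → E → Bool) → ℝ≥0) : ℝ≥0∞ :=
  ∫⁻ y, (F (bools y) : ℝ≥0∞) ∂arrayLaw V E p

variable (p : unitInterval)

lemma ex_mono {F G : (V → E → Bool) → ℝ≥0} (h : ∀ b, F b ≤ G b) : ex p F ≤ ex p G :=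
  lintegral_mono fun _ => ENNReal.coe_le_coe.2 (h _)

lemma ex_add (F G : (V → E → Bool) → ℝ≥0) : ex p (fun b => F b + G b) = ex p F + ex p G := by
  simp only [ex, ENNReal.coe_add]
  exact lintegral_add_left (measurable_comp_bools F).coe_nnreal_ennreal _

lemma ex_const_mul (c : ℝ≥0) (F : (V → E → Bool) → ℝ≥0) :
    ex p (fun b => c * F b) = c * ex p F := by
  simp only [ex, ENNReal.coe_mul]
  exact lintegral_const_mul _ (measurable_comp_bools F).coe_nnreal_ennreal

lemma ex_const (c : ℝ≥0) : ex (V := V) (E := E) p (fun _ => c) = c := by simp [ex]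

lemma ex_sum {ι : Type*} (s : Finset ι) (F : ι → (V → E → Bool) → ℝ≥0) :
    ex p (fun b => ∑ i ∈ s, F i b) = ∑ i ∈ s, ex p (F i) := by
  simp only [ex, ENNReal.ofNNReal_finsetSum]
  exact lintegral_finsetSum _ fun i _ => (measurable_comp_bools (F i)).coe_nnreal_ennreal

/-- The indicator of `b v k`. -/
def bi (v : V) (k : E) (b : V → E → Bool) : ℝ≥0 := if b v k then 1 else 0

/-- `F` does not depend on the entry `(v, k)`. -/
def NotDep (F : (V → E → Bool) → ℝ≥0) (v : V) (k : E) : Prop :=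
  ∀ b b', (∀ v' k', v' ≠ v ∨ k' ≠ k → b v' k' = b' v' k') → F b = F b'

lemma NotDep.mul {F G : (V → E → Bool) → ℝ≥0} {v : V} {k : E} (hF : NotDep F v k)
    (hG : NotDep G v k) : NotDep (fun b => F b * G b) v k :=
  fun b b' h => by simp only [hF b b' h, hG b b' h]

lemma notDep_bi {v' v : V} {k' k : E} (h : v' ≠ v ∨ k' ≠ k) : NotDep (bi v' k') v k :=
  fun b b' hb => by simp only [bi, hb v' k' h]

lemma notDep_const (c : ℝ≥0) (v : V) (k : E) : NotDep (fun _ => c) v k := fun _ _ _ => rfl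

/-- Independence through resampling: replacing the entry `(v, k)` by a fresh copy preserves the law
of the array, and `F` does not notice it. -/
lemma ex_bi_mul {F : (V → E → Bool) → ℝ≥0} {v : V} {k : E} (hF : NotDep F v k) :
    ex p (fun b => bi v k b * F b) = unitInterval.toNNReal p * ex p F := by
  have hm : Measurable (fun z : (V × E → Bool × ℝ) × (Bool × ℝ) =>
      Function.update z.1 (v, k) z.2) := by
    refine measurable_pi_lambda _ fun i => ?_
    rcases eq_or_ne i (v, k) with rfl | h
    · simpa using measurable_snd
    · simp only [ne_eq, h, not_false_eq_true, Function.update_of_ne]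
      exact (measurable_pi_apply i).comp measurable_fst
  have hF' := (measurable_comp_bools F).coe_nnreal_ennreal
  have h1 : ex p (fun b => bi v k b * F b) = ∫⁻ z, ((bi v k (bools (Function.update z.1 (v, k) z.2))
      * F (bools (Function.update z.1 (v, k) z.2)) : ℝ≥0) : ℝ≥0∞)
      ∂((arrayLaw V E p).prod (siteLaw p)) := by
    rw [ex, arrayLaw, ← map_update_pi (fun _ : V × E => siteLaw p) (v, k)]
    rw [lintegral_map (measurable_comp_bools fun b => bi v k b * F b).coe_nnreal_ennreal hm]
    rw [map_update_pi (fun _ : V × E => siteLaw p) (v, k)]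
  have h2 : ∀ z : (V × E → Bool × ℝ) × (Bool × ℝ),
      ((bi v k (bools (Function.update z.1 (v, k) z.2))
      * F (bools (Function.update z.1 (v, k) z.2)) : ℝ≥0) : ℝ≥0∞) =
      (F (bools z.1) : ℝ≥0∞) * Set.indicator {v : Bool × ℝ | v.1 = true} 1 z.2 := by
    intro z
    have e1 : F (bools (Function.update z.1 (v, k) z.2)) = F (bools z.1) := by
      refine hF _ _ fun v' k' h => ?_
      rw [bools, bools, Function.update_of_ne]
      simpa [Prod.ext_iff, imp_iff_not_or] using h
    have e2 : (bi v k (bools (Function.update z.1 (v, k) z.2)) : ℝ≥0∞) =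
        Set.indicator {v : Bool × ℝ | v.1 = true} 1 z.2 := by
      simp only [bi, bools, Set.indicator_apply, Function.update_self, Set.mem_ofPred_eq, Pi.one_apply]
      split_ifs <;> simp
    rw [e1, ENNReal.coe_mul, e2, mul_comm]
  have hset : MeasurableSet {v : Bool × ℝ | v.1 = true} :=
    measurable_fst (measurableSet_singleton true)
  rw [h1, lintegral_congr h2, lintegral_prod_mul hF'.aemeasurable
    ((measurable_one.indicator hset).aemeasurable), lintegral_indicator_one hset, siteLaw_true,
    mul_comm, ex]

lemma ex_bi (v : V) (k : E) : ex p (bi v k) = unitInterval.toNNReal p := by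
  have := ex_bi_mul p (notDep_const 1 v k)
  simpa [ex_const] using this

end Expectation

/-! ### Expected weight of self-avoiding paths. -/

section Influence

variable {V E : Type*} [Fintype V] [Fintype E] [DecidableEq V] [DecidableEq E]

lemma infl_congr (c : ℝ≥0) {b b' : V → E → Bool} (a : E → ℝ≥0) (r : ℕ) : ∀ {Vs : Finset V}
    {Es : Finset E} {s : V}, s ∈ Vs → (∀ v ∈ Vs, ∀ k ∈ Es, b v k = b' v k) →
    infl c b a r Vs Es s = infl c b' a r Vs Es s := by
  induction r with
  | zero => intros; rfl
  | succ r ih =>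
    intro Vs Es s hs h
    simp only [infl]
    refine Finset.sum_congr rfl fun k hk => ?_
    rw [h s hs k hk]
    congr 3
    refine Finset.sum_congr rfl fun s' hs' => ?_
    rw [h s' (Finset.mem_of_mem_erase hs') k hk, ih hs' fun v hv l hl =>
      h v (Finset.mem_of_mem_erase hv) l (Finset.mem_of_mem_erase hl)]

/-- The paths explore only entries of `Vs × Es`. Once a clause is erased, the remainder of a path is
therefore independent of the entries that led to it. -/
lemma notDep_infl (c : ℝ≥0) (a : E → ℝ≥0) (r : ℕ) {Vs : Finset V} {Es : Finset E} {s : V}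
    (hs : s ∈ Vs) {v : V} {k : E} (h : v ∉ Vs ∨ k ∉ Es) :
    NotDep (fun b => infl c b a r Vs Es s) v k := by
  intro b b' hb
  refine infl_congr c a r hs fun v' hv' k' hk' => hb _ _ ?_
  rcases h with h | h
  · exact Or.inl (ne_of_mem_of_not_mem hv' h)
  · exact Or.inr (ne_of_mem_of_not_mem hk' h)

lemma infl_mono (c : ℝ≥0) (b : V → E → Bool) (a : E → ℝ≥0) (r : ℕ) : ∀ {Vs Vs' : Finset V}
    (Es : Finset E) (s : V), Vs ⊆ Vs' → infl c b a r Vs Es s ≤ infl c b a r Vs' Es s := by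
  induction r with
  | zero => intros; exact le_rfl
  | succ r ih =>
    intro Vs Vs' Es s h
    simp only [infl]
    refine Finset.sum_le_sum fun k _ => ?_
    split_ifs
    · gcongr
      refine (Finset.sum_le_sum fun s' _ => ?_).trans
        (Finset.sum_le_sum_of_subset (Finset.erase_subset_erase s h))
      split_ifs
      · exact ih _ _ (Finset.erase_subset_erase s h)
      · exact le_rfl
    · exact le_rfl

/-- The paths are sorted by the clause `l` in which they end, which reduces all estimates to a
single target clause. -/
lemma infl_le_sum (c : ℝ≥0) (b : V → E → Bool) (a : E → ℝ≥0) (r : ℕ) : ∀ (Vs : Finset V)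
    (Es : Finset E) (s : V), infl c b a r Vs Es s ≤
      ∑ l ∈ Es, a l * infl c b (Pi.single l 1) r Vs Es s := by
  induction r with
  | zero => intros; simp [infl]
  | succ r ih =>
    intro Vs Es s
    simp only [infl, Finset.mul_sum]
    rw [Finset.sum_comm]
    refine Finset.sum_le_sum fun k hk => ?_
    split_ifs with hb
    · simp only [mul_add, Finset.sum_add_distrib]
      gcongr
      · refine le_trans ?_ (Finset.single_le_sum (f := fun l => a l * (Pi.single l 1 : E → ℝ≥0) k)
          (fun _ _ => zero_le) hk)
        simp
      · simp only [Finset.mul_sum]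
        rw [Finset.sum_comm]
        refine Finset.sum_le_sum fun s' hs' => ?_
        split_ifs
        · calc c * infl c b a r (Vs.erase s) (Es.erase k) s'
              ≤ c * ∑ l ∈ Es.erase k, a l *
                infl c b (Pi.single l 1) r (Vs.erase s) (Es.erase k) s' := by
                  gcongr; exact ih _ _ _
            _ ≤ c * ∑ l ∈ Es, a l *
                infl c b (Pi.single l 1) r (Vs.erase s) (Es.erase k) s' := by
                  gcongr; exact Finset.erase_subset _ _
            _ = _ := by rw [Finset.mul_sum]; exact Finset.sum_congr rfl fun _ _ => by ring
        · simp
    · simp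

/-- The expected weight of the self-avoiding paths from a spin to a clause. -/
lemma ex_infl_le (p : unitInterval) {c : ℝ≥0} (hc : c * (Fintype.card E * Fintype.card V *
      unitInterval.toNNReal p ^ 2) ≤ 1 / 2) (l : E) (r : ℕ) :
    ∀ (Vs : Finset V) (Es : Finset E) (s : V), s ∈ Vs →
    ex p (fun b => infl c b (Pi.single l 1) r Vs Es s) ≤
      ((2 * unitInterval.toNNReal p : ℝ≥0) : ℝ≥0∞) := by
  set P := unitInterval.toNNReal p with hP
  induction r with
  | zero => intro Vs Es s _; simp [infl, ex]
  | succ r ih =>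
    intro Vs Es s hs
    have e : (fun b : V → E → Bool => infl c b (Pi.single l 1) (r + 1) Vs Es s) = fun b =>
        ∑ k ∈ Es, (Pi.single l 1 : E → ℝ≥0) k * bi s k b + ∑ k ∈ Es, ∑ s' ∈ Vs.erase s,
          c * (bi s k b * (bi s' k b *
            infl c b (Pi.single l 1) r (Vs.erase s) (Es.erase k) s')) := by
      funext b
      rw [infl, ← Finset.sum_add_distrib]
      refine Finset.sum_congr rfl fun k _ => ?_
      simp only [bi]
      split_ifs
      · simp [Finset.mul_sum]
      · simp
    rw [e, ex_add, ex_sum, ex_sum]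
    simp only [ex_sum, ex_const_mul]
    have h1 : ∑ k ∈ Es, ((Pi.single l 1 : E → ℝ≥0) k : ℝ≥0∞) * ex p (bi s k) ≤ P := by
      simp only [ex_bi]
      rw [← Finset.sum_mul, ← ENNReal.ofNNReal_finsetSum]
      refine mul_le_of_le_one_left zero_le ?_
      rw [← ENNReal.coe_one, ENNReal.coe_le_coe]
      simp only [Pi.single_apply, Finset.sum_ite_eq']
      split_ifs <;> simp
    have h2 : ∀ k ∈ Es, ∀ s' ∈ Vs.erase s, (c : ℝ≥0∞) * ex p (fun b => bi s k b * (bi s' k b *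
            infl c b (Pi.single l 1) r (Vs.erase s) (Es.erase k) s')) ≤
        ((c * (P * (P * (2 * P))) : ℝ≥0) : ℝ≥0∞) := by
      intro k hk s' hs'
      have nd : ∀ v, NotDep (fun b => infl c b (Pi.single l 1) r (Vs.erase s) (Es.erase k) s') v k :=
        fun v => notDep_infl _ _ _ hs' (Or.inr (Finset.notMem_erase _ _))
      rw [ex_bi_mul p ((notDep_bi (Or.inl (Finset.ne_of_mem_erase hs'))).mul (nd s)),
        ex_bi_mul p (nd s')]
      push_cast
      gcongr
      exact (ih _ _ _ hs').trans (by push_cast; exact le_rfl)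
    refine (add_le_add h1 (Finset.sum_le_sum fun k hk => Finset.sum_le_sum fun s' hs' =>
      h2 k hk s' hs')).trans ?_
    simp only [Finset.sum_const, nsmul_eq_mul]
    -- The bound `2 * P` is the fixed point of `x ↦ P + x / 2`: ending at `l` costs `P`, and one
    -- more step has at most `card E * card V` choices, each of probability `P ^ 2` and weight `c`.
    have h3 : ((Es.card : ℝ≥0) * ((Vs.erase s).card * (c * (P * (P * (2 * P)))))) ≤ P := by
      calc ((Es.card : ℝ≥0) * ((Vs.erase s).card * (c * (P * (P * (2 * P))))))
          ≤ (Fintype.card E * (Fintype.card V * (c * (P * (P * (2 * P)))))) := by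
            gcongr
            · exact Finset.card_le_univ _
            · exact Finset.card_le_univ _
        _ = (c * (Fintype.card E * Fintype.card V * P ^ 2)) * (2 * P) := by ring
        _ ≤ (1 / 2) * (2 * P) := by gcongr
        _ = P := by rw [← mul_assoc]; norm_num
    refine le_trans ?_ (le_of_eq (show (P : ℝ≥0∞) + P = ((2 * P : ℝ≥0) : ℝ≥0∞) by
      push_cast; ring))
    gcongr
    calc _ = (((Es.card : ℝ≥0) * ((Vs.erase s).card * (c * (P * (P * (2 * P))))) : ℝ≥0) : ℝ≥0∞) := by
          push_cast; rfl
      _ ≤ P := ENNReal.coe_le_coe.2 h3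

end Influence

/-! ### Expected numbers of clauses, slots and coincidences around a set of spins. -/

section Counting

variable {V E : Type*} [Fintype V] [Fintype E] [DecidableEq V] [DecidableEq E]

/-- The only spin of `Q` in the clause `k`, if there is exactly one. -/
def owner (Q : Finset V) (b : V → E → Bool) (k : E) : Option V :=
  open Classical in
  if h : ∃ i ∈ Q, b i k = true ∧ ∀ j ∈ Q, b j k = true → j = i then some h.choose else none

lemma owner_spec {Q : Finset V} {b : V → E → Bool} {k : E} {i : V} (h : owner Q b k = some i) :
    i ∈ Q ∧ b i k = true ∧ ∀ j ∈ Q, b j k = true → j = i := by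
  unfold owner at h
  split_ifs at h with h'
  rw [Option.some_inj] at h
  rw [← h]
  exact h'.choose_spec

lemma owner_eq_some {Q : Finset V} {b : V → E → Bool} {k : E} {i : V} (hi : i ∈ Q)
    (hik : b i k = true) (h : ∀ j ∈ Q, b j k = true → j = i) : owner Q b k = some i := by
  have h' : ∃ i ∈ Q, b i k = true ∧ ∀ j ∈ Q, b j k = true → j = i := ⟨i, hi, hik, h⟩
  unfold owner
  rw [dif_pos h']
  congr 1
  exact h _ h'.choose_spec.1 h'.choose_spec.2.1

/-- The pairs `(s, k)` with `s` in the clause `k`, where `k` contains exactly one spin of `Q`. -/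
def slots (Q Vs : Finset V) (Es : Finset E) (b : V → E → Bool) : Finset (V × E) :=
  (Vs ×ˢ Es).filter (fun q => (owner Q b q.2).isSome ∧ b q.1 q.2 = true)

/-- The spins in the clauses with exactly one spin of `Q`. -/
def sites (Q Vs : Finset V) (Es : Finset E) (b : V → E → Bool) : Finset V :=
  (slots Q Vs Es b).image Prod.fst

/-- No clause of `i` contains another spin of `Q`. -/
def Isolated (Q : Finset V) (Es : Finset E) (b : V → E → Bool) (i : V) : Prop :=
  ∀ k ∈ Es, b i k = true → ∀ j ∈ Q, b j k = true → j = i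

instance (Q : Finset V) (Es : Finset E) (b : V → E → Bool) (i : V) :
    Decidable (Isolated Q Es b i) := by unfold Isolated; infer_instance

variable (p : unitInterval) (Q Vs : Finset V) (Es : Finset E)

local notation "ℙ" => unitInterval.toNNReal p

/-- Union bound: a spin that is not isolated shares a clause with a second spin of `Q`. -/
lemma ex_not_isolated_le : ex p (fun b => ∑ i ∈ Q, if Isolated Q Es b i then 0 else 1) ≤
    ((Q.card ^ 2 * Fintype.card E * ℙ ^ 2 : ℝ≥0) : ℝ≥0∞) := by
  calc ex p (fun b => ∑ i ∈ Q, if Isolated Q Es b i then 0 else 1)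
      ≤ ex p (fun b => ∑ i ∈ Q, ∑ k ∈ Es, ∑ j ∈ Q.erase i, bi i k b * bi j k b) := by
        refine ex_mono p fun b => Finset.sum_le_sum fun i _ => ?_
        split_ifs with h
        · exact zero_le
        · unfold Isolated at h
          push Not at h
          obtain ⟨k, hk, hik, j, hj, hjk, hji⟩ := h
          refine le_trans ?_ (Finset.single_le_sum (f := fun k => ∑ j ∈ Q.erase i,
            bi i k b * bi j k b) (fun _ _ => zero_le) hk)
          refine le_trans ?_ (Finset.single_le_sum (f := fun j => bi i k b * bi j k b)
            (fun _ _ => zero_le) (Finset.mem_erase.2 ⟨hji, hj⟩))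
          simp [bi, hik, hjk]
    _ ≤ ∑ i ∈ Q, ∑ k ∈ Es, ∑ j ∈ Q.erase i, ((ℙ ^ 2 : ℝ≥0) : ℝ≥0∞) := by
        simp only [ex_sum]
        refine Finset.sum_le_sum fun i _ => Finset.sum_le_sum fun k _ =>
          Finset.sum_le_sum fun j hj => ?_
        rw [ex_bi_mul p (notDep_bi (Or.inl (Finset.ne_of_mem_erase hj))), ex_bi]
        push_cast
        rw [sq]
    _ ≤ _ := by
        simp only [← ENNReal.ofNNReal_finsetSum]
        rw [ENNReal.coe_le_coe]
        simp only [Finset.sum_const, nsmul_eq_mul]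
        calc _ = ∑ i ∈ Q, (Es.card : ℝ≥0) * ((Q.erase i).card * ℙ ^ 2) := rfl
          _ ≤ ∑ i ∈ Q, (Fintype.card E : ℝ≥0) * (Q.card * ℙ ^ 2) := by
              gcongr
              · exact Finset.card_le_univ _
              · exact Finset.erase_subset _ _
          _ = _ := by simp; ring

/-- A clause `l` is perturbed because it contains a spin of `Q`, or a second neighbour `s'` from the
clause `k`. In the latter case the paths avoid `s'`, which keeps the entry `(s', l)` independent of
them. -/
lemma perturbed_mul_infl_le (U c : ℝ≥0) (b : V → E → Bool) (k : E) (s : V)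
    (l : E) (r : ℕ) : perturbed U Q Vs b k s l *
      infl c b (Pi.single l 1) r (Vs \ (nbhd Vs b k).erase s) (Es.erase k) s ≤
    2 * U * (∑ j ∈ Q, bi j l b * infl c b (Pi.single l 1) r Vs (Es.erase k) s +
      ∑ s' ∈ Vs.erase s, bi s' k b * (bi s' l b *
        infl c b (Pi.single l 1) r (Vs.erase s') (Es.erase k) s)) := by
  unfold perturbed
  split_ifs with h
  · gcongr
    rcases h with ⟨j, hj, hjl⟩ | ⟨s', hs', hl⟩
    · refine le_add_of_le_of_nonneg ?_ zero_le
      refine le_trans ?_ (Finset.single_le_sum (f := fun j => bi j l b *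
        infl c b (Pi.single l 1) r Vs (Es.erase k) s) (fun _ _ => zero_le) hj)
      simp only [bi, hjl, if_true, one_mul]
      exact infl_mono _ _ _ _ _ _ Finset.sdiff_subset
    · refine le_add_of_nonneg_of_le zero_le ?_
      obtain ⟨h1, h2⟩ := Finset.mem_erase.1 hs'
      obtain ⟨h3, h4⟩ := Finset.mem_filter.1 h2
      refine le_trans ?_ (Finset.single_le_sum (f := fun s' => bi s' k b * (bi s' l b *
        infl c b (Pi.single l 1) r (Vs.erase s') (Es.erase k) s)) (fun _ _ => zero_le)
        (Finset.mem_erase.2 ⟨h1, h3⟩))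
      simp only [bi, hl, h4, if_true, one_mul]
      refine infl_mono _ _ _ _ _ _ fun v hv => ?_
      obtain ⟨hv1, hv2⟩ := Finset.mem_sdiff.1 hv
      exact Finset.mem_erase.2 ⟨fun e => hv2 (e ▸ hs'), hv1⟩
  · simp

/-- The configurations counted are `i, s ∈ k` with a path from `s` to a clause `l` that contains
either a spin of `Q` or a third spin `s'` of `k`. The bits and the path have expected weight `2 * ℙ
^ 4` or `2 * ℙ ^ 5`. When `ℙ` is of order `1 / card V` and `card E` of order `card V`, the total is
of order `1 / card V`. -/
lemma ex_perturbed_le {U c : ℝ≥0} (hc : c * (Fintype.card E * Fintype.card V * ℙ ^ 2) ≤ 1 / 2)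
    (hQV : Disjoint Q Vs) :
    ex p (fun b => ∑ i ∈ Q, ∑ k ∈ Es, if b i k then ∑ s ∈ nbhd Vs b k,
      infl c b (perturbed U Q Vs b k s) Es.card (Vs \ (nbhd Vs b k).erase s) (Es.erase k) s
      else 0) ≤ ((Q.card * Fintype.card E * Fintype.card V * (Fintype.card E * (2 * U *
        (Q.card * (2 * ℙ ^ 4) + Fintype.card V * (2 * ℙ ^ 5)))) : ℝ≥0) : ℝ≥0∞) := by
  set r := Es.card
  calc _ ≤ ex p (fun b => ∑ i ∈ Q, ∑ k ∈ Es, ∑ s ∈ Vs, ∑ l ∈ Es.erase k, 2 * U * (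
        ∑ j ∈ Q, bi i k b * (bi s k b * (bi j l b *
          infl c b (Pi.single l 1) r Vs (Es.erase k) s)) +
        ∑ s' ∈ Vs.erase s, bi i k b * (bi s k b * (bi s' k b * (bi s' l b *
          infl c b (Pi.single l 1) r (Vs.erase s') (Es.erase k) s))))) := by
        refine ex_mono p fun b => Finset.sum_le_sum fun i _ => Finset.sum_le_sum fun k _ => ?_
        split_ifs with hik
        · rw [nbhd, Finset.sum_filter]
          refine Finset.sum_le_sum fun s _ => ?_
          split_ifs with hsk
          · refine (infl_le_sum _ _ _ _ _ _ _).trans (Finset.sum_le_sum fun l _ => ?_)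
            refine (perturbed_mul_infl_le Q Vs Es U c b k s l r).trans (le_of_eq ?_)
            simp [bi, hik, hsk]
          · exact zero_le
        · exact zero_le
    _ ≤ ∑ i ∈ Q, ∑ k ∈ Es, ∑ s ∈ Vs, ∑ l ∈ Es.erase k, ((2 * U * (Q.card * (2 * ℙ ^ 4) +
        Fintype.card V * (2 * ℙ ^ 5)) : ℝ≥0) : ℝ≥0∞) := by
        simp only [ex_sum, ex_const_mul, ex_add]
        refine Finset.sum_le_sum fun i hi => Finset.sum_le_sum fun k hk =>
          Finset.sum_le_sum fun s hs => Finset.sum_le_sum fun l hl => ?_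
        have hlk : l ≠ k := Finset.ne_of_mem_erase hl
        have hQ' : ∀ {j}, j ∈ Q → j ∉ Vs := fun hj hj' => Finset.disjoint_left.1 hQV hj hj'
        have hsi : s ≠ i := fun e => hQ' hi (e ▸ hs)
        have h1 : ∀ j ∈ Q, ex p (fun b => bi i k b * (bi s k b * (bi j l b *
            infl c b (Pi.single l 1) r Vs (Es.erase k) s))) ≤ ((2 * ℙ ^ 4 : ℝ≥0) : ℝ≥0∞) := by
          intro j hj
          have nd : ∀ v, NotDep (fun b => infl c b (Pi.single l 1) r Vs (Es.erase k) s) v k :=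
            fun v => notDep_infl _ _ _ hs (Or.inr (Finset.notMem_erase _ _))
          rw [ex_bi_mul p ((notDep_bi (Or.inl hsi)).mul ((notDep_bi (Or.inr hlk)).mul (nd i))),
            ex_bi_mul p ((notDep_bi (Or.inr hlk)).mul (nd s)),
            ex_bi_mul p (notDep_infl _ _ _ hs (Or.inl (hQ' hj)))]
          calc _ ≤ (ℙ : ℝ≥0∞) * (ℙ * (ℙ * (2 * ℙ : ℝ≥0))) := by
                gcongr; exact ex_infl_le p hc _ _ _ _ _ hs
            _ = _ := by push_cast; ring
        have h2 : ∀ s' ∈ Vs.erase s, ex p (fun b => bi i k b * (bi s k b * (bi s' k b * (bi s' l b *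
            infl c b (Pi.single l 1) r (Vs.erase s') (Es.erase k) s)))) ≤
            ((2 * ℙ ^ 5 : ℝ≥0) : ℝ≥0∞) := by
          intro s' hs'
          have hss : s ∈ Vs.erase s' := Finset.mem_erase.2 ⟨(Finset.ne_of_mem_erase hs').symm, hs⟩
          have nd : ∀ v, NotDep (fun b => infl c b (Pi.single l 1) r (Vs.erase s') (Es.erase k) s)
              v k := fun v => notDep_infl _ _ _ hss (Or.inr (Finset.notMem_erase _ _))
          have hs'i : s' ≠ i := fun e => hQ' hi (e ▸ Finset.mem_of_mem_erase hs')
          rw [ex_bi_mul p ((notDep_bi (Or.inl hsi)).mul ((notDep_bi (Or.inl hs'i)).mul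
              ((notDep_bi (Or.inr hlk)).mul (nd i)))),
            ex_bi_mul p ((notDep_bi (Or.inl (Finset.ne_of_mem_erase hs'))).mul
              ((notDep_bi (Or.inr hlk)).mul (nd s))),
            ex_bi_mul p ((notDep_bi (Or.inr hlk)).mul (nd s')),
            ex_bi_mul p (notDep_infl _ _ _ hss (Or.inl (Finset.notMem_erase _ _)))]
          calc _ ≤ (ℙ : ℝ≥0∞) * (ℙ * (ℙ * (ℙ * (2 * ℙ : ℝ≥0)))) := by
                gcongr; exact ex_infl_le p hc _ _ _ _ _ hss
            _ = _ := by push_cast; ring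
        calc _ ≤ ((2 * U : ℝ≥0) : ℝ≥0∞) * (∑ j ∈ Q, ((2 * ℙ ^ 4 : ℝ≥0) : ℝ≥0∞) +
              ∑ s' ∈ Vs.erase s, ((2 * ℙ ^ 5 : ℝ≥0) : ℝ≥0∞)) := by
              gcongr with j hj s' hs'
              · exact h1 j hj
              · exact h2 s' hs'
          _ ≤ _ := by
              simp only [← ENNReal.ofNNReal_finsetSum]
              rw [← ENNReal.coe_add, ← ENNReal.coe_mul, ENNReal.coe_le_coe]
              simp only [Finset.sum_const, nsmul_eq_mul]
              gcongr
              exact Finset.card_le_univ _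
    _ ≤ _ := by
        simp only [← ENNReal.ofNNReal_finsetSum]
        rw [ENNReal.coe_le_coe]
        simp only [Finset.sum_const, nsmul_eq_mul]
        set R : ℝ≥0 := 2 * U * (Q.card * (2 * ℙ ^ 4) + Fintype.card V * (2 * ℙ ^ 5))
        calc _ = ∑ k ∈ Es, (Q.card : ℝ≥0) * (Vs.card * ((Es.erase k).card * R)) := by
              rw [Finset.mul_sum]
          _ ≤ ∑ k ∈ Es, (Q.card : ℝ≥0) * (Fintype.card V * (Fintype.card E * R)) := by
              gcongr
              · exact Finset.card_le_univ _
              · exact Finset.card_le_univ _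
          _ = Es.card * ((Q.card : ℝ≥0) * (Fintype.card V * (Fintype.card E * R))) := by simp
          _ ≤ Fintype.card E * ((Q.card : ℝ≥0) * (Fintype.card V * (Fintype.card E * R))) := by
              gcongr
              exact Finset.card_le_univ _
          _ = _ := by ring

/-- The indicator of `q ∈ slots`. -/
def slotInd (b : V → E → Bool) (q : V × E) : ℝ≥0 := if q ∈ slots Q Vs Es b then 1 else 0

lemma slotInd_le (b : V → E → Bool) (q : V × E) :
    slotInd Q Vs Es b q ≤ ∑ i ∈ Q, bi i q.2 b * bi q.1 q.2 b := by
  unfold slotInd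
  split_ifs with h
  · obtain ⟨-, h1, h2⟩ := Finset.mem_filter.1 h
    obtain ⟨i, hi⟩ := Option.isSome_iff_exists.1 h1
    obtain ⟨h3, h4, -⟩ := owner_spec hi
    refine le_trans ?_ (Finset.single_le_sum (f := fun i => bi i q.2 b * bi q.1 q.2 b)
      (fun _ _ => zero_le) h3)
    simp [bi, h2, h4]
  · exact zero_le

lemma card_slots (b : V → E → Bool) :
    ((slots Q Vs Es b).card : ℝ≥0) = ∑ q ∈ Vs ×ˢ Es, slotInd Q Vs Es b q := by
  simp only [slotInd, Finset.sum_ite_mem, Finset.sum_const, nsmul_eq_mul, mul_one]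
  rw [slots, Finset.inter_eq_right.2 (Finset.filter_subset _ _)]

variable {Q Vs}

lemma ex_slotInd_le (hQV : Disjoint Q Vs) {q : V × E} (hq : q.1 ∈ Vs) :
    ex p (fun b => slotInd Q Vs Es b q) ≤ ((Q.card * ℙ ^ 2 : ℝ≥0) : ℝ≥0∞) := by
  refine (ex_mono p fun b => slotInd_le Q Vs Es b q).trans ?_
  rw [ex_sum]
  have : ∀ i ∈ Q, ex p (fun b => bi i q.2 b * bi q.1 q.2 b) = ((ℙ ^ 2 : ℝ≥0) : ℝ≥0∞) := by
    intro i hi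
    have h1 : q.1 ≠ i := fun e => Finset.disjoint_left.1 hQV hi (e ▸ hq)
    rw [ex_bi_mul p (notDep_bi (Or.inl h1)), ex_bi]
    push_cast; ring
  rw [Finset.sum_congr rfl this]
  simp

lemma ex_slotInd_mul_le_of_ne (hQV : Disjoint Q Vs) {q q' : V × E} (hq : q.1 ∈ Vs)
    (hq' : q'.1 ∈ Vs) (h : q.2 ≠ q'.2) : ex p (fun b => slotInd Q Vs Es b q * slotInd Q Vs Es b q') ≤
      ((Q.card ^ 2 * ℙ ^ 4 : ℝ≥0) : ℝ≥0∞) := by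
  refine (ex_mono p fun b => mul_le_mul' (slotInd_le Q Vs Es b q) (slotInd_le Q Vs Es b q')).trans ?_
  simp only [Finset.sum_mul_sum, ex_sum, mul_assoc]
  have : ∀ i ∈ Q, ∀ j ∈ Q, ex p (fun b => bi i q.2 b * (bi q.1 q.2 b * (bi j q'.2 b *
      bi q'.1 q'.2 b))) = ((ℙ ^ 4 : ℝ≥0) : ℝ≥0∞) := by
    intro i hi j hj
    have h1 : q.1 ≠ i := fun e => Finset.disjoint_left.1 hQV hi (e ▸ hq)
    have h2 : q'.1 ≠ j := fun e => Finset.disjoint_left.1 hQV hj (e ▸ hq')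
    rw [ex_bi_mul p ((notDep_bi (Or.inl h1)).mul ((notDep_bi (Or.inr h.symm)).mul
      (notDep_bi (Or.inr h.symm)))), ex_bi_mul p ((notDep_bi (Or.inr h.symm)).mul
      (notDep_bi (Or.inr h.symm))), ex_bi_mul p (notDep_bi (Or.inl h2)), ex_bi]
    push_cast; ring
  rw [Finset.sum_congr rfl fun i hi => Finset.sum_congr rfl fun j hj => this i hi j hj]
  simp
  apply le_of_eq
  ring

/-- Two slots in different clauses involve four distinct entries, two in the same clause share the
entry of the owner, and a repeated slot has two entries. -/
lemma ex_slotInd_mul_le (hQV : Disjoint Q Vs) {q q' : V × E} (hq : q.1 ∈ Vs)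
    (hq' : q'.1 ∈ Vs) : ex p (fun b => slotInd Q Vs Es b q * slotInd Q Vs Es b q') ≤
      ((Q.card ^ 2 * ℙ ^ 4 + (if q.2 = q'.2 then Q.card * ℙ ^ 3 else 0) +
        (if q = q' then Q.card * ℙ ^ 2 else 0) : ℝ≥0) : ℝ≥0∞) := by
  rcases eq_or_ne q q' with rfl | hne
  · simp only [if_true]
    refine (ex_mono p fun b => ?_).trans ((ex_slotInd_le p Es hQV hq).trans
      (ENNReal.coe_le_coe.2 le_add_self))
    unfold slotInd
    split_ifs <;> simp
  rcases eq_or_ne q.2 q'.2 with h | h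
  · simp only [h, hne, if_true, if_false, add_zero]
    have hs : q'.1 ≠ q.1 := fun e => hne (Prod.ext e.symm h)
    refine le_trans (?_ : _ ≤ ((Q.card * ℙ ^ 3 : ℝ≥0) : ℝ≥0∞)) (ENNReal.coe_le_coe.2 le_add_self)
    refine (ex_mono p (G := fun b => ∑ i ∈ Q, bi i q'.2 b * (bi q.1 q'.2 b * bi q'.1 q'.2 b))
      fun b => ?_).trans ?_
    · calc _ ≤ (∑ i ∈ Q, bi i q.2 b * bi q.1 q.2 b) * bi q'.1 q'.2 b := by
            refine mul_le_mul' (slotInd_le Q Vs Es b q) ?_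
            unfold slotInd
            split_ifs with h
            · simp [bi, (Finset.mem_filter.1 h).2.2]
            · exact zero_le
        _ = _ := by rw [Finset.sum_mul, h]; exact Finset.sum_congr rfl fun _ _ => by ring
    rw [ex_sum]
    have : ∀ i ∈ Q, ex p (fun b => bi i q'.2 b * (bi q.1 q'.2 b * bi q'.1 q'.2 b)) =
        ((ℙ ^ 3 : ℝ≥0) : ℝ≥0∞) := by
      intro i hi
      have h1 : q.1 ≠ i := fun e => Finset.disjoint_left.1 hQV hi (e ▸ hq)
      have h2 : q'.1 ≠ i := fun e => Finset.disjoint_left.1 hQV hi (e ▸ hq')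
      rw [ex_bi_mul p ((notDep_bi (Or.inl h1)).mul (notDep_bi (Or.inl h2))),
        ex_bi_mul p (notDep_bi (Or.inl hs)), ex_bi]
      push_cast; ring
    rw [Finset.sum_congr rfl this]
    simp
  · simp only [h, hne, if_false, add_zero]
    exact ex_slotInd_mul_le_of_ne p Es hQV hq hq' h

variable (Q Vs) in
lemma sum_product_const_le (t : ℝ≥0) (F : Type*) [Fintype F] (S : Finset F) :
    ∑ _ ∈ S, t ≤ Fintype.card F * t := by
  rw [Finset.sum_const, nsmul_eq_mul]
  gcongr
  exact Finset.card_le_univ _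

lemma ex_card_slots_le (hQV : Disjoint Q Vs) : ex p (fun b => ((slots Q Vs Es b).card : ℝ≥0)) ≤
    ((Q.card * Fintype.card E * Fintype.card V * ℙ ^ 2 : ℝ≥0) : ℝ≥0∞) := by
  simp only [card_slots, ex_sum]
  calc _ ≤ ∑ q ∈ Vs ×ˢ Es, ((Q.card * ℙ ^ 2 : ℝ≥0) : ℝ≥0∞) := Finset.sum_le_sum fun q hq =>
        ex_slotInd_le p Es hQV (Finset.mem_product.1 hq).1
    _ ≤ _ := by
        rw [← ENNReal.ofNNReal_finsetSum, ENNReal.coe_le_coe]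
        refine (sum_product_const_le _ _ _).trans (le_of_eq ?_)
        rw [Fintype.card_prod]
        push_cast; ring

lemma ex_card_slots_sq_le (hQV : Disjoint Q Vs) :
    ex p (fun b => ((slots Q Vs Es b).card : ℝ≥0) ^ 2) ≤
    ((Q.card ^ 2 * Fintype.card E ^ 2 * Fintype.card V ^ 2 * ℙ ^ 4 +
      Q.card * Fintype.card E * Fintype.card V ^ 2 * ℙ ^ 3 +
      Q.card * Fintype.card E * Fintype.card V * ℙ ^ 2 : ℝ≥0) : ℝ≥0∞) := by
  simp only [card_slots, sq (∑ _ ∈ _, _), Finset.sum_mul_sum, ex_sum]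
  calc _ ≤ ∑ q ∈ Vs ×ˢ Es, ∑ q' ∈ Vs ×ˢ Es, ((Q.card ^ 2 * ℙ ^ 4 +
        (if q.2 = q'.2 then Q.card * ℙ ^ 3 else 0) +
        (if q = q' then Q.card * ℙ ^ 2 else 0) : ℝ≥0) : ℝ≥0∞) := Finset.sum_le_sum fun q hq =>
        Finset.sum_le_sum fun q' hq' => ex_slotInd_mul_le p Es hQV (Finset.mem_product.1 hq).1
          (Finset.mem_product.1 hq').1
    _ ≤ _ := by
        simp only [← ENNReal.ofNNReal_finsetSum]
        rw [ENNReal.coe_le_coe]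
        calc _ ≤ ∑ q : V × E, ∑ q' : V × E, ((Q.card ^ 2 * ℙ ^ 4 +
              (if q.2 = q'.2 then Q.card * ℙ ^ 3 else 0) +
              (if q = q' then Q.card * ℙ ^ 2 else 0) : ℝ≥0)) := by
              refine (Finset.sum_le_sum fun q _ => Finset.sum_le_sum_of_subset
                (Finset.subset_univ _)).trans (Finset.sum_le_sum_of_subset (Finset.subset_univ _))
          _ = _ := by
              simp only [Finset.sum_add_distrib, Fintype.sum_prod_type, Finset.sum_ite_eq]
              simp
              ring

/-- The indicator of the touched clauses. -/
lemma card_touched_le (b : V → E → Bool) :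
    ((touched Q Es b).card : ℝ≥0) ≤ ∑ l ∈ Es, ∑ j ∈ Q, bi j l b := by
  rw [touched, Finset.card_filter]
  push_cast
  refine Finset.sum_le_sum fun l _ => ?_
  split_ifs with h
  · obtain ⟨j, hj, hjl⟩ := h
    refine le_trans ?_ (Finset.single_le_sum (f := fun j => bi j l b) (fun _ _ => zero_le) hj)
    simp [bi, hjl]
  · exact zero_le

/-- The clause of a slot is itself touched, which produces the term without decoupling; every other
clause is independent of the slot. -/
lemma ex_card_slots_mul_touched_le (hQV : Disjoint Q Vs) :
    ex p (fun b => ((slots Q Vs Es b).card : ℝ≥0) * (touched Q Es b).card) ≤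
    ((Q.card ^ 2 * Fintype.card E ^ 2 * Fintype.card V * ℙ ^ 3 +
      Q.card * Fintype.card E * Fintype.card V * ℙ ^ 2 : ℝ≥0) : ℝ≥0∞) := by
  have key : ∀ b : V → E → Bool, ((slots Q Vs Es b).card : ℝ≥0) * (touched Q Es b).card ≤
      ∑ q ∈ Vs ×ˢ Es, (slotInd Q Vs Es b q + ∑ l ∈ Es.erase q.2, ∑ j ∈ Q, ∑ i ∈ Q,
        bi i q.2 b * (bi q.1 q.2 b * bi j l b)) := by
    intro b
    rw [card_slots, Finset.sum_mul]
    refine Finset.sum_le_sum fun q hq => ?_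
    have hT : ((touched Q Es b).card : ℝ≥0) ≤ 1 + ∑ l ∈ Es.erase q.2, ∑ j ∈ Q, bi j l b := by
      have h1 := card_touched_le (Q := Q) (Es.erase q.2) b
      have h2 : touched Q Es b ⊆ insert q.2 (touched Q (Es.erase q.2) b) := by
        intro l hl
        simp only [touched, Finset.mem_insert, Finset.mem_filter, Finset.mem_erase] at hl ⊢
        by_cases h : l = q.2
        · exact Or.inl h
        · exact Or.inr ⟨⟨h, hl.1⟩, hl.2⟩
      have h3 : ((touched Q Es b).card : ℝ≥0) ≤ (touched Q (Es.erase q.2) b).card + 1 := by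
        exact_mod_cast (Finset.card_le_card h2).trans (Finset.card_insert_le _ _)
      rw [add_comm]
      exact h3.trans (by gcongr)
    calc _ ≤ slotInd Q Vs Es b q * (1 + ∑ l ∈ Es.erase q.2, ∑ j ∈ Q, bi j l b) := by gcongr
      _ = slotInd Q Vs Es b q + slotInd Q Vs Es b q * ∑ l ∈ Es.erase q.2, ∑ j ∈ Q, bi j l b := by
        ring
      _ ≤ slotInd Q Vs Es b q + (∑ i ∈ Q, bi i q.2 b * bi q.1 q.2 b) *
          ∑ l ∈ Es.erase q.2, ∑ j ∈ Q, bi j l b := by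
        gcongr
        exact slotInd_le Q Vs Es b q
      _ = _ := by
        congr 1
        simp only [Finset.mul_sum, Finset.sum_mul, mul_assoc]
  refine (ex_mono p key).trans ?_
  simp only [ex_sum, ex_add]
  calc _ ≤ ∑ q ∈ Vs ×ˢ Es, (((Q.card * ℙ ^ 2 : ℝ≥0) : ℝ≥0∞) + ∑ l ∈ Es.erase q.2, ∑ j ∈ Q,
        ∑ i ∈ Q, ((ℙ ^ 3 : ℝ≥0) : ℝ≥0∞)) := by
        refine Finset.sum_le_sum fun q hq => add_le_add
          (ex_slotInd_le p Es hQV (Finset.mem_product.1 hq).1) (Finset.sum_le_sum fun l hl =>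
          Finset.sum_le_sum fun j hj => Finset.sum_le_sum fun i hi => le_of_eq ?_)
        have h1 : q.1 ≠ i := fun e =>
          Finset.disjoint_left.1 hQV hi (e ▸ (Finset.mem_product.1 hq).1)
        have h2 := Finset.ne_of_mem_erase hl
        rw [ex_bi_mul p ((notDep_bi (Or.inl h1)).mul (notDep_bi (Or.inr h2))),
          ex_bi_mul p (notDep_bi (Or.inr h2)), ex_bi]
        push_cast; ring
    _ ≤ _ := by
        simp only [← ENNReal.ofNNReal_finsetSum, ← ENNReal.coe_add]
        rw [ENNReal.coe_le_coe]
        calc _ ≤ ∑ q ∈ Vs ×ˢ Es, ((Q.card * ℙ ^ 2 : ℝ≥0) + Fintype.card E * (Q.card *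
              (Q.card * ℙ ^ 3))) := by
              gcongr with q hq
              simp only [Finset.sum_const, nsmul_eq_mul]
              gcongr
              exact Finset.card_le_univ _
          _ ≤ _ := by
              refine (sum_product_const_le _ _ _).trans (le_of_eq ?_)
              rw [Fintype.card_prod]
              push_cast; ring

/-- The pairs of slots at the same site, in different clauses. -/
lemma card_slots_le (b : V → E → Bool) : ((slots Q Vs Es b).card : ℝ≥0) ≤
    (sites Q Vs Es b).card + ∑ s ∈ Vs, ∑ k ∈ Es, ∑ k' ∈ Es.erase k,
      slotInd Q Vs Es b (s, k) * slotInd Q Vs Es b (s, k') := by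
  classical
  set S := slots Q Vs Es b with hS
  have h1 : S.card = ∑ s ∈ sites Q Vs Es b, (S.filter (fun q => q.1 = s)).card :=
    Finset.card_eq_sum_card_image Prod.fst S
  have hsub : sites Q Vs Es b ⊆ Vs := by
    intro s hs
    obtain ⟨q, hq, rfl⟩ := Finset.mem_image.1 hs
    exact (Finset.mem_product.1 (Finset.mem_filter.1 hq).1).1
  have h2 : ∀ s ∈ sites Q Vs Es b, ((S.filter (fun q => q.1 = s)).card : ℝ≥0) ≤
      1 + ∑ k ∈ Es, ∑ k' ∈ Es.erase k, slotInd Q Vs Es b (s, k) * slotInd Q Vs Es b (s, k') := by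
    intro s hs
    obtain ⟨⟨s', k⟩, hq, rfl⟩ := Finset.mem_image.1 hs
    have hk : k ∈ Es := (Finset.mem_product.1 (Finset.mem_filter.1 hq).1).2
    have h3 : S.filter (fun q => q.1 = s') ⊆ insert (s', k)
        (((Es.erase k).filter (fun k' => (s', k') ∈ S)).image (fun k' => (s', k'))) := by
      rintro ⟨s'', k'⟩ hq'
      obtain ⟨h4, h5⟩ := Finset.mem_filter.1 hq'
      simp only at h5
      subst h5
      have hk' : k' ∈ Es := (Finset.mem_product.1 (Finset.mem_filter.1 h4).1).2
      by_cases hkk : k' = k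
      · simp [hkk]
      · simp [hkk, hk', h4]
    have h4 := (Finset.card_le_card h3).trans (Finset.card_insert_le _ _)
    have h5 := h4.trans (Nat.add_le_add_right Finset.card_image_le 1)
    have h6 : ((S.filter (fun q => q.1 = s')).card : ℝ≥0) ≤
        ((Es.erase k).filter (fun k' => (s', k') ∈ S)).card + 1 := by exact_mod_cast h5
    refine h6.trans ?_
    rw [add_comm]
    gcongr
    refine le_trans ?_ (Finset.single_le_sum (f := fun k => ∑ k' ∈ Es.erase k,
      slotInd Q Vs Es b (s', k) * slotInd Q Vs Es b (s', k')) (fun _ _ => zero_le) hk)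
    rw [Finset.card_filter]
    push_cast
    refine Finset.sum_le_sum fun k' _ => ?_
    rw [← hS] at hq
    simp [slotInd, ← hS, hq]
  rw [h1]
  push_cast
  refine (Finset.sum_le_sum h2).trans ?_
  rw [Finset.sum_add_distrib]
  simp only [Finset.sum_const, nsmul_eq_mul, mul_one]
  gcongr

/-- A surplus slot means one spin in two different clauses, each meeting `Q`: four independent
entries. -/
lemma ex_card_slots_sub_sites_le (hQV : Disjoint Q Vs) :
    ex p (fun b => ((slots Q Vs Es b).card : ℝ≥0) - (sites Q Vs Es b).card) ≤
    ((Q.card ^ 2 * Fintype.card E ^ 2 * Fintype.card V * ℙ ^ 4 : ℝ≥0) : ℝ≥0∞) := by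
  refine (ex_mono p (G := fun b => ∑ s ∈ Vs, ∑ k ∈ Es, ∑ k' ∈ Es.erase k,
      slotInd Q Vs Es b (s, k) * slotInd Q Vs Es b (s, k'))
      fun b => tsub_le_iff_left.2 (card_slots_le Es b)).trans ?_
  simp only [ex_sum]
  calc _ ≤ ∑ s ∈ Vs, ∑ k ∈ Es, ∑ k' ∈ Es.erase k, ((Q.card ^ 2 * ℙ ^ 4 : ℝ≥0) : ℝ≥0∞) :=
        Finset.sum_le_sum fun s hs => Finset.sum_le_sum fun k hk => Finset.sum_le_sum fun k' hk' =>
          ex_slotInd_mul_le_of_ne p Es hQV hs hs (Finset.ne_of_mem_erase hk').symm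
    _ ≤ _ := by
        simp only [← ENNReal.ofNNReal_finsetSum]
        rw [ENNReal.coe_le_coe]
        calc _ ≤ ∑ s ∈ Vs, ∑ k ∈ Es, Fintype.card E * (Q.card ^ 2 * ℙ ^ 4 : ℝ≥0) := by
              gcongr
              exact sum_product_const_le _ _ _
          _ ≤ ∑ s ∈ Vs, Fintype.card E * (Fintype.card E * (Q.card ^ 2 * ℙ ^ 4 : ℝ≥0)) := by
              gcongr
              exact sum_product_const_le _ _ _
          _ ≤ Fintype.card V * (Fintype.card E * (Fintype.card E * (Q.card ^ 2 * ℙ ^ 4 : ℝ≥0))) :=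
              sum_product_const_le _ _ _
          _ = _ := by ring

end Counting

/-! ### Couplings and transportation cost. -/

section Coupling

/-- There is a coupling of `μ` and `ν` with transportation cost at most `c`. -/
def Near (μ ν : Measure ℝ) (c : ℝ≥0∞) : Prop :=
  ∃ π : Measure (ℝ × ℝ), π.map Prod.fst = μ ∧ π.map Prod.snd = ν ∧
    ∫⁻ q, ENNReal.ofReal |q.1 - q.2| ∂π ≤ c

lemma Near.mono {μ ν : Measure ℝ} {c c' : ℝ≥0∞} (h : Near μ ν c) (hc : c ≤ c') : Near μ ν c' := by
  obtain ⟨π, h1, h2, h3⟩ := h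
  exact ⟨π, h1, h2, h3.trans hc⟩

variable {Y ι : Type*} [MeasurableSpace Y] [Fintype ι]

/-- There is a coupling of the random vector `X` on the space `(Y, P)` with a random vector of
law `ν`, for which the expected distance of the coordinates in `Q` is at most `c`. -/
def HasCoupling (P : Measure Y) (X : Y → ι → ℝ) (ν : Measure (ι → ℝ)) (Q : Finset ι)
    (c : ℝ≥0∞) : Prop :=
  ∃ π : Measure (Y × (ι → ℝ)), π.map Prod.fst = P ∧ π.map Prod.snd = ν ∧
    ∫⁻ q, ∑ i ∈ Q, ENNReal.ofReal |X q.1 i - q.2 i| ∂π ≤ c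

lemma HasCoupling.mono {P : Measure Y} {X : Y → ι → ℝ} {ν : Measure (ι → ℝ)} {Q : Finset ι}
    {c c' : ℝ≥0∞} (h : HasCoupling P X ν Q c) (hc : c ≤ c') : HasCoupling P X ν Q c' := by
  obtain ⟨π, h1, h2, h3⟩ := h
  exact ⟨π, h1, h2, h3.trans hc⟩

lemma isProbabilityMeasure_of_map {A B : Type*} [MeasurableSpace A] [MeasurableSpace B]
    {π : Measure A} {f : A → B} {μ : Measure B} [IsProbabilityMeasure μ] (hf : Measurable f)
    (h : π.map f = μ) : IsProbabilityMeasure π := by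
  subst h
  exact ⟨by rw [← Set.preimage_univ (f := f), ← Measure.map_apply hf .univ, measure_univ]⟩

lemma measurable_ofReal_abs_sub {A : Type*} [MeasurableSpace A] {f g : A → ℝ} (hf : Measurable f)
    (hg : Measurable g) : Measurable fun a => ENNReal.ofReal |f a - g a| :=
  ((hf.sub hg).norm).ennreal_ofReal

lemma map_compProd_comap {A B C : Type*} [MeasurableSpace A] [MeasurableSpace B]
    [MeasurableSpace C] (μ : Measure A) [SFinite μ] (f : A → B) (hf : Measurable f)
    (κ : Kernel B C) [IsSFiniteKernel κ] :
    (μ ⊗ₘ (κ.comap f hf)).map (fun z => (f z.1, z.2)) = (μ.map f) ⊗ₘ κ := by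
  have hm : Measurable (fun z : A × C => (f z.1, z.2)) := by fun_prop
  refine Measure.ext_of_lintegral _ fun g hg => ?_
  rw [lintegral_map hg hm, Measure.lintegral_compProd (f := fun z : A × C => g (f z.1, z.2))
    (hg.comp hm), Measure.lintegral_compProd hg,
    lintegral_map hg.lintegral_kernel_prod_right' hf]
  rfl

/-- Gluing of couplings. The second one is disintegrated over `ν`, so a regular conditional law is
needed only on `ι → ℝ` and the space `Y` may be arbitrary. -/
lemma HasCoupling.trans {P : Measure Y} {X : Y → ι → ℝ} (hX : ∀ i, Measurable fun y => X y i)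
    {ν ν' : Measure (ι → ℝ)} [IsProbabilityMeasure ν] {Q : Finset ι}
    {c c' : ℝ≥0∞} (h : HasCoupling P X ν Q c) (h' : HasCoupling ν id ν' Q c') :
    HasCoupling P X ν' Q (c + c') := by
  obtain ⟨π, rfl, h2, h3⟩ := h
  obtain ⟨π', h1', rfl, h3'⟩ := h'
  have : IsProbabilityMeasure π := isProbabilityMeasure_of_map measurable_snd h2
  have : IsProbabilityMeasure π' := isProbabilityMeasure_of_map measurable_fst h1'
  set κ := π'.condKernel
  have hκ : ν ⊗ₘ κ = π' := by rw [← h1']; exact π'.disintegrate π'.condKernel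
  set J := π ⊗ₘ (κ.comap Prod.snd measurable_snd) with hJ
  have hfst : J.map Prod.fst = π := Measure.fst_compProd π _
  have hsnd : J.map (fun z => (z.1.2, z.2)) = π' := by
    rw [hJ, map_compProd_comap π Prod.snd measurable_snd κ, h2, hκ]
  have hm : Measurable fun z : (Y × (ι → ℝ)) × (ι → ℝ) => (z.1.1, z.2) := by fun_prop
  have hm' : Measurable fun z : (Y × (ι → ℝ)) × (ι → ℝ) => (z.1.2, z.2) := by fun_prop
  have hX1 : ∀ i, Measurable fun z : Y × (ι → ℝ) => X z.1 i := fun i => (hX i).comp measurable_fst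
  refine ⟨J.map (fun z => (z.1.1, z.2)), ?_, ?_, ?_⟩
  · rw [Measure.map_map measurable_fst hm]
    change J.map (Prod.fst ∘ Prod.fst) = _
    rw [← Measure.map_map measurable_fst measurable_fst, hfst]
  · rw [Measure.map_map measurable_snd hm, ← hsnd, Measure.map_map measurable_snd hm']
    rfl
  · rw [lintegral_map (Finset.measurable_fun_sum _ fun i _ => measurable_ofReal_abs_sub (hX1 i)
      (by fun_prop)) hm]
    calc _ ≤ ∫⁻ z, (∑ i ∈ Q, ENNReal.ofReal |X z.1.1 i - z.1.2 i| +
          ∑ i ∈ Q, ENNReal.ofReal |z.1.2 i - z.2 i|) ∂J := by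
          refine lintegral_mono fun z => ?_
          rw [← Finset.sum_add_distrib]
          refine Finset.sum_le_sum fun i _ => ?_
          rw [← ENNReal.ofReal_add (abs_nonneg _) (abs_nonneg _)]
          exact ENNReal.ofReal_le_ofReal (abs_sub_le _ _ _)
      _ = ∫⁻ q, ∑ i ∈ Q, ENNReal.ofReal |X q.1 i - q.2 i| ∂π +
          ∫⁻ q, ∑ i ∈ Q, ENNReal.ofReal |q.1 i - q.2 i| ∂π' := by
          rw [lintegral_add_left (Finset.measurable_fun_sum _ fun i _ =>
            measurable_ofReal_abs_sub (f := fun z : (Y × (ι → ℝ)) × (ι → ℝ) => X z.1.1 i)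
              (g := fun z => z.1.2 i) ((hX1 i).comp measurable_fst) (by fun_prop))]
          congr 1
          · rw [← hfst, lintegral_map (Finset.measurable_fun_sum _ fun i _ =>
              measurable_ofReal_abs_sub (hX1 i) (by fun_prop)) measurable_fst]
          · rw [← hsnd, lintegral_map (Finset.measurable_fun_sum _ fun i _ =>
              measurable_ofReal_abs_sub (by fun_prop) (by fun_prop)) hm']
      _ ≤ _ := add_le_add h3 h3'

lemma pi_map_coord {A : Type*} [MeasurableSpace A] (π : ι → Measure A)
    [∀ i, IsProbabilityMeasure (π i)] {f : A → ℝ} (hf : Measurable f) :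
    (Measure.pi π).map (fun q i => f (q i)) = Measure.pi (fun i => (π i).map f) := by
  have : ∀ i, IsProbabilityMeasure ((π i).map f) :=
    fun i => Measure.isProbabilityMeasure_map hf.aemeasurable
  exact Measure.pi_map_pi (f := fun _ => f) fun i => hf.aemeasurable

lemma HasCoupling.pi (μ ν : ι → Measure ℝ) [∀ i, IsProbabilityMeasure (μ i)] (Q : Finset ι)
    {c : ι → ℝ≥0∞} (h : ∀ i, Near (μ i) (ν i) (c i)) :
    HasCoupling (Measure.pi μ) id (Measure.pi ν) Q (∑ i ∈ Q, c i) := by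
  choose π h1 h2 h3 using h
  have : ∀ i, IsProbabilityMeasure (π i) := fun i => isProbabilityMeasure_of_map measurable_fst (h1 i)
  have hm : Measurable fun q : ι → ℝ × ℝ => ((fun i => (q i).1 : ι → ℝ), (fun i => (q i).2 : ι → ℝ)) := by
    fun_prop
  refine ⟨(Measure.pi π).map fun q => (fun i => (q i).1, fun i => (q i).2), ?_, ?_, ?_⟩
  · rw [Measure.map_map measurable_fst hm]
    exact (pi_map_coord π measurable_fst).trans (by simp only [h1])
  · rw [Measure.map_map measurable_snd hm]
    exact (pi_map_coord π measurable_snd).trans (by simp only [h2])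
  · rw [lintegral_map (Finset.measurable_fun_sum _ fun i _ => measurable_ofReal_abs_sub
      (by simp only [id]; fun_prop) (by fun_prop)) hm, lintegral_finsetSum _ fun i _ => measurable_ofReal_abs_sub
      (by simp only [id]; fun_prop) (by fun_prop)]
    refine Finset.sum_le_sum fun i _ => le_trans (le_of_eq ?_) (h3 i)
    have := (measurePreserving_eval π i).lintegral_comp
      (f := fun q : ℝ × ℝ => ENNReal.ofReal |q.1 - q.2|)
      (measurable_ofReal_abs_sub measurable_fst measurable_snd)
    exact this

lemma Near.of_map {A : Type*} [MeasurableSpace A] {P : Measure A} {f g : A → ℝ}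
    (hf : Measurable f) (hg : Measurable g) {c : ℝ≥0∞}
    (h : ∫⁻ a, ENNReal.ofReal |f a - g a| ∂P ≤ c) : Near (P.map f) (P.map g) c := by
  have hm : Measurable fun a => (f a, g a) := hf.prodMk hg
  refine ⟨P.map fun a => (f a, g a), ?_, ?_, ?_⟩
  · rw [Measure.map_map measurable_fst hm]; rfl
  · rw [Measure.map_map measurable_snd hm]; rfl
  · rwa [lintegral_map (measurable_ofReal_abs_sub measurable_fst measurable_snd) hm]

lemma Near.sum {κ : Type*} [Countable κ] {μ ν : κ → Measure ℝ} {w c : κ → ℝ≥0∞}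
    (h : ∀ i, Near (μ i) (ν i) (c i)) :
    Near (Measure.sum fun i => w i • μ i) (Measure.sum fun i => w i • ν i) (∑' i, w i * c i) := by
  choose π h1 h2 h3 using h
  refine ⟨Measure.sum fun i => w i • π i, ?_, ?_, ?_⟩
  · rw [Measure.map_sum measurable_fst.aemeasurable]
    simp only [Measure.map_smul, h1]
  · rw [Measure.map_sum measurable_snd.aemeasurable]
    simp only [Measure.map_smul, h2]
  · rw [lintegral_sum_measure]
    refine ENNReal.tsum_le_tsum fun i => ?_
    rw [lintegral_smul_measure, smul_eq_mul]
    gcongr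
    exact h3 i

/-- The law is carried by `[-1, 1]`. -/
def Supp (μ : Measure ℝ) : Prop := ∀ᵐ x ∂μ, x ∈ Set.Icc (-1 : ℝ) 1

lemma lintegral_abs_le {μ : Measure ℝ} (h : Supp μ) :
    ∫⁻ x, ENNReal.ofReal |x| ∂μ ≤ μ Set.univ := by
  rw [← lintegral_one]
  refine lintegral_mono_ae (h.mono fun x hx => ?_)
  rw [← ENNReal.ofReal_one]
  exact ENNReal.ofReal_le_ofReal (abs_le.2 hx)

lemma lintegral_abs_sub_prod_le {μ ν : Measure ℝ} [IsFiniteMeasure μ] [IsFiniteMeasure ν]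
    (hμ : Supp μ) (hν : Supp ν) : ∫⁻ q, ENNReal.ofReal |q.1 - q.2| ∂(μ.prod ν) ≤
      2 * (μ Set.univ * ν Set.univ) := by
  calc _ ≤ ∫⁻ q, (ENNReal.ofReal |q.1| * 1 + 1 * ENNReal.ofReal |q.2|) ∂(μ.prod ν) := by
        refine lintegral_mono fun q => ?_
        rw [mul_one, one_mul, ← ENNReal.ofReal_add (abs_nonneg _) (abs_nonneg _)]
        exact ENNReal.ofReal_le_ofReal (abs_sub _ _)
    _ = (∫⁻ x, ENNReal.ofReal |x| ∂μ) * ν Set.univ + μ Set.univ * ∫⁻ x, ENNReal.ofReal |x| ∂ν := by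
        rw [lintegral_add_left (by fun_prop), lintegral_prod_mul (f := fun x => ENNReal.ofReal |x|) (g := fun _ => 1)
          (by fun_prop) (by fun_prop),
          lintegral_prod_mul (f := fun _ => 1) (g := fun x => ENNReal.ofReal |x|) (by fun_prop) (by fun_prop)]
        simp
    _ ≤ μ Set.univ * ν Set.univ + μ Set.univ * ν Set.univ := by
        gcongr
        · exact lintegral_abs_le hμ
        · exact lintegral_abs_le hν
    _ = _ := by ring

/-- Two laws on `[-1, 1]` with a large common part are close. -/
lemma near_of_common {μ ν ρ : Measure ℝ} [IsProbabilityMeasure μ] [IsProbabilityMeasure ν]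
    (hμ : Supp μ) (hν : Supp ν) (h1 : ρ ≤ μ) (h2 : ρ ≤ ν) {d : ℝ≥0∞} (hd : 1 ≤ ρ Set.univ + d) :
    Near μ ν (2 * d) := by
  have : IsFiniteMeasure ρ := isFiniteMeasure_of_le μ h1
  set a := μ - ρ
  set a' := ν - ρ
  have e1 : a + ρ = μ := Measure.sub_add_cancel_of_le h1
  have e2 : a' + ρ = ν := Measure.sub_add_cancel_of_le h2
  have : IsFiniteMeasure a := isFiniteMeasure_of_le μ (Measure.sub_le)
  have : IsFiniteMeasure a' := isFiniteMeasure_of_le ν (Measure.sub_le)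
  have s1 : Supp a := ae_mono Measure.sub_le hμ
  have s2 : Supp a' := ae_mono Measure.sub_le hν
  have m1 : a Set.univ + ρ Set.univ = 1 := by
    rw [← Measure.add_apply, e1, measure_univ]
  have m2 : a' Set.univ + ρ Set.univ = 1 := by
    rw [← Measure.add_apply, e2, measure_univ]
  have hρ : ρ Set.univ ≠ ∞ := measure_ne_top _ _
  have m3 : a' Set.univ = a Set.univ := (ENNReal.add_left_inj hρ).1 (m2.trans m1.symm)
  have m4 : a Set.univ ≤ d := by
    have : ρ Set.univ + a Set.univ ≤ ρ Set.univ + d := by rwa [add_comm, m1]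
    exact (ENNReal.add_le_add_iff_left hρ).1 this
  set m := a Set.univ with hm
  have hd : Measurable fun x : ℝ => (x, x) := by fun_prop
  -- The common part stays on the diagonal at no cost, and the two remainders, of equal mass `m`,
  -- are coupled independently. When `m = 0` the factor `m⁻¹` is infinite, but the remainders
  -- vanish.
  refine ⟨ρ.map (fun x => (x, x)) + m⁻¹ • a.prod a', ?_, ?_, ?_⟩
  · rw [Measure.map_add _ _ measurable_fst, Measure.map_map measurable_fst hd, Measure.map_smul,
      Measure.map_fst_prod, m3, smul_smul]
    rcases eq_or_ne m 0 with h0 | h0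
    · have : a = 0 := Measure.measure_univ_eq_zero.1 h0
      rw [this, smul_zero, add_zero, ← e1, this, zero_add]
      exact Measure.map_id
    · rw [ENNReal.inv_mul_cancel h0 (measure_ne_top _ _), one_smul, add_comm, ← e1]
      congr 1
      exact Measure.map_id
  · rw [Measure.map_add _ _ measurable_snd, Measure.map_map measurable_snd hd, Measure.map_smul,
      Measure.map_snd_prod, ← hm, smul_smul]
    rcases eq_or_ne m 0 with h0 | h0
    · have : a' = 0 := Measure.measure_univ_eq_zero.1 (m3.trans h0)
      rw [this, smul_zero, add_zero, ← e2, this, zero_add]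
      exact Measure.map_id
    · rw [ENNReal.inv_mul_cancel h0 (measure_ne_top _ _), one_smul, add_comm, ← e2]
      congr 1
      exact Measure.map_id
  · rw [lintegral_add_measure, lintegral_map (measurable_ofReal_abs_sub measurable_fst
      measurable_snd) hd, lintegral_smul_measure]
    simp only [sub_self, abs_zero, ENNReal.ofReal_zero, lintegral_zero, zero_add, smul_eq_mul]
    calc _ ≤ m⁻¹ * (2 * (m * m)) := by
          gcongr
          refine (lintegral_abs_sub_prod_le s1 s2).trans ?_
          rw [m3]
      _ = 2 * ((m⁻¹ * m) * m) := by ring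
      _ ≤ 2 * (1 * m) := by gcongr; exact ENNReal.inv_mul_le_one m
      _ ≤ 2 * d := by rw [one_mul]; gcongr

lemma near_prod {μ ν : Measure ℝ} [IsProbabilityMeasure μ] [IsProbabilityMeasure ν]
    (hμ : Supp μ) (hν : Supp ν) : Near μ ν 2 :=
  ⟨μ.prod ν, by simp [Measure.map_fst_prod], by simp [Measure.map_snd_prod], by
    simpa using lintegral_abs_sub_prod_le hμ hν⟩

/-- The map `x ↦ exp (i t x)` is `|t|`-Lipschitz. Laws joined by couplings of arbitrarily small cost
thus have the same characteristic function. -/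
lemma Near.norm_charFun_sub_le {μ ν : Measure ℝ} [IsProbabilityMeasure μ] {c : ℝ≥0∞}
    (h : Near μ ν c) (t : ℝ) : ENNReal.ofReal ‖charFun μ t - charFun ν t‖ ≤ ENNReal.ofReal |t| * c := by
  obtain ⟨π, h1, rfl, h3⟩ := h
  have : IsProbabilityMeasure π := isProbabilityMeasure_of_map measurable_fst h1
  subst h1
  rw [charFun_apply_real, charFun_apply_real, integral_map measurable_fst.aemeasurable
    (by fun_prop), integral_map measurable_snd.aemeasurable (by fun_prop)]
  have hint : ∀ f : ℝ × ℝ → ℝ, Measurable f → Integrable (fun q => Complex.exp (t * f q * Complex.I)) π := by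
    intro f hf
    refine Integrable.of_bound (C := 1) (by fun_prop) (ae_of_all _ fun q => ?_)
    rw [← Complex.ofReal_mul, Complex.norm_exp_ofReal_mul_I]
  rw [← integral_sub (hint _ measurable_fst) (hint _ measurable_snd), ofReal_norm]
  refine (enorm_integral_le_lintegral_enorm _).trans ?_
  calc _ ≤ ∫⁻ q, ENNReal.ofReal |t| * ENNReal.ofReal |q.1 - q.2| ∂π := by
        refine lintegral_mono fun q => ?_
        rw [← ofReal_norm, ← ENNReal.ofReal_mul (abs_nonneg _)]
        refine ENNReal.ofReal_le_ofReal ?_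
        have e : Complex.exp (t * q.1 * Complex.I) - Complex.exp (t * q.2 * Complex.I) =
            Complex.exp (((t * q.2 : ℝ) : ℂ) * Complex.I) *
            (Complex.exp (Complex.I * ((t * (q.1 - q.2) : ℝ) : ℂ)) - 1) := by
          rw [mul_sub, ← Complex.exp_add, mul_one]
          push_cast
          congr 2
          ring
        rw [e, norm_mul, Complex.norm_exp_ofReal_mul_I, one_mul]
        refine (Real.norm_exp_I_mul_ofReal_sub_one_le).trans ?_
        rw [Real.norm_eq_abs, abs_mul]
    _ = ENNReal.ofReal |t| * ∫⁻ q, ENNReal.ofReal |q.1 - q.2| ∂π :=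
        lintegral_const_mul _ (measurable_ofReal_abs_sub measurable_fst measurable_snd)
    _ ≤ _ := by gcongr

lemma eq_of_near {μ ν : Measure ℝ} [IsProbabilityMeasure μ] [IsProbabilityMeasure ν]
    {c : ℕ → ℝ≥0∞} (hc : Filter.Tendsto c Filter.atTop (nhds 0)) (h : ∀ n, Near μ ν (c n)) :
    μ = ν := by
  refine Measure.ext_of_charFun (funext fun t => ?_)
  have h1 : Filter.Tendsto (fun n => ENNReal.ofReal |t| * c n) Filter.atTop (nhds 0) := by
    simpa using ENNReal.Tendsto.const_mul hc (Or.inr ENNReal.ofReal_ne_top)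
  have h2 := ge_of_tendsto' h1 fun n => (h n).norm_charFun_sub_le t
  rw [nonpos_iff_eq_zero, ENNReal.ofReal_eq_zero] at h2
  exact sub_eq_zero.1 (norm_le_zero_iff.1 h2)

lemma eq_of_near_of_near {μ ν : Measure ℝ} {ρ : ℕ → Measure ℝ} [IsProbabilityMeasure μ]
    [IsProbabilityMeasure ν] [∀ n, IsProbabilityMeasure (ρ n)]
    {c : ℕ → ℝ≥0∞} (hc : Filter.Tendsto c Filter.atTop (nhds 0)) (h : ∀ n, Near (ρ n) μ (c n))
    (h' : ∀ n, Near (ρ n) ν (c n)) : μ = ν := by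
  refine Measure.ext_of_charFun (funext fun t => ?_)
  have h1 : Filter.Tendsto (fun n => ENNReal.ofReal |t| * c n + ENNReal.ofReal |t| * c n)
      Filter.atTop (nhds 0) := by
    have := ENNReal.Tendsto.const_mul hc (Or.inr (ENNReal.ofReal_ne_top (r := |t|)))
    simpa using this.add this
  have h2 : ENNReal.ofReal ‖charFun μ t - charFun ν t‖ ≤ 0 := ge_of_tendsto' h1 fun n => by
    refine le_trans ?_ (add_le_add ((h n).norm_charFun_sub_le t) ((h' n).norm_charFun_sub_le t))
    rw [← ENNReal.ofReal_add (norm_nonneg _) (norm_nonneg _)]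
    refine ENNReal.ofReal_le_ofReal ?_
    rw [norm_sub_rev (charFun (ρ n) t) (charFun μ t)]
    exact norm_sub_le_norm_sub_add_norm_sub _ _ _
  rw [nonpos_iff_eq_zero, ENNReal.ofReal_eq_zero] at h2
  exact sub_eq_zero.1 (norm_le_zero_iff.1 h2)

/-- A sequence of laws on `[-1, 1]` that is Cauchy for the transportation distance converges. -/
lemma exists_near_limit {μ : ℕ → Measure ℝ} (hp : ∀ n, IsProbabilityMeasure (μ n))
    (hs : ∀ n, Supp (μ n)) {c : ℕ → ℝ≥0∞} (h : ∀ r s, r ≤ s → Near (μ r) (μ s) (c r)) :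
    ∃ ν : Measure ℝ, IsProbabilityMeasure ν ∧ Supp ν ∧ ∀ r, Near (μ r) ν (c r) := by
  classical
  set I := Set.Icc (-1 : ℝ) 1
  have h11 : (-1 : ℝ) ≤ 1 := by norm_num
  set pr : ℝ → I := Set.projIcc (-1) 1 h11
  have hpr : Measurable pr := continuous_projIcc.measurable
  have hval : ∀ n, (μ n).map (fun x => (pr x : ℝ)) = μ n := by
    intro n
    conv_rhs => rw [← Measure.map_id (μ := μ n)]
    refine Measure.map_congr ((hs n).mono fun x hx => ?_)
    exact congrArg Subtype.val (Set.projIcc_of_mem h11 hx)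
  -- The couplings are moved to the compact square by the projection onto `[-1, 1]`, which is
  -- `1`-Lipschitz and fixes almost every point.
  have hcpl : ∀ r s, r ≤ s → ∃ θ : ProbabilityMeasure (I × I),
      (θ : Measure (I × I)).map (fun q => (q.1 : ℝ)) = μ r ∧
      (θ : Measure (I × I)).map (fun q => (q.2 : ℝ)) = μ s ∧
      ∫⁻ q, ENNReal.ofReal |(q.1 : ℝ) - q.2| ∂(θ : Measure (I × I)) ≤ c r := by
    intro r s hrs
    obtain ⟨π, h1, h2, h3⟩ := h r s hrs
    have := hp r
    have : IsProbabilityMeasure π := isProbabilityMeasure_of_map measurable_fst h1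
    have hm : Measurable fun q : ℝ × ℝ => (pr q.1, pr q.2) := by fun_prop
    refine ⟨⟨π.map fun q => (pr q.1, pr q.2), Measure.isProbabilityMeasure_map hm.aemeasurable⟩,
      ?_, ?_, ?_⟩
    · simp only [ProbabilityMeasure.coe_mk]
      rw [Measure.map_map (by fun_prop) hm, ← hval r, ← h1,
        Measure.map_map (by fun_prop) measurable_fst]
      rfl
    · simp only [ProbabilityMeasure.coe_mk]
      rw [Measure.map_map (by fun_prop) hm, ← hval s, ← h2,
        Measure.map_map (by fun_prop) measurable_snd]
      rfl
    · simp only [ProbabilityMeasure.coe_mk]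
      rw [lintegral_map (measurable_ofReal_abs_sub (by fun_prop) (by fun_prop)) hm]
      refine (lintegral_mono fun q => ENNReal.ofReal_le_ofReal ?_).trans h3
      have := (LipschitzWith.projIcc h11).dist_le_mul q.1 q.2
      simpa [Subtype.dist_eq, Real.dist_eq] using this
  have : Nonempty (ProbabilityMeasure (I × I)) := ⟨(hcpl 0 0 le_rfl).choose⟩
  choose! θ hθ1 hθ2 hθ3 using hcpl
  -- For each `r` the couplings of `μ r` with `μ s` converge as `s` follows one and the same
  -- ultrafilter, by compactness. Their second marginals have a limit that does not depend on `r`,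
  -- and this is the limit law.
  set 𝒰 : Ultrafilter ℕ := Filter.hyperfilter ℕ
  have h𝒰 : ∀ r : ℕ, ∀ᶠ s in (𝒰 : Filter ℕ), r ≤ s := fun r =>
    (Nat.hyperfilter_le_atTop) (Filter.eventually_ge_atTop r)
  have hlim : ∀ r, ∃ π : ProbabilityMeasure (I × I),
      Filter.Tendsto (fun s => θ r s) 𝒰 (nhds π) := by
    intro r
    obtain ⟨π, -, hπ⟩ := isCompact_univ.ultrafilter_le_nhds (𝒰.map (θ r)) (by simp)
    exact ⟨π, hπ⟩
  choose π hπ using hlim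
  have c1 : Continuous fun q : I × I => (q.1 : ℝ) := by fun_prop
  have c2 : Continuous fun q : I × I => (q.2 : ℝ) := by fun_prop
  have t1 : ∀ r, Filter.Tendsto (fun s => (θ r s).map c1.measurable.aemeasurable) 𝒰
      (nhds ((π r).map c1.measurable.aemeasurable)) := fun r =>
    ProbabilityMeasure.tendsto_map_of_tendsto_of_continuous _ _ (hπ r) c1
  have t2 : ∀ r, Filter.Tendsto (fun s => (θ r s).map c2.measurable.aemeasurable) 𝒰
      (nhds ((π r).map c2.measurable.aemeasurable)) := fun r =>
    ProbabilityMeasure.tendsto_map_of_tendsto_of_continuous _ _ (hπ r) c2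
  have e1 : ∀ r, ((π r : Measure (I × I))).map (fun q => (q.1 : ℝ)) = μ r := by
    intro r
    have hc : Filter.Tendsto (fun s => (θ r s).map c1.measurable.aemeasurable) 𝒰
        (nhds (⟨μ r, hp r⟩ : ProbabilityMeasure ℝ)) := by
      refine tendsto_const_nhds.congr' ((h𝒰 r).mono fun s hs => ?_)
      exact Subtype.ext (hθ1 r s hs).symm
    have he : (π r).map c1.measurable.aemeasurable = (⟨μ r, hp r⟩ : ProbabilityMeasure ℝ) :=
      tendsto_nhds_unique (t1 r) hc
    exact congrArg Subtype.val he
  have e2 : ∀ r, (π r).map c2.measurable.aemeasurable = (π 0).map c2.measurable.aemeasurable := by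
    intro r
    refine tendsto_nhds_unique (t2 r) ((t2 0).congr' ((h𝒰 r).mono fun s hs => ?_))
    exact Subtype.ext ((hθ2 0 s (Nat.zero_le _)).trans (hθ2 r s hs).symm)
  set ν := (π 0).map c2.measurable.aemeasurable
  have e2' : ∀ r, (π r : Measure (I × I)).map (fun q => (q.2 : ℝ)) = (ν : Measure ℝ) := fun r =>
    congrArg Subtype.val (e2 r)
  refine ⟨ν, inferInstance, ?_, fun r => ?_⟩
  · rw [Supp, ← e2' 0, ae_map_iff (p := fun x => x ∈ Set.Icc (-1 : ℝ) 1) c2.measurable.aemeasurable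
      measurableSet_Icc]
    exact ae_of_all _ fun q => q.2.2
  · have hm : Measurable fun q : I × I => ((q.1 : ℝ), (q.2 : ℝ)) := by fun_prop
    refine ⟨(π r : Measure (I × I)).map fun q => ((q.1 : ℝ), (q.2 : ℝ)), ?_, ?_, ?_⟩
    · rw [Measure.map_map measurable_fst hm]; exact e1 r
    · rw [Measure.map_map measurable_snd hm]; exact e2' r
    · rw [lintegral_map (measurable_ofReal_abs_sub measurable_fst measurable_snd) hm]
      -- The cost is continuous on the compact square, so it passes to the weak limit.
      set f : BoundedContinuousFunction (I × I) ℝ≥0 :=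
        BoundedContinuousFunction.mkOfCompact ⟨fun q => nndist (q.1 : ℝ) q.2, by fun_prop⟩
      have hf : ∀ q : I × I, ENNReal.ofReal |(q.1 : ℝ) - q.2| = f q := by
        intro q
        rw [← Real.dist_eq, ← edist_dist, edist_nndist]
        rfl
      have hfl := (ProbabilityMeasure.tendsto_iff_forall_lintegral_tendsto.1 (hπ r)) f
      simp only [hf]
      refine le_of_tendsto hfl ((h𝒰 r).mono fun s hs => ?_)
      have := hθ3 r s hs
      simpa only [hf] using this

end Coupling

/-! ### Factorization of product averages and the cavity ratio as a hyperbolic tangent. -/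

section ProductAverage

lemma productAverage_sigma {ι : Type*} [Fintype ι] [DecidableEq ι] {κ : ι → Type*}
    [∀ i, Fintype (κ i)] [∀ i, DecidableEq (κ i)] (x : ((i : ι) × κ i) → ℝ)
    (F : ∀ i, (κ i → Bool) → ℝ) :
    productAverage x (fun σ => ∏ i, F i (fun j => σ ⟨i, j⟩)) =
      ∏ i, productAverage (fun j => x ⟨i, j⟩) (F i) := by
  simp only [productAverage]
  rw [Finset.prod_univ_sum, Fintype.piFinset_univ]
  refine Fintype.sum_equiv (Equiv.piCurry fun _ _ => Bool) _ _ fun σ => ?_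
  rw [Fintype.prod_sigma, ← Finset.prod_mul_distrib]
  rfl

/-- The spins outside the range of `e` are integrated out, their weights having total mass `1`. -/
lemma productAverage_comp {ι V : Type*} [Fintype ι] [DecidableEq ι] [Fintype V] [DecidableEq V]
    {e : ι → V} (he : Function.Injective e) (x : V → ℝ) (φ : (ι → Bool) → ℝ) :
    productAverage x (fun σ => φ (σ ∘ e)) = productAverage (x ∘ e) φ := by
  classical
  simp only [productAverage]
  set w : V → Bool → ℝ := fun v s => (1 + spin s * x v) / 2
  have hw : ∀ v, ∑ s, w v s = 1 := fun v => by simp [w, spin]; ring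
  rw [Fintype.sum_equiv (Equiv.piEquivPiSubtypeProd (fun v => ∃ j, e j = v) fun _ => Bool) _
    (fun z => (φ (fun j => z.1 ⟨e j, j, rfl⟩) * ∏ v : {v // ∃ j, e j = v}, w v (z.1 v)) *
      ∏ v : {v // ¬ ∃ j, e j = v}, w v (z.2 v))]
  · rw [Fintype.sum_prod_type]
    simp only [← Finset.mul_sum]
    have h1 : ∑ z : {v // ¬ ∃ j, e j = v} → Bool, ∏ v : {v // ¬ ∃ j, e j = v}, w v (z v) = 1 := by
      have := (Finset.prod_univ_sum (fun _ : {v // ¬ ∃ j, e j = v} => Finset.univ)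
        (fun v s => w v s)).symm
      rw [Fintype.piFinset_univ] at this
      rw [this]
      exact Finset.prod_eq_one fun v _ => hw v
    simp only [h1, mul_one]
    set r : ι ≃ {v // ∃ j, e j = v} := Equiv.ofBijective (fun j => ⟨e j, j, rfl⟩)
      ⟨fun a b h => he (congrArg Subtype.val h), fun ⟨_, j, hj⟩ => ⟨j, Subtype.ext hj⟩⟩
    refine Fintype.sum_equiv (M := ℝ)
      ((Equiv.arrowCongr r (Equiv.refl Bool)).symm) _ _ fun z => ?_
    congr 1
    exact (Fintype.prod_equiv r (fun j => w (e j) (z (r j))) (fun v => w v (z v)) fun j => rfl).symm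
  · intro σ
    rw [mul_assoc]
    congr 1
    convert (Fintype.prod_subtype_mul_prod_subtype (fun v => ∃ j, e j = v)
      (fun v => w v (σ v))).symm using 2 <;> exact Finset.prod_congr rfl fun _ _ => rfl

lemma clauseLog_comp {ι V : Type*} [Fintype ι] [DecidableEq ι] [Fintype V] [DecidableEq V]
    {e : ι → V} (he : Function.Injective e) {W : Finset V} (hW : Finset.univ.image e = W)
    (u : ℝ → ℝ) (g : V → ℝ) (h : ℝ) (x : V → ℝ) :
    clauseLog u W g h x = clauseLog u Finset.univ (g ∘ e) h (x ∘ e) := by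
  have : ∀ ε, clauseFactor u W g h ε = fun σ =>
      clauseFactor u Finset.univ (g ∘ e) h ε (σ ∘ e) := by
    intro ε
    funext σ
    simp only [clauseFactor, ← hW]
    rw [Finset.sum_image fun a _ b _ hab => he hab]
    rfl
  simp only [clauseLog, this, productAverage_comp he]

lemma productAverage_clauseFactor_pos {V : Type*} [Fintype V] [DecidableEq V] {x : V → ℝ}
    (hx : ∀ v, |x v| ≤ 1) {u : ℝ → ℝ} {U : ℝ} (hu : ∀ t, |u t| ≤ U) (W : Finset V) (g : V → ℝ)
    (h : ℝ) (ε : Bool) : 0 < productAverage x (clauseFactor u W g h ε) :=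
  (Real.exp_pos (-U)).trans_le (productAverage_mem hx fun _ => exp_mem hu _).1

/-- The clauses use disjoint slots, so under a product measure the average of `xi` factors over them
and the log-odds add up. -/
lemma cavityRatio_eq_tanh {u : ℝ → ℝ} {U : ℝ} (hu : ∀ t, |u t| ≤ U) {θ : ℕ} (τ : Fin θ → ℕ)
    (g : Slot τ → ℝ) (h : Fin θ → ℝ) {x : Slot τ → ℝ} (hx : ∀ v, |x v| ≤ 1) :
    cavityRatio u τ g h x = Real.tanh ((∑ k, clauseLog u Finset.univ (fun i => g ⟨k, i⟩) (h k)
      (fun i => x ⟨k, i⟩)) / 2) := by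
  set A : Bool → Fin θ → ℝ := fun ε k => productAverage (fun i => x ⟨k, i⟩)
    (clauseFactor u Finset.univ (fun i => g ⟨k, i⟩) (h k) ε) with hA
  have hpos : ∀ ε k, 0 < A ε k := fun ε k =>
    productAverage_clauseFactor_pos (fun i => hx ⟨k, i⟩) hu _ _ _ _
  have hxi : ∀ ε, productAverage x (fun σ => xi u τ g h σ ε) = ∏ k, A ε k := by
    intro ε
    have := productAverage_sigma x (fun k σ =>
      clauseFactor u Finset.univ (fun i => g ⟨k, i⟩) (h k) ε σ)
    rw [hA, ← this]
    congr 1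
    funext σ
    simp only [xi, clauseFactor, Real.exp_sum]
  have hnum : productAverage x (fun σ => spinAverage (fun ε => spin ε * xi u τ g h σ ε)) =
      (∏ k, A true k - ∏ k, A false k) / 2 := by
    rw [← hxi, ← hxi]
    simp only [productAverage, spinAverage, spin, ← Finset.sum_sub_distrib, Finset.sum_div]
    refine Finset.sum_congr rfl fun σ _ => ?_
    simp
    ring
  have hden : productAverage x (fun σ => spinAverage (fun ε => xi u τ g h σ ε)) =
      (∏ k, A true k + ∏ k, A false k) / 2 := by
    rw [← hxi, ← hxi]
    simp only [productAverage, spinAverage, ← Finset.sum_add_distrib, Finset.sum_div]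
    refine Finset.sum_congr rfl fun σ _ => ?_
    ring
  rw [cavityRatio, hnum, hden, div_div_div_cancel_right₀ two_ne_zero,
    div_add_eq_tanh (Finset.prod_pos fun k _ => hpos true k)
      (Finset.prod_pos fun k _ => hpos false k),
    Real.log_prod fun k _ => (hpos true k).ne', Real.log_prod fun k _ => (hpos false k).ne',
    ← Finset.sum_sub_distrib]
  rfl

lemma measurable_productAverage {V : Type*} [Fintype V] [DecidableEq V] {Z : Type*}
    [MeasurableSpace Z] {x : Z → V → ℝ} (hx : Measurable x) {f : Z → (V → Bool) → ℝ}
    (hf : ∀ σ, Measurable fun z => f z σ) :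
    Measurable fun z => productAverage (x z) (f z) := by
  unfold productAverage
  fun_prop

lemma measurable_clauseLog {V : Type*} [Fintype V] [DecidableEq V] {Z : Type*}
    [MeasurableSpace Z] {u : ℝ → ℝ} (hu : Measurable u) (W : Finset V) {g x : Z → V → ℝ}
    {h : Z → ℝ} (hg : Measurable g) (hh : Measurable h) (hx : Measurable x) :
    Measurable fun z => clauseLog u W (g z) (h z) (x z) := by
  have : ∀ ε, Measurable fun z => productAverage (x z) (clauseFactor u W (g z) (h z) ε) := by
    intro ε
    refine measurable_productAverage hx fun σ => ?_
    unfold clauseFactor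
    fun_prop
  exact ((this true).log).sub (this false).log

lemma measurable_cavityRatio {Z : Type*} [MeasurableSpace Z] {u : ℝ → ℝ} (hu : Measurable u)
    {θ : ℕ} (τ : Fin θ → ℕ) {g x : Z → Slot τ → ℝ} {h : Z → Fin θ → ℝ} (hg : Measurable g)
    (hh : Measurable h) (hx : Measurable x) :
    Measurable fun z => cavityRatio u τ (g z) (h z) (x z) := by
  unfold cavityRatio
  refine Measurable.div (measurable_productAverage hx fun σ => ?_)
    (measurable_productAverage hx fun σ => ?_) <;>
  · unfold spinAverage xi
    fun_prop

end ProductAverage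

/-! ### Reindexing and regrouping of product measures. -/

section ProductMeasure

/-- Pairing the coordinates of two product measures. -/
lemma map_prod_pi_zip {ι : Type*} [Fintype ι] {A B : ι → Type*} [∀ i, MeasurableSpace (A i)]
    [∀ i, MeasurableSpace (B i)] (μ : ∀ i, Measure (A i)) (ν : ∀ i, Measure (B i))
    [∀ i, IsProbabilityMeasure (μ i)] [∀ i, IsProbabilityMeasure (ν i)] :
    ((Measure.pi μ).prod (Measure.pi ν)).map (fun z i => (z.1 i, z.2 i)) =
      Measure.pi fun i => (μ i).prod (ν i) := by
  have hm : Measurable fun (z : (∀ i, A i) × (∀ i, B i)) i => (z.1 i, z.2 i) := by fun_prop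
  symm
  refine Measure.pi_eq_generateFrom
    (C := fun i => Set.image2 (· ×ˢ ·) {s : Set (A i) | MeasurableSet s} {t : Set (B i) | MeasurableSet t})
    (fun i => generateFrom_prod) (fun i => isPiSystem_prod)
    (fun i => ((μ i).toFiniteSpanningSetsIn.prod (ν i).toFiniteSpanningSetsIn)) ?_
  intro s hs
  choose a ha b hb hab using hs
  have hs : (fun (z : (∀ i, A i) × (∀ i, B i)) i => (z.1 i, z.2 i)) ⁻¹' (Set.univ.pi s) =
      (Set.univ.pi a) ×ˢ (Set.univ.pi b) := by
    ext z
    simp only [Set.mem_preimage, Set.mem_pi, Set.mem_univ, true_imp_iff, ← hab, Set.mem_prod,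
      forall_and]
  rw [Measure.map_apply hm (MeasurableSet.univ_pi fun i => by
    rw [← hab i]; exact (ha i).prod (hb i)), hs, Measure.prod_prod, Measure.pi_pi, Measure.pi_pi,
    ← Finset.prod_mul_distrib]
  refine Finset.prod_congr rfl fun i _ => ?_
  rw [← hab i]
  exact (Measure.prod_prod _ _).symm

lemma map_comp_pi {ι V X : Type*} [Fintype ι] [Fintype V] [MeasurableSpace X] (μ : Measure X)
    [IsProbabilityMeasure μ] {e : ι → V} (he : Function.Injective e) :
    (Measure.pi fun _ : V => μ).map (fun x => x ∘ e) = Measure.pi fun _ : ι => μ := by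
  have h := (iIndepFun_pi (μ := fun _ : V => μ) (X := fun _ x => x) fun _ => aemeasurable_id).precomp he
  rw [iIndepFun_iff_map_fun_eq_pi_map fun i => (measurable_pi_apply _).aemeasurable] at h
  refine h.trans ?_
  congr 1
  funext i
  exact (measurePreserving_eval (fun _ : V => μ) (e i)).map_eq

lemma map_sigma_pi {ι : Type*} [Fintype ι] {κ : ι → Type*} [∀ i, Fintype (κ i)] {X : Type*}
    [MeasurableSpace X] (μ : Measure X) [IsProbabilityMeasure μ] :
    (Measure.pi fun _ : (i : ι) × κ i => μ).map (fun x i j => x ⟨i, j⟩) =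
      Measure.pi fun i => Measure.pi fun _ : κ i => μ := by
  have := Measure.infinitePi_map_piCurry (ι := ι) (κ := κ) (X := fun _ _ => X) (fun _ _ => μ)
  simp only [Measure.infinitePi_eq_pi] at this
  exact this

lemma pi_mono {ι : Type*} [Fintype ι] {A : ι → Type*} [∀ i, MeasurableSpace (A i)]
    {μ ν : ∀ i, Measure (A i)} (h : ∀ i, μ i ≤ ν i) : Measure.pi μ ≤ Measure.pi ν := by
  refine Measure.le_iff.2 fun s hs => ?_
  rw [Measure.pi_def, Measure.pi_def, toMeasure_apply _ _ hs, toMeasure_apply _ _ hs]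
  refine (OuterMeasure.le_pi.2 fun s _ => (OuterMeasure.pi_pi_le _ s).trans ?_) s
  exact Finset.prod_le_prod' fun i _ => h i _

lemma tsum_prod_pi (θ : ℕ) (f : Fin θ → ℕ → ℝ≥0∞) :
    ∑' τ : Fin θ → ℕ, ∏ k, f k (τ k) = ∏ k, ∑' q, f k q := by
  induction θ with
  | zero => simp
  | succ θ ih =>
    rw [← (Fin.consEquiv fun _ => ℕ).tsum_eq, Fin.prod_univ_succ, ← ih, ENNReal.tsum_prod',
      ← ENNReal.tsum_mul_right]
    refine tsum_congr fun q => ?_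
    rw [← ENNReal.tsum_mul_left]
    refine tsum_congr fun τ => ?_
    simp [Fin.consEquiv, Fin.prod_univ_succ]

end ProductMeasure

/-! ### The operator `T` as a contraction and its fixed point. -/

section Operator

/-- The disorder and the cavity fields of one clause with `q` spins besides the cavity spin. -/
abbrev clauseData (μ : Measure ℝ) (ι : Type*) [Fintype ι] :
    Measure ((ι → ℝ) × (ι → ℝ) × ℝ) :=
  (Measure.pi fun _ : ι => μ).prod
    ((Measure.pi fun _ : ι => gaussianReal 0 1).prod (gaussianReal 0 1))

/-- The law of the log-ratio of a clause with `q` spins besides the cavity spin. -/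
def clauseLaw (u : ℝ → ℝ) (μ : Measure ℝ) (q : ℕ) : Measure ℝ :=
  (clauseData μ (Fin q)).map fun z => clauseLog u Finset.univ z.2.1 z.2.2 z.1

lemma measurable_clauseLog' {u : ℝ → ℝ} (hu : Measurable u) {ι : Type*} [Fintype ι]
    [DecidableEq ι] (W : Finset ι) : Measurable fun z : (ι → ℝ) × (ι → ℝ) × ℝ =>
      clauseLog u W z.2.1 z.2.2 z.1 :=
  measurable_clauseLog hu _ (by fun_prop) (by fun_prop) (by fun_prop)

lemma isProbabilityMeasure_clauseLaw {u : ℝ → ℝ} (hu : Measurable u) (μ : Measure ℝ)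
    [IsProbabilityMeasure μ] (q : ℕ) : IsProbabilityMeasure (clauseLaw u μ q) :=
  Measure.isProbabilityMeasure_map (measurable_clauseLog' hu _).aemeasurable

lemma ae_pi_mem {ι X : Type*} [Fintype ι] [MeasurableSpace X] (μ : Measure X)
    [IsProbabilityMeasure μ] {p : X → Prop} (h : ∀ᵐ x ∂μ, p x) :
    ∀ᵐ x ∂Measure.pi fun _ : ι => μ, ∀ i, p (x i) :=
  ae_all_iff.2 fun i =>
    (measurePreserving_eval (fun _ : ι => μ) i).quasiMeasurePreserving.ae h

lemma measurable_tanh : Measurable Real.tanh := by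
  have : Real.tanh = fun x => Real.sinh x / Real.cosh x := funext Real.tanh_eq_sinh_div_cosh
  rw [this]
  exact Real.measurable_sinh.div Real.measurable_cosh

lemma abs_tanh_le_one (x : ℝ) : |Real.tanh x| ≤ 1 := (Real.abs_tanh_lt_one x).le

/-- The joint law of the data of all the clauses. -/
lemma map_clauseData {θ : ℕ} (τ : Fin θ → ℕ) (μ : Measure ℝ) [IsProbabilityMeasure μ] :
    ((Measure.pi (fun _ : Slot τ => μ)).prod
      ((Measure.pi (fun _ : Slot τ => gaussianReal 0 1)).prod
        (Measure.pi (fun _ : Fin θ => gaussianReal 0 1)))).map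
      (fun y k => ((fun i => y.1 ⟨k, i⟩ : Fin (τ k) → ℝ), (fun i => y.2.1 ⟨k, i⟩ : Fin (τ k) → ℝ),
        y.2.2 k)) = Measure.pi fun k => clauseData μ (Fin (τ k)) := by
  rw [← map_prod_pi_zip, ← map_prod_pi_zip, ← map_sigma_pi, ← map_sigma_pi]
  have m1 : Measurable fun (x : Slot τ → ℝ) (k : Fin θ) (i : Fin (τ k)) => x ⟨k, i⟩ := by fun_prop
  have e1 := Measure.map_prod_map (Measure.pi (fun _ : Slot τ => gaussianReal 0 1))
    (Measure.pi (fun _ : Fin θ => gaussianReal 0 1)) m1 measurable_id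
  rw [Measure.map_id] at e1
  rw [e1, Measure.map_map (by fun_prop) (by fun_prop), Measure.map_prod_map _ _ m1 (by fun_prop),
    Measure.map_map (by fun_prop) (by fun_prop)]
  rfl

/-- Displays `T` as the law of `tanh (S / 2)` for a sum `S` of independent contributions, the `k`-th
depending only on `τ k`. The finite cavity fields are brought to the same shape. -/
lemma opTau_eq {u : ℝ → ℝ} (hum : Measurable u) {U : ℝ} (hu : ∀ t, |u t| ≤ U) {θ : ℕ}
    (τ : Fin θ → ℕ) (μ : Measure ℝ) [IsProbabilityMeasure μ] (hμ : Supp μ) :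
    opTau u τ μ = (Measure.pi fun k => clauseLaw u μ (τ k)).map
      fun L => Real.tanh ((∑ k, L k) / 2) := by
  have := fun q => isProbabilityMeasure_clauseLaw hum μ q
  have hL : Measurable fun L : Fin θ → ℝ => Real.tanh ((∑ k, L k) / 2) :=
    measurable_tanh.comp (by fun_prop)
  have h1 : Measure.pi (fun k => clauseLaw u μ (τ k)) =
      (Measure.pi fun k => clauseData μ (Fin (τ k))).map
        fun z k => clauseLog u Finset.univ (z k).2.1 (z k).2.2 (z k).1 :=
    (Measure.pi_map_pi fun k => (measurable_clauseLog' hum _).aemeasurable).symm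
  have m2 : Measurable fun (z : ∀ k, (Fin (τ k) → ℝ) × (Fin (τ k) → ℝ) × ℝ) k =>
      clauseLog u Finset.univ (z k).2.1 (z k).2.2 (z k).1 :=
    measurable_pi_lambda _ fun k => (measurable_clauseLog' hum _).comp (measurable_pi_apply k)
  rw [h1, ← map_clauseData, Measure.map_map m2 (by fun_prop), Measure.map_map hL
    (m2.comp (by fun_prop)), opTau]
  refine Measure.map_congr ?_
  have hx := (Measure.quasiMeasurePreserving_fst (ν := (Measure.pi (fun _ : Slot τ =>
    gaussianReal 0 1)).prod (Measure.pi (fun _ : Fin θ => gaussianReal 0 1)))).ae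
    (ae_pi_mem (ι := Slot τ) μ hμ)
  refine hx.mono fun y hy => ?_
  exact cavityRatio_eq_tanh hu τ _ _ fun v => abs_le.2 (hy v)

/-- The Poisson weights. -/
def poi (t : ℝ) (q : ℕ) : ℝ≥0∞ := ENNReal.ofReal (Real.exp (-t) * t ^ q / q.factorial)

lemma hasSum_poi_real (t : ℝ) : HasSum (fun q : ℕ => Real.exp (-t) * t ^ q / q.factorial) 1 := by
  have h := (NormedSpace.expSeries_div_hasSum_exp (𝔸 := ℝ) t).mul_left (Real.exp (-t))
  rw [← Real.exp_eq_exp_ℝ, ← Real.exp_add, neg_add_cancel, Real.exp_zero] at h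
  simpa only [mul_div_assoc] using h

lemma tsum_poi {t : ℝ} (ht : 0 ≤ t) : ∑' q, poi t q = 1 := by
  unfold poi
  rw [← ENNReal.ofReal_tsum_of_nonneg (fun q => by positivity) (hasSum_poi_real t).summable,
    (hasSum_poi_real t).tsum_eq, ENNReal.ofReal_one]

lemma tsum_poi_mul {t : ℝ} (ht : 0 ≤ t) : ∑' q, poi t q * q = ENNReal.ofReal t := by
  rw [tsum_eq_zero_add' ENNReal.summable]
  have : ∀ q : ℕ, poi t (q + 1) * ((q + 1 : ℕ) : ℝ≥0∞) = ENNReal.ofReal t * poi t q := by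
    intro q
    rw [poi, poi, ← ENNReal.ofReal_natCast, ← ENNReal.ofReal_mul (by positivity),
      ← ENNReal.ofReal_mul ht, Nat.factorial_succ]
    congr 1
    push_cast
    have : (q.factorial : ℝ) ≠ 0 := by positivity
    field_simp
    ring
  simp only [this, ENNReal.tsum_mul_left, tsum_poi ht]
  simp

lemma ofReal_kappa {α γ : ℝ} (hα : 0 ≤ α) (hγ : 0 ≤ γ) {θ : ℕ} (τ : Fin θ → ℕ) :
    ENNReal.ofReal (kappa α γ τ) = poi (α * γ) θ * ∏ k, poi γ (τ k) := by
  unfold poi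
  rw [← ENNReal.ofReal_prod_of_nonneg fun k _ => by positivity,
    ← ENNReal.ofReal_mul (by positivity)]
  congr 1
  rw [kappa, Finset.prod_div_distrib, Finset.prod_mul_distrib, Finset.prod_const,
    Finset.prod_pow_eq_pow_sum, Finset.card_univ, Fintype.card_fin, ← Real.exp_nat_mul,
    mul_neg]
  ring

lemma tsum_sigma_kappa {α γ : ℝ} (hα : 0 ≤ α) (hγ : 0 ≤ γ) :
    ∑' q : (θ : ℕ) × (Fin θ → ℕ), ENNReal.ofReal (kappa α γ q.2) = 1 := by
  rw [ENNReal.tsum_sigma' (fun q : (θ : ℕ) × (Fin θ → ℕ) => ENNReal.ofReal (kappa α γ q.2))]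
  simp only [ofReal_kappa hα hγ, ENNReal.tsum_mul_left]
  simp only [tsum_prod_pi _ fun _ q => poi γ q, tsum_poi hγ, Finset.prod_const_one, mul_one]
  exact tsum_poi (mul_nonneg hα hγ)

/-- The mean number of slots: a Poisson number of clauses with mean `α * γ`, each with a Poisson
number of spins with mean `γ`. -/
lemma tsum_sigma_kappa_mul {α γ : ℝ} (hα : 0 ≤ α) (hγ : 0 ≤ γ) :
    ∑' q : (θ : ℕ) × (Fin θ → ℕ), ENNReal.ofReal (kappa α γ q.2) * (∑ k, q.2 k : ℕ) =
      ENNReal.ofReal (α * γ ^ 2) := by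
  rw [ENNReal.tsum_sigma' (fun q : (θ : ℕ) × (Fin θ → ℕ) =>
    ENNReal.ofReal (kappa α γ q.2) * ((∑ k, q.2 k : ℕ) : ℝ≥0∞))]
  have h : ∀ θ : ℕ, ∑' τ : Fin θ → ℕ, ENNReal.ofReal (kappa α γ τ) * ((∑ k, τ k : ℕ) : ℝ≥0∞) =
      ENNReal.ofReal γ * (poi (α * γ) θ * θ) := by
    intro θ
    have h1 : ∀ τ : Fin θ → ℕ, ENNReal.ofReal (kappa α γ τ) * ((∑ k, τ k : ℕ) : ℝ≥0∞) =
        poi (α * γ) θ * ∑ j, ∏ k, (poi γ (τ k) * if k = j then (τ k : ℝ≥0∞) else 1) := by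
      intro τ
      rw [ofReal_kappa hα hγ, mul_assoc, Nat.cast_sum, Finset.mul_sum]
      congr 1
      refine Finset.sum_congr rfl fun j _ => ?_
      rw [Finset.prod_mul_distrib, Finset.prod_ite_eq' Finset.univ j]
      simp
    simp only [h1, ENNReal.tsum_mul_left]
    rw [Summable.tsum_finsetSum fun _ _ => ENNReal.summable]
    have h2 : ∀ j : Fin θ, ∑' τ : Fin θ → ℕ, ∏ k, (poi γ (τ k) * if k = j then (τ k : ℝ≥0∞) else 1) =
        ENNReal.ofReal γ := by
      intro j
      rw [tsum_prod_pi θ fun k q => poi γ q * if k = j then (q : ℝ≥0∞) else 1]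
      rw [Finset.prod_eq_single j]
      · simp [tsum_poi_mul hγ]
      · intro k _ hk
        simp [hk, tsum_poi hγ]
      · simp
    simp only [h2, Finset.sum_const, Finset.card_univ, Fintype.card_fin, nsmul_eq_mul]
    ring
  simp only [h, ENNReal.tsum_mul_left]
  rw [tsum_poi_mul (mul_nonneg hα hγ), ← ENNReal.ofReal_mul hγ]
  congr 1
  ring

lemma isProbabilityMeasure_opTau {u : ℝ → ℝ} (hum : Measurable u) {θ : ℕ} (τ : Fin θ → ℕ)
    (μ : Measure ℝ) [IsProbabilityMeasure μ] : IsProbabilityMeasure (opTau u τ μ) :=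
  Measure.isProbabilityMeasure_map
    (measurable_cavityRatio hum τ (by fun_prop) (by fun_prop) (by fun_prop)).aemeasurable

lemma isProbabilityMeasure_opT {u : ℝ → ℝ} (hum : Measurable u) {α γ : ℝ} (hα : 0 ≤ α)
    (hγ : 0 ≤ γ) (μ : Measure ℝ) [IsProbabilityMeasure μ] : IsProbabilityMeasure (opT u α γ μ) := by
  have := fun (q : (θ : ℕ) × (Fin θ → ℕ)) => isProbabilityMeasure_opTau hum q.2 μ
  refine ⟨?_⟩
  rw [opT, Measure.sum_apply _ .univ]
  simp only [Measure.smul_apply, measure_univ, smul_eq_mul, mul_one]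
  exact tsum_sigma_kappa hα hγ

lemma supp_opT {u : ℝ → ℝ} (hum : Measurable u) {U : ℝ} (hu : ∀ t, |u t| ≤ U) {α γ : ℝ}
    (μ : Measure ℝ) [IsProbabilityMeasure μ] (hμ : Supp μ) : Supp (opT u α γ μ) := by
  rw [Supp, opT, Measure.ae_sum_iff' (p := fun x => x ∈ Set.Icc (-1 : ℝ) 1) measurableSet_Icc]
  intro q
  refine Measure.ae_smul_measure ?_ _
  have hm : Measurable fun L : Fin q.1 → ℝ => Real.tanh ((∑ k, L k) / 2) :=
    measurable_tanh.comp (by fun_prop)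
  rw [opTau_eq hum hu _ μ hμ, ae_map_iff (p := fun x => x ∈ Set.Icc (-1 : ℝ) 1)
    hm.aemeasurable measurableSet_Icc]
  exact ae_of_all _ fun L => abs_le.1 (abs_tanh_le_one _)

/-- Both sides use the same Gaussian variables, and the slots carry independent copies of the
coupling. The cost is then at most `c` per slot, by the Lipschitz bound on clause log-ratios. -/
lemma near_opTau {u : ℝ → ℝ} (hum : Measurable u) {U c : ℝ≥0} (hu : ∀ t, |u t| ≤ U)
    (hc : (c : ℝ) = (Real.exp (2 * U) - 1) / 2) {μ ν : Measure ℝ} [IsProbabilityMeasure μ]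
    [IsProbabilityMeasure ν] (hμ : Supp μ) (hν : Supp ν) {d : ℝ≥0∞} (h : Near μ ν d) {θ : ℕ}
    (τ : Fin θ → ℕ) : Near (opTau u τ μ) (opTau u τ ν) (c * ((∑ k, τ k : ℕ) * d)) := by
  obtain ⟨π, h1, h2, h3⟩ := h
  have : IsProbabilityMeasure π := isProbabilityMeasure_of_map measurable_fst h1
  set G := (Measure.pi (fun _ : Slot τ => gaussianReal 0 1)).prod
    (Measure.pi (fun _ : Fin θ => gaussianReal 0 1)) with hG
  set J := (Measure.pi fun _ : Slot τ => π).prod G with hJ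
  have hf : ∀ {f : ℝ × ℝ → ℝ}, Measurable f → opTau u τ (π.map f) =
      J.map fun y => cavityRatio u τ y.2.1 y.2.2 (fun s => f (y.1 s)) := by
    intro f hf
    have : IsProbabilityMeasure (π.map f) := Measure.isProbabilityMeasure_map hf.aemeasurable
    have m : Measurable fun (x : Slot τ → ℝ × ℝ) s => f (x s) := by fun_prop
    have e := Measure.map_prod_map (Measure.pi fun _ : Slot τ => π) G m measurable_id
    rw [pi_map_coord _ hf, Measure.map_id] at e
    rw [opTau, e, Measure.map_map
      (measurable_cavityRatio hum τ (by fun_prop) (by fun_prop) (by fun_prop)) (by fun_prop)]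
    rfl
  have hπ : ∀ᵐ q ∂π, q.1 ∈ Set.Icc (-1 : ℝ) 1 ∧ q.2 ∈ Set.Icc (-1 : ℝ) 1 := by
    refine Filter.Eventually.and ?_ ?_
    · exact ae_of_ae_map measurable_fst.aemeasurable (by rw [h1]; exact hμ)
    · exact ae_of_ae_map measurable_snd.aemeasurable (by rw [h2]; exact hν)
  have hx := (Measure.quasiMeasurePreserving_fst (ν := G)).ae (ae_pi_mem (ι := Slot τ) π hπ)
  rw [← h1, ← h2, hf measurable_fst, hf measurable_snd]
  refine Near.of_map (measurable_cavityRatio hum τ (by fun_prop) (by fun_prop) (by fun_prop))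
    (measurable_cavityRatio hum τ (by fun_prop) (by fun_prop) (by fun_prop)) ?_
  calc _ ≤ ∫⁻ y, c * ∑ s : Slot τ, ENNReal.ofReal |(y.1 s).1 - (y.1 s).2| ∂J := by
        refine lintegral_mono_ae (hx.mono fun y hy => ?_)
        rw [← ENNReal.ofReal_sum_of_nonneg fun s _ => abs_nonneg _, ← ENNReal.ofReal_coe_nnreal,
          ← ENNReal.ofReal_mul c.coe_nonneg]
        refine ENNReal.ofReal_le_ofReal ?_
        rw [cavityRatio_eq_tanh hu _ _ _ fun v => abs_le.2 (hy v).1,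
          cavityRatio_eq_tanh hu _ _ _ fun v => abs_le.2 (hy v).2]
        refine (abs_tanh_sub_tanh_le _ _).trans ?_
        rw [← sub_div, ← Finset.sum_sub_distrib, abs_div, abs_two, Fintype.sum_sigma, hc,
          div_le_iff₀ two_pos, mul_assoc, mul_comm _ (2 : ℝ), ← mul_assoc,
          div_mul_cancel₀ _ (two_ne_zero' ℝ), Finset.mul_sum]
        refine (Finset.abs_sum_le_sum_abs _ _).trans (Finset.sum_le_sum fun k _ => ?_)
        exact abs_clauseLog_sub_le hu _ _ _ (fun i => abs_le.2 (hy ⟨k, i⟩).1)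
          fun i => abs_le.2 (hy ⟨k, i⟩).2
    _ = c * ∑ s : Slot τ, ∫⁻ q, ENNReal.ofReal |q.1 - q.2| ∂π := by
        have hm : ∀ s : Slot τ, Measurable fun y : (Slot τ → ℝ × ℝ) × (Slot τ → ℝ) × (Fin θ → ℝ) =>
            ENNReal.ofReal |(y.1 s).1 - (y.1 s).2| := fun s =>
          measurable_ofReal_abs_sub (by fun_prop) (by fun_prop)
        rw [lintegral_const_mul _ (Finset.measurable_fun_sum _ fun s _ => hm s),
          lintegral_finsetSum _ fun s _ => hm s]
        congr 1
        refine Finset.sum_congr rfl fun s _ => ?_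
        exact ((measurePreserving_eval (fun _ : Slot τ => π) s).comp
          (measurePreserving_fst (ν := G))).lintegral_comp
          (measurable_ofReal_abs_sub measurable_fst measurable_snd)
    _ ≤ c * ∑ s : Slot τ, d := by gcongr
    _ = _ := by
        rw [Finset.sum_const, Finset.card_univ, Fintype.card_sigma, nsmul_eq_mul]
        simp

/-- Averaging `near_opTau` over the weights replaces the number of slots by its mean, which gives
the contraction factor. -/
lemma near_opT {u : ℝ → ℝ} (hum : Measurable u) {U c : ℝ≥0} (hu : ∀ t, |u t| ≤ U)
    (hc : (c : ℝ) = (Real.exp (2 * U) - 1) / 2) {α γ : ℝ} (hα : 0 ≤ α) (hγ : 0 ≤ γ)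
    {μ ν : Measure ℝ} [IsProbabilityMeasure μ]
    [IsProbabilityMeasure ν] (hμ : Supp μ) (hν : Supp ν) {d : ℝ≥0∞} (h : Near μ ν d) :
    Near (opT u α γ μ) (opT u α γ ν) (c * ENNReal.ofReal (α * γ ^ 2) * d) := by
  have hsum := Near.sum (κ := (θ : ℕ) × (Fin θ → ℕ)) (w := fun q => ENNReal.ofReal (kappa α γ q.2))
    fun q => near_opTau hum hu hc hμ hν h q.2
  refine Near.mono (μ := opT u α γ μ) (ν := opT u α γ ν) hsum (le_of_eq ?_)
  rw [← tsum_sigma_kappa_mul hα hγ, ← ENNReal.tsum_mul_left, ← ENNReal.tsum_mul_right]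
  exact tsum_congr fun q => by ring

lemma isFixedLaw_unique {u : ℝ → ℝ} (hum : Measurable u) {U c : ℝ≥0} (hu : ∀ t, |u t| ≤ U)
    (hc : (c : ℝ) = (Real.exp (2 * U) - 1) / 2) {α γ : ℝ} (hα : 0 ≤ α) (hγ : 0 ≤ γ)
    (hlt : c * ENNReal.ofReal (α * γ ^ 2) < 1) {μ ν : Measure ℝ} (hμ : IsFixedLaw u α γ μ)
    (hν : IsFixedLaw u α γ ν) : μ = ν := by
  have := hμ.prob
  have := hν.prob
  set r := c * ENNReal.ofReal (α * γ ^ 2)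
  have h : ∀ n : ℕ, Near μ ν (r ^ n * 2) := by
    intro n
    induction n with
    | zero => simpa using near_prod hμ.supp hν.supp
    | succ n ih =>
      have := near_opT hum hu hc hα hγ hμ.supp hν.supp ih
      rwa [hμ.fixed, hν.fixed, ← mul_assoc, ← pow_succ'] at this
  refine eq_of_near (c := fun n => r ^ n * 2) ?_ h
  simpa using ENNReal.Tendsto.mul_const (ENNReal.tendsto_pow_atTop_nhds_zero_of_lt_one hlt)
    (Or.inr (by simp : (2 : ℝ≥0∞) ≠ ∞))

/-- The iterates from the Dirac measure at `0` are Cauchy for the transportation cost. The shifted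
iterates are close both to the limit and to its image under `T`, so the two agree. -/
lemma exists_isFixedLaw {u : ℝ → ℝ} (hum : Measurable u) {U c : ℝ≥0} (hu : ∀ t, |u t| ≤ U)
    (hc : (c : ℝ) = (Real.exp (2 * U) - 1) / 2) {α γ : ℝ} (hα : 0 ≤ α) (hγ : 0 ≤ γ)
    (hlt : c * ENNReal.ofReal (α * γ ^ 2) < 1) : ∃ μ, IsFixedLaw u α γ μ := by
  set r := c * ENNReal.ofReal (α * γ ^ 2)
  set μ : ℕ → Measure ℝ := fun n => (opT u α γ)^[n] (Measure.dirac 0) with hμ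
  have hsucc : ∀ n, μ (n + 1) = opT u α γ (μ n) := fun n => Function.iterate_succ_apply' _ _ _
  have hps : ∀ n, IsProbabilityMeasure (μ n) ∧ Supp (μ n) := by
    intro n
    induction n with
    | zero =>
      refine ⟨by simp only [hμ, Function.iterate_zero, id]; infer_instance, ?_⟩
      simp only [hμ, Function.iterate_zero, id, Supp]
      rw [ae_dirac_eq]
      simp
    | succ n ih =>
      have := ih.1
      rw [hsucc]
      exact ⟨isProbabilityMeasure_opT hum hα hγ _, supp_opT hum hu _ ih.2⟩
  have := fun n => (hps n).1
  have hnear : ∀ n s, Near (μ n) (μ (n + s)) (r ^ n * 2) := by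
    intro n s
    induction n with
    | zero => simpa using near_prod (hps _).2 (hps _).2
    | succ n ih =>
      have := near_opT hum hu hc hα hγ (hps _).2 (hps _).2 ih
      rwa [← hsucc, ← hsucc, ← mul_assoc, ← pow_succ', add_right_comm] at this
  obtain ⟨ν, hν, hνs, hlim⟩ := exists_near_limit this (fun n => (hps n).2)
    (c := fun n => r ^ n * 2) fun n s hs => by
      obtain ⟨k, rfl⟩ := Nat.exists_eq_add_of_le hs
      exact hnear n k
  have hp := isProbabilityMeasure_opT hum hα hγ ν
  refine ⟨ν, hν, hνs, (eq_of_near_of_near (c := fun n => r ^ (n + 1) * 2) ?_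
    (fun n => hlim (n + 1)) fun n => ?_).symm⟩
  · simpa using ENNReal.Tendsto.mul_const ((ENNReal.tendsto_pow_atTop_nhds_zero_of_lt_one
      hlt).comp (Filter.tendsto_add_atTop_nat 1)) (Or.inr (by simp : (2 : ℝ≥0∞) ≠ ∞))
  · have := near_opT hum hu hc hα hγ (hps _).2 hνs (hlim n)
    rwa [← hsucc, ← mul_assoc, ← pow_succ'] at this

end Operator

/-! ### Lower bounds for binomial mixtures. -/

section Binomial

local notation "ℙ" => unitInterval.toNNReal

lemma lintegral_bernoulliMeasure (p : unitInterval) (F : Bool → ℝ≥0∞) :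
    ∫⁻ ε, F ε ∂bernoulliMeasure true false p =
      ℙ p * F true + ℙ (unitInterval.symm p) * F false := by
  rw [bernoulliMeasure_def, lintegral_add_measure, lintegral_smul_measure, lintegral_smul_measure,
    lintegral_dirac, lintegral_dirac]
  rfl

lemma lintegral_pi_bernoulliMeasure {V : Type*} [Fintype V] [DecidableEq V] (p : unitInterval)
    (s : V) (F : (V → Bool) → ℝ≥0∞) :
    ∫⁻ β, F β ∂(Measure.pi fun _ : V => bernoulliMeasure true false p) =
      ∫⁻ β, (ℙ p * F (Function.update β s true) +
        ℙ (unitInterval.symm p) * F (Function.update β s false))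
        ∂(Measure.pi fun _ : V => bernoulliMeasure true false p) := by
  have hF : Measurable F := measurable_of_countable F
  have hm : Measurable fun z : (V → Bool) × Bool => Function.update z.1 s z.2 :=
    measurable_of_countable _
  conv_lhs => rw [← map_update_pi (fun _ : V => bernoulliMeasure true false p) s]
  rw [lintegral_map hF hm, lintegral_prod (fun z => F (Function.update z.1 s z.2))
    (hF.comp hm).aemeasurable]
  simp only [lintegral_bernoulliMeasure]

/-- A lower bound for the binomial weights. -/
def binWeight (p : unitInterval) (n q : ℕ) : ℝ≥0∞ :=
  n.choose q * ℙ p ^ q * ℙ (unitInterval.symm p) ^ n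

/-- Pascal's rule. It is only an inequality because the exponent of `1 - p` in `binWeight` is `n`
and not `n - q`. -/
lemma tsum_binWeight_succ (p : unitInterval) (n : ℕ) (f : ℕ → ℝ≥0∞) :
    ∑' q, binWeight p (n + 1) q * f q ≤ ℙ p * ∑' q, binWeight p n q * f (q + 1) +
      ℙ (unitInterval.symm p) * ∑' q, binWeight p n q * f q := by
  have hq : (ℙ (unitInterval.symm p) : ℝ≥0∞) ≤ 1 := by
    rw [← ENNReal.coe_one, ENNReal.coe_le_coe, ← unitInterval.toNNReal_symm_add_toNNReal p]
    exact le_self_add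
  rw [tsum_eq_zero_add' ENNReal.summable, ← ENNReal.tsum_mul_left, ← ENNReal.tsum_mul_left,
    tsum_eq_zero_add' (f := fun q => _ * (binWeight p n q * f q)) ENNReal.summable]
  have h0 : binWeight p (n + 1) 0 * f 0 =
      ℙ (unitInterval.symm p) * (binWeight p n 0 * f 0) := by
    simp only [binWeight, Nat.choose_zero_right, pow_zero, pow_succ]
    ring
  rw [h0, ← add_assoc, add_comm (∑' q, _) _, add_assoc, ← ENNReal.tsum_add]
  gcongr with q
  simp only [binWeight, Nat.choose_succ_succ', Nat.cast_add]
  calc _ = ℙ (unitInterval.symm p) * (ℙ p * (n.choose q * ℙ p ^ q * ℙ (unitInterval.symm p) ^ n *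
        f (q + 1))) + ℙ (unitInterval.symm p) *
        (n.choose (q + 1) * ℙ p ^ (q + 1) * ℙ (unitInterval.symm p) ^ n * f (q + 1)) := by
        ring
    _ ≤ 1 * (ℙ p * (n.choose q * ℙ p ^ q * ℙ (unitInterval.symm p) ^ n *
        f (q + 1))) + _ := by gcongr
    _ = _ := by rw [one_mul]

/-- The number of successes among the spins of `W` has a law that dominates `binWeight`; the spins
are added one at a time. -/
lemma tsum_binWeight_le {V : Type*} [Fintype V] [DecidableEq V] (p : unitInterval) (W : Finset V) :
    ∀ f : ℕ → ℝ≥0∞, ∑' q, binWeight p W.card q * f q ≤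
      ∫⁻ β, f (W.filter (fun v => β v = true)).card
        ∂(Measure.pi fun _ : V => bernoulliMeasure true false p) := by
  induction W using Finset.induction_on with
  | empty =>
    intro f
    rw [tsum_eq_single 0]
    · simp [binWeight]
    · intro q hq
      simp [binWeight, Nat.choose_eq_zero_of_lt (Nat.pos_of_ne_zero hq)]
  | insert s W hs ih =>
    intro f
    rw [Finset.card_insert_of_notMem hs]
    refine (tsum_binWeight_succ p _ f).trans ?_
    rw [lintegral_pi_bernoulliMeasure p s]
    have h1 : ∀ (β : V → Bool) ε, W.filter (fun v => Function.update β s ε v = true) =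
        W.filter (fun v => β v = true) := by
      intro β ε
      refine Finset.filter_congr fun v hv => ?_
      rw [Function.update_of_ne (ne_of_mem_of_not_mem hv hs)]
    simp only [Finset.filter_insert, Function.update_self, h1, if_true, Bool.false_eq_true, if_false]
    rw [lintegral_add_left (measurable_of_countable _), lintegral_const_mul _ (measurable_of_countable _),
      lintegral_const_mul _ (measurable_of_countable _)]
    have h2 : ∀ β : V → Bool, (insert s (W.filter (fun v => β v = true))).card =
        (W.filter (fun v => β v = true)).card + 1 := fun β =>
      Finset.card_insert_of_notMem fun h => hs (Finset.mem_of_mem_filter _ h)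
    simp only [h2]
    gcongr
    · exact ih fun q => f (q + 1)
    · exact ih f

end Binomial

/-! ### The law of the contribution of one clause. -/

section ClauseValue

local notation "ℙ" => unitInterval.toNNReal

variable {V : Type*} [Fintype V] [DecidableEq V]

/-- By exchangeability the law depends on `W` only through its size; `i ∉ W` makes the Gaussian of
the cavity spin independent of those of the neighbours. -/
lemma map_clauseLog_eq {u : ℝ → ℝ} (hum : Measurable u) (μ : Measure ℝ) [IsProbabilityMeasure μ]
    {W : Finset V} {i : V} (hi : i ∉ W) :
    ((Measure.pi fun _ : V => gaussianReal 0 1).prod (Measure.pi fun _ : V => μ)).map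
      (fun z => clauseLog u W z.1 (z.1 i) z.2) = clauseLaw u μ W.card := by
  set e : Fin W.card → V := fun j => (W.equivFin.symm j : V) with he
  have hinj : Function.Injective e := fun a b h => W.equivFin.symm.injective (Subtype.ext h)
  have himg : Finset.univ.image e = W := by
    ext v
    simp only [Finset.mem_image, Finset.mem_univ, true_and, he]
    exact ⟨fun ⟨j, hj⟩ => hj ▸ (W.equivFin.symm j).2, fun hv => ⟨W.equivFin ⟨v, hv⟩, by simp⟩⟩
  set e' : Fin (W.card + 1) → V := Fin.cons i e with he'
  have hinj' : Function.Injective e' := Fin.cons_injective_iff.2 ⟨by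
    rintro ⟨j, rfl⟩
    exact hi (W.equivFin.symm j).2, hinj⟩
  have h1 : (Measure.pi fun _ : V => gaussianReal 0 1).map (fun g => (g ∘ e, g i)) =
      (Measure.pi fun _ : Fin W.card => gaussianReal 0 1).prod (gaussianReal 0 1) := by
    have hp := (measurePreserving_piFinSuccAbove (fun _ : Fin (W.card + 1) => gaussianReal 0 1) 0).map_eq
    rw [← map_comp_pi (gaussianReal 0 1) hinj', Measure.map_map (MeasurableEquiv.measurable _)
      (by fun_prop)] at hp
    rw [← Measure.prod_swap, ← hp, Measure.map_map measurable_swap (by fun_prop)]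
    rfl
  have h2 := Measure.map_prod_map (Measure.pi fun _ : V => gaussianReal 0 1)
    (Measure.pi fun _ : V => μ) (f := fun g => (g ∘ e, g i)) (g := fun x => x ∘ e)
    (by fun_prop) (by fun_prop)
  rw [h1, map_comp_pi μ hinj] at h2
  rw [clauseLaw, clauseData, ← Measure.prod_swap (μ := (Measure.pi fun _ : Fin W.card =>
    gaussianReal 0 1).prod (gaussianReal 0 1)) (ν := Measure.pi fun _ : Fin W.card => μ), h2, Measure.map_map measurable_swap (by fun_prop),
    Measure.map_map (measurable_clauseLog' hum _) (by fun_prop)]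
  congr 1
  funext z
  exact clauseLog_comp hinj himg u _ _ _

/-- The contribution of a clause to the cavity field on the spin `i`. -/
def clauseVal (u : ℝ → ℝ) (i : V) (W : Finset V) (y : V → Bool × ℝ) (z : V → ℝ) : ℝ :=
  if (y i).1 then clauseLog u (W.filter fun v => (y v).1 = true) (fun v => (y v).2) (y i).2 z else 0

lemma measurable_clauseVal {u : ℝ → ℝ} (hum : Measurable u) (i : V) (W : Finset V) :
    Measurable fun z : (V → Bool × ℝ) × (V → ℝ) => clauseVal u i W z.1 z.2 := by
  have : (fun z : (V → Bool × ℝ) × (V → ℝ) => clauseVal u i W z.1 z.2) = fun z =>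
      ∑ β : V → Bool, if (fun v => (z.1 v).1) = β then (if β i then
        clauseLog u (W.filter fun v => β v = true) (fun v => (z.1 v).2) (z.1 i).2 z.2 else 0)
        else 0 := by
    funext z
    rw [Finset.sum_ite_eq Finset.univ, if_pos (Finset.mem_univ _)]
    rfl
  rw [this]
  refine Finset.measurable_fun_sum _ fun β _ => Measurable.ite ?_ ?_ measurable_const
  · exact (by fun_prop : Measurable fun z : (V → Bool × ℝ) × (V → ℝ) => fun v => (z.1 v).1)
      (MeasurableSet.singleton β)
  · split_ifs
    · exact measurable_clauseLog hum _ (by fun_prop) (by fun_prop) (by fun_prop)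
    · exact measurable_const

/-- The law of the contribution of a clause to a cavity field. -/
def clauseValLaw (p : unitInterval) (u : ℝ → ℝ) (i : V) (W : Finset V) (μ : Measure ℝ) : Measure ℝ :=
  ((Measure.pi fun _ : V => siteLaw p).prod (Measure.pi fun _ : V => μ)).map
    fun z => clauseVal u i W z.1 z.2

/-- The common part of the mixtures of the laws `clauseLaw` with binomial and Poisson weights. -/
def mixLaw (u : ℝ → ℝ) (μ : Measure ℝ) (w : ℕ → ℝ≥0∞) : Measure ℝ :=
  Measure.sum fun q => w q • clauseLaw u μ q

/-- With the bit of `i` off the contribution vanishes. With the bit on, which happens with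
probability `p` independently of `W`, the number of neighbours dominates the weights `binWeight`. -/
lemma le_clauseValLaw (p : unitInterval) {u : ℝ → ℝ} (hum : Measurable u) (μ : Measure ℝ)
    [IsProbabilityMeasure μ] {W : Finset V} {i : V} (hi : i ∉ W) :
    ℙ (unitInterval.symm p) • Measure.dirac 0 + ℙ p • mixLaw u μ (binWeight p W.card) ≤
      clauseValLaw p u i W μ := by
  set B := Measure.pi fun _ : V => bernoulliMeasure true false p
  set G := Measure.pi fun _ : V => gaussianReal 0 1
  refine Measure.le_iff.2 fun S hS => ?_
  have hz := map_prod_pi_zip (fun _ : V => bernoulliMeasure true false p) (fun _ : V => gaussianReal 0 1)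
  have h1 := Measure.map_prod_map (B.prod G) (Measure.pi fun _ : V => μ)
    (f := fun z i => (z.1 i, z.2 i)) (g := id) (by fun_prop) measurable_id
  rw [Measure.map_id, hz] at h1
  have h2 := (MeasureTheory.measurePreserving_prodAssoc B G (Measure.pi fun _ : V => μ)).symm
  have hcv := measurable_clauseVal hum i W
  have h3 : clauseValLaw p u i W μ S = ∫⁻ β, (if β i then clauseLaw u μ
      (W.filter fun v => β v = true).card S else Measure.dirac 0 S) ∂B := by
    have e : clauseValLaw p u i W μ = (B.prod (G.prod (Measure.pi fun _ : V => μ))).map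
        (fun z => clauseVal u i W (fun v => (z.1 v, z.2.1 v)) z.2.2) := by
      have : clauseValLaw p u i W μ = ((Measure.pi fun _ : V => (bernoulliMeasure true false p).prod
        (gaussianReal 0 1)).prod (Measure.pi fun _ : V => μ)).map
          fun z => clauseVal u i W z.1 z.2 := rfl
      rw [this, h1, Measure.map_map hcv (by fun_prop), ← h2.map_eq,
        Measure.map_map (hcv.comp (by fun_prop)) h2.measurable]
      rfl
    have hm : Measurable fun z : (V → Bool) × (V → ℝ) × (V → ℝ) =>
        clauseVal u i W (fun v => (z.1 v, z.2.1 v)) z.2.2 :=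
      hcv.comp (f := fun z : (V → Bool) × (V → ℝ) × (V → ℝ) =>
        ((fun v => (z.1 v, z.2.1 v) : V → Bool × ℝ), z.2.2)) (by fun_prop)
    rw [e, Measure.map_apply hm hS, Measure.prod_apply (hm hS)]
    refine lintegral_congr fun β => ?_
    split_ifs with hβ
    · rw [← map_clauseLog_eq hum μ (i := i) (fun h => hi (Finset.mem_of_mem_filter _ h)),
        Measure.map_apply (measurable_clauseLog hum _ (by fun_prop) (by fun_prop) (by fun_prop)) hS]
      congr 1
      ext z
      simp [clauseVal, hβ]
    · have : (Prod.mk β ⁻¹' ((fun z : (V → Bool) × (V → ℝ) × (V → ℝ) =>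
          clauseVal u i W (fun v => (z.1 v, z.2.1 v)) z.2.2) ⁻¹' S)) = (fun _ => (0 : ℝ)) ⁻¹' S := by
        ext z
        simp [clauseVal, hβ]
      rw [this]
      by_cases h0 : (0 : ℝ) ∈ S <;> simp [h0, hS]
  rw [h3, lintegral_pi_bernoulliMeasure p i]
  have h4 : ∀ (β : V → Bool) ε, W.filter (fun v => Function.update β i ε v = true) =
      W.filter (fun v => β v = true) := by
    intro β ε
    refine Finset.filter_congr fun v hv => ?_
    rw [Function.update_of_ne (ne_of_mem_of_not_mem hv hi)]
  simp only [Function.update_self, h4, if_true, Bool.false_eq_true, if_false]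
  rw [lintegral_add_left (measurable_of_countable _), lintegral_const_mul _ (measurable_of_countable _),
    lintegral_const, measure_univ, mul_one]
  rw [Measure.add_apply, Measure.smul_apply, Measure.smul_apply, ENNReal.smul_def, ENNReal.smul_def,
    smul_eq_mul, smul_eq_mul, mixLaw, Measure.sum_apply _ hS, add_comm]
  gcongr
  simpa using tsum_binWeight_le p W fun q => clauseLaw u μ q S

end ClauseValue

/-! ### Convolution powers. -/

section Sums

local notation "ℙ" => unitInterval.toNNReal

/-- The law of the sum of `θ` independent variables of law `κ`. -/
def sumLaw (κ : Measure ℝ) (θ : ℕ) : Measure ℝ :=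
  (Measure.pi fun _ : Fin θ => κ).map fun x => ∑ k, x k

lemma charFun_sumLaw (κ : Measure ℝ) [IsFiniteMeasure κ] (θ : ℕ) (t : ℝ) :
    charFun (sumLaw κ θ) t = charFun κ t ^ θ := by
  have hm : Measurable fun x : Fin θ → ℝ => ∑ k, x k := by fun_prop
  rw [charFun_apply_real, sumLaw, integral_map hm.aemeasurable (by fun_prop)]
  have := integral_fintype_prod_eq_pow (ι := Fin θ) (𝕜 := ℂ)
    (fun x : ℝ => Complex.exp (t * x * Complex.I)) (μ := κ)
  rw [Fintype.card_fin] at this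
  rw [charFun_apply_real, ← this]
  congr 1
  funext x
  rw [← Complex.exp_sum]
  push_cast
  rw [Finset.mul_sum, Finset.sum_mul]

instance (κ : Measure ℝ) [IsFiniteMeasure κ] (θ : ℕ) : IsFiniteMeasure (sumLaw κ θ) := by
  unfold sumLaw; infer_instance

lemma integrable_charFun (κ : Measure ℝ) [IsFiniteMeasure κ] (t : ℝ) :
    Integrable (fun x : ℝ => Complex.exp (t * x * Complex.I)) κ := by
  refine Integrable.of_bound (C := 1) (by fun_prop) (ae_of_all _ fun q => ?_)
  rw [← Complex.ofReal_mul, Complex.norm_exp_ofReal_mul_I]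

lemma charFun_smul_measure (a : ℝ≥0) (κ : Measure ℝ) (t : ℝ) :
    charFun (a • κ) t = a * charFun κ t := by
  rw [charFun_apply_real, charFun_apply_real, integral_smul_nnreal_measure]
  exact NNReal.smul_def _ _

lemma charFun_add_measure (κ κ' : Measure ℝ) [IsFiniteMeasure κ] [IsFiniteMeasure κ'] (t : ℝ) :
    charFun (κ + κ') t = charFun κ t + charFun κ' t := by
  simp only [charFun_apply_real]
  exact integral_add_measure (integrable_charFun _ _) (integrable_charFun _ _)

/-- The binomial theorem for convolution powers. -/
lemma sumLaw_smul_dirac_add (a b : ℝ≥0) (κ : Measure ℝ) [IsFiniteMeasure κ] (n : ℕ) :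
    sumLaw (a • Measure.dirac 0 + b • κ) n = ∑ q ∈ Finset.range (n + 1),
      ((n.choose q * b ^ q * a ^ (n - q) : ℝ≥0)) • sumLaw κ q := by
  -- Characteristic functions turn convolution powers into powers, so the scalar binomial theorem
  -- suffices. The measures are finite but need not have mass `1`.
  refine Measure.ext_of_charFun (funext fun t => ?_)
  rw [charFun_sumLaw, charFun_add_measure, charFun_smul_measure, charFun_smul_measure, charFun_dirac]
  have : charFun (∑ q ∈ Finset.range (n + 1),
      ((n.choose q * b ^ q * a ^ (n - q) : ℝ≥0)) • sumLaw κ q) t =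
      ∑ q ∈ Finset.range (n + 1), ((n.choose q * b ^ q * a ^ (n - q) : ℝ≥0)) *
        charFun κ t ^ q := by
    rw [charFun_apply_real, integral_finsetSum_measure fun q _ => integrable_charFun _ _]
    refine Finset.sum_congr rfl fun q _ => ?_
    rw [← charFun_sumLaw, ← charFun_smul_measure, charFun_apply_real]
  rw [this, add_comm, add_pow]
  refine Finset.sum_congr rfl fun q _ => ?_
  simp only [inner_zero_left, Complex.ofReal_zero, zero_mul, Complex.exp_zero, mul_one]
  push_cast
  ring

lemma sumLaw_mono {κ κ' : Measure ℝ} (h : κ ≤ κ') (θ : ℕ) : sumLaw κ θ ≤ sumLaw κ' θ :=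
  Measure.map_mono (pi_mono fun _ => h) (by fun_prop)

end Sums

/-! ### Poisson approximation of the law of a cavity field. -/

section CavityLaw

local notation "ℙ" => unitInterval.toNNReal

lemma toNNReal_eq_ofReal (p : unitInterval) : (ℙ p : ℝ≥0∞) = ENNReal.ofReal p := by
  rw [← ENNReal.ofReal_coe_nnreal, unitInterval.coe_toNNReal]

lemma toNNReal_symm_eq_ofReal (p : unitInterval) :
    (ℙ (unitInterval.symm p) : ℝ≥0∞) = ENNReal.ofReal (1 - p) := by
  rw [toNNReal_eq_ofReal, unitInterval.coe_symm_eq]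

lemma one_sub_nonneg (p : unitInterval) : 0 ≤ 1 - (p : ℝ) := sub_nonneg.2 p.2.2

lemma binWeight_eq (p : unitInterval) (n q : ℕ) :
    binWeight p n q = ENNReal.ofReal (n.choose q * (p : ℝ) ^ q * (1 - p) ^ n) := by
  have := one_sub_nonneg p
  have := p.2.1
  rw [binWeight, toNNReal_eq_ofReal, toNNReal_symm_eq_ofReal, ENNReal.ofReal_mul (by positivity),
    ENNReal.ofReal_mul (by positivity), ENNReal.ofReal_natCast, ENNReal.ofReal_pow (by positivity),
    ENNReal.ofReal_pow (by positivity)]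

/-- A common lower bound for the binomial and the Poisson weights. -/
def lowWeight (p : unitInterval) (n : ℕ) (t : ℝ) (q : ℕ) : ℝ≥0∞ :=
  ENNReal.ofReal (Real.exp (-(t - n * p))) * binWeight p n q

lemma lowWeight_le_binWeight {p : unitInterval} {n : ℕ} {t : ℝ} (h : n * (p : ℝ) ≤ t) (q : ℕ) :
    lowWeight p n t q ≤ binWeight p n q := by
  refine (mul_le_mul_left (ENNReal.ofReal_le_one.2 ?_) _).trans_eq (one_mul _)
  rw [Real.exp_le_one_iff]
  linarith

/-- Combine `(1 - p) ^ n ≤ exp (-(n * p))` with `n.choose q ≤ n ^ q / q!`; the prefactor `exp (-(t -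
n * p))` then restores the exponent `t`. -/
lemma lowWeight_le_poi {p : unitInterval} {n : ℕ} {t : ℝ} (h : n * (p : ℝ) ≤ t) (q : ℕ) :
    lowWeight p n t q ≤ poi t q := by
  have h1 := one_sub_nonneg p
  have h2 := p.2.1
  have ht : 0 ≤ t := le_trans (by positivity) h
  rw [lowWeight, poi, binWeight_eq, ← ENNReal.ofReal_mul (by positivity)]
  refine ENNReal.ofReal_le_ofReal ?_
  have h3 : (1 - (p : ℝ)) ^ n ≤ Real.exp (-(n * p)) := by
    rw [← mul_neg, Real.exp_nat_mul]
    gcongr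
    linarith [Real.add_one_le_exp (-(p : ℝ))]
  have h4 : (n.choose q : ℝ) * (p : ℝ) ^ q ≤ t ^ q / q.factorial := by
    calc _ ≤ ((n : ℝ) ^ q / q.factorial) * (p : ℝ) ^ q := by
          gcongr
          exact Nat.choose_le_pow_div q n
      _ = (n * (p : ℝ)) ^ q / q.factorial := by rw [mul_pow]; ring
      _ ≤ _ := by gcongr
  calc _ ≤ Real.exp (-(t - n * p)) * (t ^ q / q.factorial * Real.exp (-(n * p))) := by
        gcongr
    _ = (Real.exp (-(t - n * p)) * Real.exp (-(n * p))) * t ^ q / q.factorial := by ring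
    _ = _ := by
        rw [← Real.exp_add]
        congr 3
        ring

/-- The generating function gives the mass of the minorant: at `x = 1` for one clause, and at the
mass of a clause for a random sum of clauses. -/
lemma tsum_lowWeight_mul_pow (p : unitInterval) (n : ℕ) (t : ℝ) {x : ℝ} (hx : 0 ≤ x) :
    ∑' q, lowWeight p n t q * ENNReal.ofReal x ^ q =
      ENNReal.ofReal (Real.exp (-(t - n * p)) * ((1 - p) * (1 + p * x)) ^ n) := by
  have h1 := one_sub_nonneg p
  have h2 := p.2.1
  have h3 : ∀ q, lowWeight p n t q * ENNReal.ofReal x ^ q = ENNReal.ofReal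
      (Real.exp (-(t - n * p)) * (n.choose q * (p : ℝ) ^ q * (1 - p) ^ n) * x ^ q) := by
    intro q
    rw [lowWeight, binWeight_eq, ← ENNReal.ofReal_mul (by positivity), ← ENNReal.ofReal_pow hx,
      ← ENNReal.ofReal_mul (by positivity)]
  rw [tsum_eq_sum (s := Finset.range (n + 1))]
  · simp only [h3]
    rw [← ENNReal.ofReal_sum_of_nonneg fun q _ => by positivity, mul_pow, add_comm (1 : ℝ), add_pow]
    congr 1
    rw [Finset.mul_sum, Finset.mul_sum]
    refine Finset.sum_congr rfl fun q _ => ?_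
    rw [mul_pow, one_pow]
    ring
  · intro q hq
    rw [h3, Nat.choose_eq_zero_of_lt (by simpa using hq)]
    simp

lemma mixLaw_mono {u : ℝ → ℝ} {μ : Measure ℝ} {w w' : ℕ → ℝ≥0∞} (h : ∀ q, w q ≤ w' q) :
    mixLaw u μ w ≤ mixLaw u μ w' := by
  refine Measure.le_iff.2 fun S hS => ?_
  rw [mixLaw, mixLaw, Measure.sum_apply _ hS, Measure.sum_apply _ hS]
  refine ENNReal.tsum_le_tsum fun q => ?_
  rw [Measure.smul_apply, Measure.smul_apply, smul_eq_mul, smul_eq_mul]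
  gcongr
  exact h q

lemma mixLaw_univ {u : ℝ → ℝ} (hum : Measurable u) (μ : Measure ℝ) [IsProbabilityMeasure μ]
    (w : ℕ → ℝ≥0∞) : mixLaw u μ w Set.univ = ∑' q, w q := by
  have := fun q => isProbabilityMeasure_clauseLaw hum μ q
  rw [mixLaw, Measure.sum_apply _ .univ]
  simp

/-- The law of `tanh (S / 2)` for a sum `S` of a random number of independent variables. -/
def outLaw (w : ℕ → ℝ≥0∞) (κ : Measure ℝ) : Measure ℝ :=
  Measure.sum fun θ => w θ • (sumLaw κ θ).map fun x => Real.tanh (x / 2)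

lemma measurable_tanh_half : Measurable fun x : ℝ => Real.tanh (x / 2) :=
  measurable_tanh.comp (by fun_prop)

lemma map_sumLaw (κ : Measure ℝ) (θ : ℕ) : (sumLaw κ θ).map (fun x => Real.tanh (x / 2)) =
    (Measure.pi fun _ : Fin θ => κ).map fun L => Real.tanh ((∑ k, L k) / 2) :=
  Measure.map_map measurable_tanh_half (by fun_prop)

lemma pi_mixLaw {u : ℝ → ℝ} (hum : Measurable u) (μ : Measure ℝ) [IsProbabilityMeasure μ]
    (w : ℕ → ℝ≥0∞) [IsFiniteMeasure (mixLaw u μ w)] (θ : ℕ) :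
    Measure.pi (fun _ : Fin θ => mixLaw u μ w) = Measure.sum fun τ : Fin θ → ℕ =>
      (∏ k, w (τ k)) • Measure.pi fun k => clauseLaw u μ (τ k) := by
  have := fun q => isProbabilityMeasure_clauseLaw hum μ q
  refine Measure.pi_eq fun s hs => ?_
  rw [Measure.sum_apply _ (MeasurableSet.univ_pi hs)]
  simp only [Measure.smul_apply, Measure.pi_pi, smul_eq_mul, ← Finset.prod_mul_distrib]
  rw [tsum_prod_pi θ fun k q => w q * clauseLaw u μ q (s k)]
  refine Finset.prod_congr rfl fun k _ => ?_
  rw [mixLaw, Measure.sum_apply _ (hs k)]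
  rfl

/-- Both sides are compound sums of the same clause laws, with smaller weights on the left. Together
with `outLaw_le_cavityLaw` this provides the common part required by `near_of_common`. -/
lemma outLaw_le_opT {u : ℝ → ℝ} (hum : Measurable u) {U : ℝ} (hu : ∀ t, |u t| ≤ U) {α γ : ℝ}
    (hα : 0 ≤ α) (hγ : 0 ≤ γ) (μ : Measure ℝ) [IsProbabilityMeasure μ] (hμ : Supp μ)
    {w w' : ℕ → ℝ≥0∞} (hw : ∀ q, w q ≤ poi (α * γ) q) (hw' : ∀ q, w' q ≤ poi γ q)
    [IsFiniteMeasure (mixLaw u μ w')] : outLaw w (mixLaw u μ w') ≤ opT u α γ μ := by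
  refine Measure.le_iff.2 fun S hS => ?_
  rw [outLaw, opT, Measure.sum_apply _ hS, Measure.sum_apply _ hS, ENNReal.tsum_sigma']
  refine ENNReal.tsum_le_tsum fun θ => ?_
  have hL : Measurable fun L : Fin θ → ℝ => Real.tanh ((∑ k, L k) / 2) :=
    measurable_tanh.comp (by fun_prop)
  rw [map_sumLaw, Measure.smul_apply, Measure.map_apply hL hS, pi_mixLaw hum, Measure.sum_apply _ (hL hS), smul_eq_mul,
    ← ENNReal.tsum_mul_left]
  refine ENNReal.tsum_le_tsum fun τ => ?_
  rw [Measure.smul_apply, Measure.smul_apply, smul_eq_mul, smul_eq_mul, ofReal_kappa hα hγ,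
    opTau_eq hum hu _ _ hμ, Measure.map_apply hL hS, ← mul_assoc]
  gcongr
  · exact hw θ
  · exact hw' _

variable {V E : Type*} [Fintype V] [Fintype E] [DecidableEq V] [DecidableEq E]

/-- The cavity field on the spin `i` for given values `z` of the neighbouring magnetizations. -/
def cavityField (u : ℝ → ℝ) (i : V) (W : Finset V) (Es : Finset E) (y : V × E → Bool × ℝ)
    (z : V × E → ℝ) : ℝ :=
  Real.tanh ((∑ k ∈ Es, clauseVal u i W (fun v => y (v, k)) (fun v => z (v, k))) / 2)

lemma measurable_cavityField {u : ℝ → ℝ} (hum : Measurable u) (i : V) (W : Finset V)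
    (Es : Finset E) : Measurable fun z : (V × E → Bool × ℝ) × (V × E → ℝ) =>
      cavityField u i W Es z.1 z.2 := by
  refine measurable_tanh.comp (Measurable.div_const (Finset.measurable_fun_sum _ fun k _ => ?_) _)
  exact (measurable_clauseVal hum i W).comp (f := fun z : (V × E → Bool × ℝ) × (V × E → ℝ) =>
    ((fun v => z.1 (v, k) : V → Bool × ℝ), (fun v => z.2 (v, k) : V → ℝ))) (by fun_prop)

lemma map_columns {X : Type*} [MeasurableSpace X] (μ : Measure X) [IsProbabilityMeasure μ] :
    (Measure.pi fun _ : V × E => μ).map (fun x k v => x (v, k)) =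
      Measure.pi fun _ : E => Measure.pi fun _ : V => μ := by
  have he : Function.Injective (fun s : (_ : E) × V => (s.2, s.1)) := by
    rintro ⟨a, b⟩ ⟨a', b'⟩ h
    simp only [Prod.mk.injEq] at h
    rw [h.1, h.2]
  rw [← map_sigma_pi, ← map_comp_pi μ he, Measure.map_map (by fun_prop) (by fun_prop)]
  rfl

/-- The law of a cavity field. -/
def cavityLaw (p : unitInterval) (u : ℝ → ℝ) (i : V) (W : Finset V) (Es : Finset E)
    (μ : Measure ℝ) : Measure ℝ :=
  ((arrayLaw V E p).prod (Measure.pi fun _ : V × E => μ)).map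
    fun z => cavityField u i W Es z.1 z.2

lemma isProbabilityMeasure_clauseValLaw (p : unitInterval) {u : ℝ → ℝ} (hum : Measurable u)
    (i : V) (W : Finset V) (μ : Measure ℝ) [IsProbabilityMeasure μ] :
    IsProbabilityMeasure (clauseValLaw p u i W μ) :=
  Measure.isProbabilityMeasure_map (measurable_clauseVal hum i W).aemeasurable

lemma isProbabilityMeasure_cavityLaw (p : unitInterval) {u : ℝ → ℝ} (hum : Measurable u)
    (i : V) (W : Finset V) (Es : Finset E) (μ : Measure ℝ) [IsProbabilityMeasure μ] :
    IsProbabilityMeasure (cavityLaw p u i W Es μ) :=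
  Measure.isProbabilityMeasure_map (measurable_cavityField hum i W Es).aemeasurable

lemma supp_cavityLaw (p : unitInterval) {u : ℝ → ℝ} (hum : Measurable u)
    (i : V) (W : Finset V) (Es : Finset E) (μ : Measure ℝ) :
    Supp (cavityLaw p u i W Es μ) := by
  rw [cavityLaw, Supp, ae_map_iff (p := fun x => x ∈ Set.Icc (-1 : ℝ) 1)
    (measurable_cavityField hum i W Es).aemeasurable measurableSet_Icc]
  exact ae_of_all _ fun L => abs_le.1 (abs_tanh_le_one _)

/-- Different clauses read different columns of the arrays, so their contributions are independent
and identically distributed. -/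
lemma cavityLaw_eq (p : unitInterval) {u : ℝ → ℝ} (hum : Measurable u) (i : V) (W : Finset V)
    (Es : Finset E) (μ : Measure ℝ) [IsProbabilityMeasure μ] :
    cavityLaw p u i W Es μ =
      (sumLaw (clauseValLaw p u i W μ) Es.card).map fun x => Real.tanh (x / 2) := by
  have := isProbabilityMeasure_clauseValLaw p hum i W μ
  set e : Fin Es.card → E := fun j => (Es.equivFin.symm j : E) with he
  have hinj : Function.Injective e := fun a b h => Es.equivFin.symm.injective (Subtype.ext h)
  have hsum : ∀ f : E → ℝ, ∑ k ∈ Es, f k = ∑ j, f (e j) := by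
    intro f
    rw [← Finset.sum_coe_sort]
    exact Fintype.sum_equiv Es.equivFin _ _ fun k => by simp [he]
  have hcv := measurable_clauseVal hum i W
  have hcv' : Measurable fun (z : E → (V → Bool × ℝ) × (V → ℝ)) k =>
      clauseVal u i W (z k).1 (z k).2 :=
    measurable_pi_lambda _ fun k => hcv.comp (measurable_pi_apply k)
  have h1 := Measure.map_prod_map (arrayLaw V E p) (Measure.pi fun _ : V × E => μ)
    (f := fun x k v => x (v, k)) (g := fun x k v => x (v, k)) (by fun_prop) (by fun_prop)
  rw [arrayLaw, map_columns, map_columns] at h1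
  have h2 : (Measure.pi fun _ : E => clauseValLaw p u i W μ) =
      (Measure.pi fun _ : E => (Measure.pi fun _ : V => siteLaw p).prod
        (Measure.pi fun _ : V => μ)).map fun z k => clauseVal u i W (z k).1 (z k).2 :=
    (Measure.pi_map_pi fun _ => hcv.aemeasurable).symm
  have hL : Measurable fun L : Fin Es.card → ℝ => Real.tanh ((∑ k, L k) / 2) :=
    measurable_tanh.comp (by fun_prop)
  have hLe : Measurable ((fun L : Fin Es.card → ℝ => Real.tanh ((∑ k, L k) / 2)) ∘
      fun x : E → ℝ => x ∘ e) := hL.comp (by fun_prop)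
  rw [map_sumLaw, ← map_comp_pi _ hinj, h2, ← map_prod_pi_zip, h1,
    Measure.map_map (by fun_prop) (by fun_prop), Measure.map_map hcv' (by fun_prop),
    Measure.map_map (by fun_prop) (hcv'.comp (by fun_prop)),
    Measure.map_map (hLe.comp (hcv'.comp (by fun_prop))) (by fun_prop)]
  rw [cavityLaw]
  congr 1
  funext z
  simp only [cavityField, hsum]
  rfl

/-- The binomial theorem for convolution powers counts the clauses that contain `i`, and `(1 - p) ^
(n - q) ≥ (1 - p) ^ n` compares its weights with `binWeight`. -/
lemma outLaw_le_cavityLaw (p : unitInterval) {u : ℝ → ℝ} (hum : Measurable u) {i : V}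
    {W : Finset V} (hi : i ∉ W) (Es : Finset E) (μ : Measure ℝ) [IsProbabilityMeasure μ]
    {w w' : ℕ → ℝ≥0∞} (hw : ∀ q, w q ≤ binWeight p Es.card q)
    (hw' : ∀ q, w' q ≤ binWeight p W.card q) [IsFiniteMeasure (mixLaw u μ w')] :
    outLaw w (mixLaw u μ w') ≤ cavityLaw p u i W Es μ := by
  have hle : ℙ (unitInterval.symm p) • Measure.dirac 0 + ℙ p • mixLaw u μ w' ≤
      clauseValLaw p u i W μ := by
    refine le_trans ?_ (le_clauseValLaw p hum μ hi)
    gcongr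
    exact mixLaw_mono hw'
  rw [cavityLaw_eq p hum]
  refine le_trans ?_ (Measure.map_mono (sumLaw_mono hle Es.card) measurable_tanh_half)
  rw [sumLaw_smul_dirac_add]
  refine Measure.le_iff.2 fun S hS => ?_
  have hS' := measurable_tanh_half hS
  have hp1 : ℙ (unitInterval.symm p) ≤ 1 := by
    rw [← unitInterval.toNNReal_symm_add_toNNReal p]
    exact le_self_add
  rw [outLaw, Measure.sum_apply _ hS, Measure.map_apply measurable_tanh_half hS,
    Measure.finsetSum_apply, tsum_eq_sum (s := Finset.range (Es.card + 1))]
  · refine Finset.sum_le_sum fun q _ => ?_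
    rw [Measure.smul_apply, Measure.smul_apply, Measure.map_apply measurable_tanh_half hS,
      smul_eq_mul, ENNReal.smul_def, smul_eq_mul]
    gcongr
    refine (hw q).trans ?_
    rw [binWeight]
    push_cast
    refine mul_le_mul_right ?_ _
    exact_mod_cast pow_le_pow_of_le_one zero_le hp1 (Nat.sub_le _ _)
  · intro q hq
    have : w q = 0 := by
      refine le_antisymm ((hw q).trans ?_) (zero_le)
      rw [binWeight, Nat.choose_eq_zero_of_lt (by simpa using hq)]
      simp
    simp [this]

lemma outLaw_univ (w : ℕ → ℝ≥0∞) (κ : Measure ℝ) [IsFiniteMeasure κ] :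
    outLaw w κ Set.univ = ∑' q, w q * κ Set.univ ^ q := by
  rw [outLaw, Measure.sum_apply _ .univ]
  refine tsum_congr fun q => ?_
  rw [Measure.smul_apply, Measure.map_apply measurable_tanh_half .univ, Set.preimage_univ, sumLaw,
    Measure.map_apply (by fun_prop) .univ, Set.preimage_univ, Measure.pi_univ]
  simp

lemma one_sub_mul_le_exp_mul_pow {x t : ℝ} (hx0 : 0 ≤ x) (hx1 : x ≤ 1) (ht : 0 ≤ t) (n : ℕ) :
    1 - (n * (1 - x) + t) ≤ Real.exp (-t) * x ^ n := by
  have h1 := one_add_mul_le_pow (a := x - 1) (by linarith) n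
  rw [add_sub_cancel] at h1
  have h2 := Real.add_one_le_exp (-t)
  have h3 : x ^ n ≤ 1 := pow_le_one₀ hx0 hx1
  have h4 : 0 ≤ x ^ n := by positivity
  have h5 : 0 < Real.exp (-t) := Real.exp_pos _
  have h6 : Real.exp (-t) ≤ 1 := by simpa using ht
  nlinarith [mul_nonneg (sub_nonneg.2 h6) (sub_nonneg.2 h3)]

/-- The law of a cavity field is close to the fixed point. -/
theorem near_cavityLaw (p : unitInterval) {u : ℝ → ℝ} (hum : Measurable u) {U : ℝ}
    (hu : ∀ t, |u t| ≤ U) {α γ : ℝ} (hα : 0 ≤ α) (hγ : 0 ≤ γ) {μ : Measure ℝ}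
    (hμ : IsFixedLaw u α γ μ) {i : V} {W : Finset V} (hi : i ∉ W) {Es : Finset E}
    (hW : W.card * (p : ℝ) ≤ γ) (hE : Es.card * (p : ℝ) ≤ α * γ) :
    Near (cavityLaw p u i W Es μ) μ (2 * ENNReal.ofReal (Es.card *
      (p ^ 2 + p * (W.card * p ^ 2 + (γ - W.card * p))) + (α * γ - Es.card * p))) := by
  have := hμ.prob
  have := isProbabilityMeasure_cavityLaw p hum i W Es μ
  have h1 := one_sub_nonneg p
  have h2 := p.2.1
  set w := lowWeight p Es.card (α * γ)
  set w' := lowWeight p W.card γ with hw'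
  -- The mass of the common part of the mixtures for a single clause.
  set x := Real.exp (-(γ - W.card * p)) * ((1 - p) * (1 + p * 1)) ^ W.card with hx
  have hmass : mixLaw u μ w' Set.univ = ENNReal.ofReal x := by
    rw [mixLaw_univ hum, hx, ← tsum_lowWeight_mul_pow p _ _ zero_le_one]
    simp [hw']
  have hfin : IsFiniteMeasure (mixLaw u μ w') := ⟨by rw [hmass]; exact ENNReal.ofReal_lt_top⟩
  have hx0 : 0 ≤ x := by positivity
  have hb1 : (1 - (p : ℝ)) * (1 + p * 1) ≤ 1 := by nlinarith
  have hb0 : 0 ≤ (1 - (p : ℝ)) * (1 + p * 1) := by positivity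
  have hx1 : x ≤ 1 := mul_le_one₀ (Real.exp_le_one_iff.2 (by linarith)) (by positivity)
    (pow_le_one₀ hb0 hb1)
  have hx2 := one_sub_mul_le_exp_mul_pow (t := γ - W.card * p) hb0 hb1 (by linarith) W.card
  rw [← hx] at hx2
  have hc1 : (1 - (p : ℝ)) * (1 + p * x) ≤ 1 := by nlinarith
  have hc0 : 0 ≤ (1 - (p : ℝ)) * (1 + p * x) := by positivity
  refine near_of_common (ρ := outLaw w (mixLaw u μ w')) (supp_cavityLaw p hum i W Es μ) hμ.supp
    (outLaw_le_cavityLaw p hum hi Es μ (fun q => lowWeight_le_binWeight hE q)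
      fun q => lowWeight_le_binWeight hW q) ?_ ?_
  · conv_rhs => rw [← hμ.fixed]
    exact outLaw_le_opT hum hu hα hγ μ hμ.supp (fun q => lowWeight_le_poi hE q)
      fun q => lowWeight_le_poi hW q
  · rw [outLaw_univ, hmass, tsum_lowWeight_mul_pow p _ _ hx0, ← ENNReal.ofReal_add (by positivity)]
    · rw [← ENNReal.ofReal_one]
      refine ENNReal.ofReal_le_ofReal ?_
      have h5 := one_sub_mul_le_exp_mul_pow (t := α * γ - Es.card * p) hc0 hc1 (by linarith) Es.card
      -- The left side equals `p * (1 - x) + p ^ 2 * x`.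
      have h6 : 1 - (1 - (p : ℝ)) * (1 + p * x) ≤
          p ^ 2 + p * (W.card * p ^ 2 + (γ - W.card * p)) := by
        have : 1 - x ≤ W.card * p ^ 2 + (γ - W.card * p) := by nlinarith
        nlinarith [mul_nonneg h2 (sub_nonneg.2 hx1), mul_le_mul_of_nonneg_left this h2,
          mul_nonneg (mul_nonneg h2 h2) (sub_nonneg.2 hx1)]
      have h7 := mul_le_mul_of_nonneg_left h6 (Nat.cast_nonneg Es.card : (0 : ℝ) ≤ _)
      linarith
    · have : 0 ≤ α * γ - Es.card * p := by linarith
      have : 0 ≤ γ - W.card * p := by linarith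
      positivity

end CavityLaw

/-! ### Comparison with cavity fields for a fixed realization. -/

section Pointwise

variable {V E : Type*} [Fintype V] [Fintype E] [DecidableEq V] [DecidableEq E]

lemma clauseVal_congr {u : ℝ → ℝ} {i : V} {W : Finset V} {y y' : V → Bool × ℝ} (hi : y i = y' i)
    (h : ∀ v ∈ W, y v = y' v) (x : V → ℝ) : clauseVal u i W y x = clauseVal u i W y' x := by
  have hW : (W.filter fun v => (y v).1 = true) = W.filter fun v => (y' v).1 = true :=
    Finset.filter_congr fun v hv => by rw [h v hv]
  have hf : ∀ ε, clauseFactor u (W.filter fun v => (y' v).1 = true) (fun v => (y v).2) (y' i).2 ε =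
      clauseFactor u (W.filter fun v => (y' v).1 = true) (fun v => (y' v).2) (y' i).2 ε := by
    intro ε
    funext σ
    simp only [clauseFactor]
    rw [Finset.sum_congr rfl fun v hv => by rw [h v (Finset.mem_of_mem_filter v hv)]]
  simp only [clauseVal, clauseLog, hW, hi, hf]

lemma abs_clauseVal_sub_le {u : ℝ → ℝ} {U : ℝ} (hu : ∀ t, |u t| ≤ U) (i : V) (W : Finset V)
    (y : V → Bool × ℝ) {x x' : V → ℝ} (hx : ∀ v, |x v| ≤ 1) (hx' : ∀ v, |x' v| ≤ 1) :
    |clauseVal u i W y x - clauseVal u i W y x'| ≤ (Real.exp (2 * U) - 1) *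
      if (y i).1 then ∑ v ∈ W.filter (fun v => (y v).1 = true), |x v - x' v| else 0 := by
  simp only [clauseVal]
  split_ifs
  · exact abs_clauseLog_sub_le hu _ _ _ hx hx'
  · simp

lemma mem_slots {Q W : Finset V} {Es : Finset E} {b : V → E → Bool} {q : V × E} :
    q ∈ slots Q W Es b ↔ (q.1 ∈ W ∧ q.2 ∈ Es) ∧ (owner Q b q.2).isSome ∧ b q.1 q.2 = true := by
  rw [slots, Finset.mem_filter, Finset.mem_product]

/-- A choice of one slot for every site in `sites Q W Es b`. -/
def pick (Q W : Finset V) (Es : Finset E) (b : V → E → Bool) (s : V) : Option E :=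
  open Classical in
  if h : ∃ k, (s, k) ∈ slots Q W Es b then some h.choose else none

lemma mem_slots_of_pick {Q W : Finset V} {Es : Finset E} {b : V → E → Bool} {s : V} {k : E}
    (h : pick Q W Es b s = some k) : (s, k) ∈ slots Q W Es b := by
  unfold pick at h
  split_ifs at h with h'
  rw [← Option.some.inj h]
  exact h'.choose_spec

/-- Each site has exactly one picked slot, which carries `f`; the surplus slots all carry the
penalty `r`. -/
lemma sum_slots_pick (Q W : Finset V) (Es : Finset E) (b : V → E → Bool) (f : V → ℝ) (r : ℝ) :
    ∑ q ∈ slots Q W Es b, (if pick Q W Es b q.1 = some q.2 then f q.1 else r) =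
      ∑ s ∈ sites Q W Es b, f s + r * ((slots Q W Es b).card - (sites Q W Es b).card) := by
  set S := slots Q W Es b
  set C := S.filter (fun q => pick Q W Es b q.1 = some q.2)
  have hinj : Set.InjOn Prod.fst (C : Set (V × E)) := by
    intro q hq q' hq' h
    simp only [C, Finset.coe_filter, Set.mem_ofPred_eq] at hq hq'
    refine Prod.ext h (Option.some.inj ?_)
    rw [← hq.2, ← hq'.2, h]
  have himg : C.image Prod.fst = sites Q W Es b := by
    ext s
    simp only [sites, Finset.mem_image, C, Finset.mem_filter]
    constructor
    · rintro ⟨q, ⟨hq, -⟩, rfl⟩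
      exact ⟨q, hq, rfl⟩
    · rintro ⟨q, hq, rfl⟩
      have h : ∃ k, (q.1, k) ∈ slots Q W Es b := ⟨q.2, hq⟩
      have hp : pick Q W Es b q.1 = some h.choose := by rw [pick, dif_pos h]
      exact ⟨(q.1, h.choose), ⟨mem_slots_of_pick hp, hp⟩, rfl⟩
  have hcard : C.card = (sites Q W Es b).card := by
    rw [← himg, Finset.card_image_of_injOn hinj]
  have hcc : ((S.filter (fun q => ¬ pick Q W Es b q.1 = some q.2)).card : ℝ) =
      S.card - (sites Q W Es b).card := by
    rw [← hcard, ← Finset.card_filter_add_card_filter_not (s := S) (p := fun q =>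
      pick Q W Es b q.1 = some q.2)]
    push_cast
    ring
  rw [Finset.sum_ite, Finset.sum_const, nsmul_eq_mul, hcc, ← himg, Finset.sum_image hinj]
  ring

/-- The error made by replacing the magnetizations with independent cavity fields. -/
def errorTerm (U c : ℝ≥0) (Q W : Finset V) (Es : Finset E) (b : V → E → Bool) : ℝ≥0 :=
  -- The factor `2` bounds the distance of two points of `[-1, 1]`. It is paid at a spin that is not
  -- isolated and, multiplied by `c`, at each slot whose site has another picked slot.
  2 * (∑ i ∈ Q, if Isolated Q Es b i then 0 else 1) +
  c * (∑ i ∈ Q, ∑ k ∈ Es, if b i k then ∑ s ∈ nbhd W b k,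
      infl c b (perturbed U Q W b k s) Es.card (W \ (nbhd W b k).erase s) (Es.erase k) s else 0) +
  2 * c * ((slots Q W Es b).card - (sites Q W Es b).card)

/-- The array `d i` has to agree with `y` only on the row of `i` and on the clauses whose single
spin of `Q` is `i`. These regions are disjoint for different `i`, which is what allows the cavity
fields to be built from independent arrays. Likewise `z i` is prescribed only at picked slots, once
per site. -/
theorem sum_abs_sysMag_sub_cavityField_le {u : ℝ → ℝ} {U c : ℝ≥0} (hu : ∀ t, |u t| ≤ U)
    (hc : (c : ℝ) = (Real.exp (2 * U) - 1) / 2) {Vs Q : Finset V} {Es : Finset E} (hQ : Q ⊆ Vs)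
    (y : V × E → Bool × ℝ) (d : V → V × E → Bool × ℝ) (z : V → V × E → ℝ) (ζ : V → ℝ)
    (hd : ∀ i ∈ Q, ∀ k, y (i, k) = d i (i, k))
    (hd' : ∀ i k, owner Q (bools y) k = some i → ∀ v ∈ Vs \ Q, y (v, k) = d i (v, k))
    (hz : ∀ i q, |z i q| ≤ 1)
    (hζ : ∀ i s k, owner Q (bools y) k = some i → pick Q (Vs \ Q) Es (bools y) s = some k →
      z i (s, k) = ζ s) :
    ∑ i ∈ Q, |sysMag u Vs Es y i - cavityField u i (Vs \ Q) Es (d i) (z i)| ≤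
      errorTerm U c Q (Vs \ Q) Es (bools y) + c * ∑ s ∈ sites Q (Vs \ Q) Es (bools y),
        |sysMag u (Vs \ Q) (Es \ touched Q Es (bools y)) y s - ζ s| := by
  set W := Vs \ Q with hW
  set b := bools y with hb
  set X := sysMag u W (Es \ touched Q Es b) y with hX
  have hX1 : ∀ v, |X v| ≤ 1 := fun v => (abs_sysMag_lt_one u _ _ _ _).le
  -- The error at a slot: the coupling error of its site if the slot is picked, and the trivial
  -- bound `2` otherwise.
  set w : V × E → ℝ := fun q => if pick Q W Es b q.1 = some q.2 then |X q.1 - ζ q.1| else 2 with hw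
  have hw0 : ∀ q, 0 ≤ w q := fun q => by simp only [hw]; split_ifs <;> positivity
  set I : V → ℝ := fun i => ∑ k ∈ Es, if b i k then ∑ s ∈ nbhd W b k,
      (infl c b (perturbed U Q W b k s) Es.card (W \ (nbhd W b k).erase s) (Es.erase k) s : ℝ)
      else 0 with hI
  have hI0 : ∀ i, 0 ≤ I i := fun i => Finset.sum_nonneg fun k _ => by
    split_ifs
    · exact Finset.sum_nonneg fun s _ => NNReal.coe_nonneg _
    · exact le_rfl
  have hone : ∀ i ∈ Q, |sysMag u Vs Es y i - cavityField u i W Es (d i) (z i)| ≤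
      2 * (if Isolated Q Es b i then 0 else 1) + c * I i +
      c * ∑ q ∈ slots Q W Es b, if owner Q b q.2 = some i then w q else 0 := by
    intro i hi
    have hT0 : 0 ≤ c * ∑ q ∈ slots Q W Es b, if owner Q b q.2 = some i then w q else 0 :=
      mul_nonneg c.2 (Finset.sum_nonneg fun q _ => by split_ifs; exacts [hw0 q, le_rfl])
    by_cases hiso : Isolated Q Es b i
    · rw [if_pos hiso, mul_zero, zero_add]
      have hown : ∀ k ∈ Es, b i k = true → owner Q b k = some i := fun k hk hik =>
        owner_eq_some hi hik (hiso k hk hik)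
      have h1 := abs_sysMag_sub_tanh_le hu hc y hi hQ hiso
      refine (abs_sub_le _ _ _).trans (add_le_add h1 ?_)
      change |Real.tanh ((∑ k ∈ Es, clauseVal u i W (fun v => y (v, k)) X) / 2) -
        cavityField u i W Es (d i) (z i)| ≤ _
      refine (abs_tanh_sub_tanh_le _ _).trans ?_
      rw [← sub_div, ← Finset.sum_sub_distrib, abs_div, abs_two, hc, div_le_iff₀ two_pos, mul_assoc,
        mul_comm _ (2 : ℝ), ← mul_assoc, div_mul_cancel₀ _ (two_ne_zero' ℝ)]
      have h2 : ∀ k ∈ Es, |clauseVal u i W (fun v => y (v, k)) X -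
          clauseVal u i W (fun v => d i (v, k)) (fun v => z i (v, k))| ≤
          (Real.exp (2 * U) - 1) * if b i k then ∑ v ∈ nbhd W b k, w (v, k) else 0 := by
        intro k hk
        by_cases hik : b i k = true
        · rw [← clauseVal_congr (y := fun v => y (v, k)) (hd i hi k)
            fun v hv => hd' i k (hown k hk hik) v hv]
          refine (abs_clauseVal_sub_le hu i W _ hX1 fun v => hz i (v, k)).trans ?_
          have he : 0 ≤ Real.exp (2 * (U : ℝ)) - 1 := by
            have := c.2; rw [NNReal.val_eq_coe, hc] at this; linarith
          refine mul_le_mul_of_nonneg_left ?_ he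
          rw [if_pos hik]
          change (if b i k then ∑ v ∈ nbhd W b k, |X v - z i (v, k)| else 0) ≤ _
          rw [if_pos hik]
          refine Finset.sum_le_sum fun v hv => ?_
          simp only [hw]
          split_ifs with hp
          · rw [hζ i v k (hown k hk hik) hp]
          · refine (abs_sub _ _).trans ?_
            linarith [hX1 v, hz i (v, k)]
        · have hik' : (d i (i, k)).1 = false := by
            rw [← hd i hi k]; exact Bool.eq_false_iff.2 hik
          have hik'' : (y (i, k)).1 = false := Bool.eq_false_iff.2 hik
          simp [clauseVal, hik', hik'', hik]
      refine (Finset.abs_sum_le_sum_abs _ _).trans ((Finset.sum_le_sum h2).trans ?_)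
      rw [← Finset.mul_sum]
      have he : 0 ≤ Real.exp (2 * (U : ℝ)) - 1 := by
        have := c.2; rw [NNReal.val_eq_coe, hc] at this; linarith
      refine mul_le_mul_of_nonneg_left ?_ he
      rw [← Finset.sum_filter, ← Finset.sum_filter]
      have h3 : ∑ k ∈ Es.filter (fun k => b i k = true), ∑ v ∈ nbhd W b k, w (v, k) =
          ∑ q ∈ (W ×ˢ Es).filter (fun q => b i q.2 = true ∧ b q.1 q.2 = true), w q := by
        rw [Finset.sum_filter, Finset.sum_filter, Finset.sum_product_right]
        refine Finset.sum_congr rfl fun k _ => ?_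
        rw [nbhd, Finset.sum_filter]
        split_ifs with h <;> simp [h]
      rw [h3]
      refine Finset.sum_le_sum_of_subset_of_nonneg (fun q hq => ?_) fun q _ _ => hw0 q
      simp only [Finset.mem_filter, Finset.mem_product, mem_slots] at hq ⊢
      have := hown q.2 hq.1.2 hq.2.1
      exact ⟨⟨hq.1, by rw [this]; rfl, hq.2.2⟩, this⟩
    · rw [if_neg hiso]
      have h1 := (abs_sub (sysMag u Vs Es y i) (cavityField u i W Es (d i) (z i)))
      have h2 := (abs_sysMag_lt_one u Vs Es y i).le
      have h3 : |cavityField u i W Es (d i) (z i)| ≤ 1 := abs_tanh_le_one _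
      have h4 := mul_nonneg c.2 (hI0 i)
      rw [NNReal.val_eq_coe] at h4
      linarith
  -- A slot has only one owner, so it is charged to at most one spin of `Q`.
  have hsw : ∑ i ∈ Q, ∑ q ∈ slots Q W Es b, (if owner Q b q.2 = some i then w q else 0) ≤
      ∑ q ∈ slots Q W Es b, w q := by
    rw [Finset.sum_comm]
    refine Finset.sum_le_sum fun q _ => ?_
    rcases h : owner Q b q.2 with _ | j
    · simpa using hw0 q
    · simp only [Option.some.injEq]
      rw [Finset.sum_ite_eq]
      split_ifs
      exacts [le_rfl, hw0 q]
  rw [hw, sum_slots_pick Q W Es b (fun s => |X s - ζ s|) 2] at hsw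
  have hcard : (sites Q W Es b).card ≤ (slots Q W Es b).card := Finset.card_image_le
  have herr : (errorTerm U c Q W Es b : ℝ) =
      2 * (∑ i ∈ Q, if Isolated Q Es b i then 0 else 1) + c * ∑ i ∈ Q, I i +
      2 * c * ((slots Q W Es b).card - (sites Q W Es b).card) := by
    rw [errorTerm, NNReal.coe_add, NNReal.coe_add, NNReal.coe_mul, NNReal.coe_mul, NNReal.coe_mul,
      NNReal.coe_mul, NNReal.coe_sub (by exact_mod_cast hcard), NNReal.coe_sum, NNReal.coe_sum]
    congr 2
    · congr 2
      funext i
      split_ifs <;> rfl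
    · congr 1
      refine Finset.sum_congr rfl fun i _ => ?_
      rw [NNReal.coe_sum]
      refine Finset.sum_congr rfl fun k _ => ?_
      split_ifs
      · rw [NNReal.coe_sum]
      · rfl
  refine (Finset.sum_le_sum hone).trans ?_
  rw [Finset.sum_add_distrib, Finset.sum_add_distrib, ← Finset.mul_sum, ← Finset.mul_sum,
    ← Finset.mul_sum, herr]
  have := mul_le_mul_of_nonneg_left hsw c.2
  rw [NNReal.val_eq_coe] at this
  linarith

end Pointwise

/-! ### Assembling one random array from independent copies. -/

section Routing

variable {V J S T : Type*} [Fintype V] [Fintype J] [DecidableEq V] [MeasurableSpace S]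

/-- An array assembled from the copies `z.1 i` and `z.2`. -/
def route (src : J → Option V) (z : (V → J → S) × (J → S)) (j : J) : S :=
  (src j).elim (z.2 j) fun i => z.1 i j

lemma measurable_route (src : J → Option V) :
    Measurable (route src : (V → J → S) × (J → S) → J → S) := by
  refine measurable_pi_lambda _ fun j => ?_
  unfold route
  rcases src j with _ | i
  · simp only [Option.elim_none]; fun_prop
  · simp only [Option.elim_some]; fun_prop

lemma map_route (ν : Measure S) [IsProbabilityMeasure ν] (src : J → Option V) :
    ((Measure.pi fun _ : V => Measure.pi fun _ : J => ν).prod (Measure.pi fun _ : J => ν)).map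
      (route src) = Measure.pi fun _ : J => ν := by
  symm
  refine Measure.pi_eq fun s hs => ?_
  rw [Measure.map_apply (measurable_route src) (.univ_pi hs)]
  have hpre : route src ⁻¹' (Set.univ.pi s) = (Set.univ.pi fun i : V => Set.univ.pi fun j =>
      if src j = some i then s j else Set.univ) ×ˢ
      (Set.univ.pi fun j => if src j = none then s j else Set.univ) := by
    ext z
    simp only [Set.mem_preimage, Set.mem_pi, Set.mem_univ, true_imp_iff, Set.mem_prod, route]
    constructor
    · intro h
      refine ⟨fun i j => ?_, fun j => ?_⟩
      · split_ifs with hj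
        · simpa [hj] using h j
        · trivial
      · split_ifs with hj
        · simpa [hj] using h j
        · trivial
    · rintro ⟨h1, h2⟩ j
      rcases hj : src j with _ | i
      · simpa [hj] using h2 j
      · simpa [hj] using h1 i j
  rw [hpre, Measure.prod_prod, Measure.pi_pi, Measure.pi_pi]
  simp only [Measure.pi_pi]
  rw [Finset.prod_comm, ← Finset.prod_mul_distrib]
  refine Finset.prod_congr rfl fun j _ => ?_
  rcases hj : src j with _ | i
  · simp
  · rw [Finset.prod_eq_single i]
    · simp
    · intro i' _ hi'
      simp [hi'.symm]
    · simp

/-- Routing according to a pattern which is itself read off the routed array. -/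
lemma map_route_pattern [Fintype T] [MeasurableSpace T] [MeasurableSingletonClass T]
    (ν : Measure S) [IsProbabilityMeasure ν] (src : T → J → Option V) {pat : (J → S) → T}
    (hpat : Measurable pat) {pat' : (V → J → S) × (J → S) → T} (hpat' : Measurable pat')
    (h : ∀ t z, pat (route (src t) z) = pat' z) :
    Measurable (fun z => route (src (pat' z)) z) ∧
    ((Measure.pi fun _ : V => Measure.pi fun _ : J => ν).prod (Measure.pi fun _ : J => ν)).map
      (fun z => route (src (pat' z)) z) = Measure.pi fun _ : J => ν := by
  classical
  have hm : Measurable fun z : (V → J → S) × (J → S) => route (src (pat' z)) z := by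
    have : Measurable fun q : T × ((V → J → S) × (J → S)) => route (src q.1) q.2 :=
      measurable_from_prod_countable_right fun t => measurable_route (src t)
    exact this.comp (hpat'.prodMk measurable_id)
  refine ⟨hm, Measure.ext_of_lintegral _ fun F hF => ?_⟩
  rw [lintegral_map hF hm]
  have hind : ∀ t, Measurable fun y : J → S => if pat y = t then F y else 0 := fun t =>
    Measurable.ite (hpat (MeasurableSet.singleton t)) hF measurable_const
  -- Sum over the value `t` of the pattern. Because `pat (route (src t) z)` does not depend on the
  -- `t` used for routing, each term is an integral over a routing that is fixed in advance, to
  -- which `map_route` applies.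
  calc _ = ∫⁻ z, ∑ t, (if pat (route (src t) z) = t then F (route (src t) z) else 0)
        ∂((Measure.pi fun _ : V => Measure.pi fun _ : J => ν).prod (Measure.pi fun _ : J => ν)) := by
        refine lintegral_congr fun z => ?_
        simp only [h]
        rw [Finset.sum_ite_eq Finset.univ, if_pos (Finset.mem_univ _)]
    _ = ∑ t, ∫⁻ y, (if pat y = t then F y else 0) ∂(Measure.pi fun _ : J => ν) := by
        refine (lintegral_finsetSum Finset.univ (f := fun t z =>
          (fun y => if pat y = t then F y else 0) (route (src t) z))
          fun t _ => (hind t).comp (measurable_route _)).trans ?_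
        refine Finset.sum_congr rfl fun t _ => ?_
        conv_rhs => rw [← map_route ν (src t), lintegral_map (hind t) (measurable_route _)]
    _ = _ := by
        rw [← lintegral_finsetSum _ fun t _ => hind t]
        refine lintegral_congr fun y => ?_
        rw [Finset.sum_ite_eq Finset.univ, if_pos (Finset.mem_univ _)]

lemma sum_restrict_preimage [Fintype T] [MeasurableSpace T] [MeasurableSingletonClass T]
    (ν : Measure S) {f : S → T} (hf : Measurable f) :
    ∑ t, ν.restrict (f ⁻¹' {t}) = ν := by
  classical
  refine Measure.ext_of_lintegral _ fun F hF => ?_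
  rw [lintegral_finsetSum_measure]
  simp only [← lintegral_indicator (hf (MeasurableSet.singleton _))]
  rw [← lintegral_finsetSum _ fun t _ => hF.indicator (hf (MeasurableSet.singleton _))]
  refine lintegral_congr fun y => ?_
  simp only [Set.indicator_apply, Set.mem_preimage, Set.mem_singleton_iff]
  rw [Finset.sum_ite_eq Finset.univ, if_pos (Finset.mem_univ _)]

end Routing

/-! ### The decoupled array and the grafted cavity variables. -/

section Selection

variable {V E : Type*} [Fintype V] [Fintype E] [DecidableEq V] [DecidableEq E]

lemma owner_congr {Q : Finset V} {b b' : V → E → Bool} {k : E} (h : ∀ i ∈ Q, b i k = b' i k) :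
    owner Q b k = owner Q b' k := by
  refine Option.ext fun i => ⟨fun hi => ?_, fun hi => ?_⟩
  · obtain ⟨h1, h2, h3⟩ := owner_spec hi
    exact owner_eq_some h1 (by rw [← h i h1]; exact h2) fun j hj hjk => h3 j hj (by rwa [h j hj])
  · obtain ⟨h1, h2, h3⟩ := owner_spec hi
    exact owner_eq_some h1 (by rw [h i h1]; exact h2) fun j hj hjk => h3 j hj (by rwa [← h j hj])

/-- The routing is decided by the rows of `Q` alone. These rows are always taken from their own
copies, so the decision can be read both from the copies and from the assembled array. -/
def rowBits (Q : Finset V) (b : V → E → Bool) (v : V) (k : E) : Bool := decide (v ∈ Q) && b v k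

def selSrc (Q : Finset V) (b : V → E → Bool) (q : V × E) : Option V :=
  if q.1 ∈ Q then some q.1 else owner Q b q.2

def diagBits (d : V → V × E → Bool × ℝ) (v : V) (k : E) : Bool := (d v (v, k)).1

/-- The row of a spin `i ∈ Q` is taken from the copy `i`, and so are the clauses whose only
spin in `Q` is `i`; the rest is taken from `y₀`. -/
def sel (Q : Finset V) (z : (V → V × E → Bool × ℝ) × (V × E → Bool × ℝ)) : V × E → Bool × ℝ :=
  route (selSrc Q (rowBits Q (diagBits z.1))) z

lemma owner_rowBits (Q : Finset V) (b : V → E → Bool) (k : E) :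
    owner Q (rowBits Q b) k = owner Q b k :=
  owner_congr fun i hi => by simp [rowBits, hi]

lemma sel_of_mem {Q : Finset V} (z : (V → V × E → Bool × ℝ) × (V × E → Bool × ℝ)) {i : V}
    (hi : i ∈ Q) (k : E) : sel Q z (i, k) = z.1 i (i, k) := by
  simp [sel, route, selSrc, hi]

lemma sel_of_owner {Q : Finset V} (z : (V → V × E → Bool × ℝ) × (V × E → Bool × ℝ)) {v : V}
    (hv : v ∉ Q) {k : E} {i : V} (h : owner Q (diagBits z.1) k = some i) :
    sel Q z (v, k) = z.1 i (v, k) := by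
  simp [sel, route, selSrc, hv, owner_rowBits, h]

lemma sel_of_owner_none {Q : Finset V} (z : (V → V × E → Bool × ℝ) × (V × E → Bool × ℝ)) {v : V}
    (hv : v ∉ Q) {k : E} (h : owner Q (diagBits z.1) k = none) :
    sel Q z (v, k) = z.2 (v, k) := by
  simp [sel, route, selSrc, hv, owner_rowBits, h]

/-- Every entry is taken from exactly one independent copy, and the choice does not look at entries
outside the rows of `Q`; the assembled array thus has the law of the disorder. -/
lemma sel_map (p : unitInterval) (Q : Finset V) : Measurable (sel (E := E) Q) ∧
    ((Measure.pi fun _ : V => arrayLaw V E p).prod (arrayLaw V E p)).map (sel Q) =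
      arrayLaw V E p := by
  refine map_route_pattern (T := V → E → Bool) (siteLaw p) (selSrc Q)
    (pat := fun y => rowBits Q (bools y)) (measurable_comp_bools _)
    (pat' := fun z => rowBits Q (diagBits z.1)) ?_ ?_
  · refine measurable_pi_lambda _ fun v => measurable_pi_lambda _ fun k => ?_
    unfold rowBits diagBits
    have : Measurable fun z : (V → V × E → Bool × ℝ) × (V × E → Bool × ℝ) => (z.1 v (v, k)).1 := by
      fun_prop
    exact (measurable_of_countable (fun e : Bool => decide (v ∈ Q) && e)).comp this
  · intro t z
    funext v k
    by_cases hv : v ∈ Q <;> simp [rowBits, bools, diagBits, route, selSrc, hv]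

lemma owner_sel (Q : Finset V) (z : (V → V × E → Bool × ℝ) × (V × E → Bool × ℝ)) (k : E) :
    owner Q (bools (sel Q z)) k = owner Q (diagBits z.1) k :=
  owner_congr fun i hi => by rw [bools, sel_of_mem z hi]; rfl

/-- The part of the bits of `sel Q z` that is determined by the copies `z.1`. -/
def selBits (Q : Finset V) (t : V → V → E → Bool) (v : V) (k : E) : Bool :=
  if v ∈ Q then t v v k else (owner Q (fun v k => t v v k) k).elim false fun i => t i v k

lemma owner_selBits (Q : Finset V) (z : (V → V × E → Bool × ℝ) × (V × E → Bool × ℝ)) (k : E) :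
    owner Q (selBits Q fun i => bools (z.1 i)) k = owner Q (diagBits z.1) k :=
  owner_congr fun i hi => by simp [selBits, hi, bools, diagBits]

/-- The slots are determined by the copies `z.1` alone. Once the bits of the copies are fixed, the
sites are fixed too, and the fresh array `z.2` remains independent of them. -/
lemma slots_selBits {Q W : Finset V} (hQW : Disjoint Q W) (Es : Finset E)
    (z : (V → V × E → Bool × ℝ) × (V × E → Bool × ℝ)) :
    slots Q W Es (selBits Q fun i => bools (z.1 i)) = slots Q W Es (bools (sel Q z)) := by
  ext ⟨v, k⟩
  simp only [mem_slots, owner_selBits, owner_sel]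
  refine and_congr_right fun hvk => and_congr_right fun ho => ?_
  obtain ⟨i, hi⟩ := Option.isSome_iff_exists.1 ho
  have hv : v ∉ Q := Finset.disjoint_right.1 hQW hvk.1
  rw [bools, sel_of_owner z hv hi, selBits, if_neg hv]
  have : owner Q (fun v k => bools (z.1 v) v k) k = some i := hi
  rw [this]
  rfl

lemma touched_selBits {Q : Finset V} (Es : Finset E)
    (z : (V → V × E → Bool × ℝ) × (V × E → Bool × ℝ)) :
    touched Q Es (selBits Q fun i => bools (z.1 i)) = touched Q Es (bools (sel Q z)) := by
  refine Finset.filter_congr fun k _ => ?_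
  refine exists_congr fun i => and_congr_right fun hi => ?_
  rw [bools, sel_of_mem z hi, selBits, if_pos hi, bools]

lemma measurable_sysMag {u : ℝ → ℝ} (hum : Measurable u) (Vs : Finset V) (Es : Finset E) (v : V) :
    Measurable fun y : V × E → Bool × ℝ => sysMag u Vs Es y v := by
  have hf : ∀ k (σ : V → Bool), Measurable fun y : V × E → Bool × ℝ => factor u Vs y k σ := by
    intro k σ
    unfold factor
    simp only [Finset.sum_filter]
    refine Real.measurable_exp.comp (hum.comp (Finset.measurable_fun_sum _ fun v _ => ?_))
    refine Measurable.ite ?_ (by fun_prop) measurable_const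
    exact (by fun_prop : Measurable fun y : V × E → Bool × ℝ => (y (v, k)).1)
      (MeasurableSet.singleton true)
  unfold sysMag mag avg prodWeight
  fun_prop

lemma sysMag_congr {u : ℝ → ℝ} {Vs : Finset V} {Es : Finset E} {y y' : V × E → Bool × ℝ}
    (h : ∀ v ∈ Vs, ∀ k ∈ Es, y (v, k) = y' (v, k)) : sysMag u Vs Es y = sysMag u Vs Es y' := by
  have : prodWeight Es (factor u Vs y) = prodWeight Es (factor u Vs y') := by
    funext σ
    refine Finset.prod_congr rfl fun k hk => ?_
    rw [factor, factor, Finset.sum_filter, Finset.sum_filter,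
      Finset.sum_congr rfl fun v hv => by rw [h v hv k hk]]
  funext v
  rw [sysMag, sysMag, this]

/-- Independent variables `z₀`, with the values `ζ` at one slot of each site. -/
def graft (Q W : Finset V) (Es : Finset E) (b : V → E → Bool) (ζ : V → ℝ)
    (z₀ : V × (V × E) → ℝ) (i : V) (q : V × E) : ℝ :=
  if owner Q b q.2 = some i ∧ pick Q W Es b q.1 = some q.2 then ζ q.1 else z₀ (i, q)

lemma measurable_graft (Q W : Finset V) (Es : Finset E) (b : V → E → Bool) :
    Measurable fun z : (V × (V × E) → ℝ) × (V → ℝ) => graft Q W Es b z.2 z.1 := by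
  refine measurable_pi_lambda _ fun i => measurable_pi_lambda _ fun q => ?_
  unfold graft
  split_ifs <;> fun_prop

/-- A value `ζ s` is inserted in at most one place: `pick` selects one clause for the site and the
clause has one owner. Hence the entries of the result are distinct coordinates of one independent
family. -/
lemma map_graft (μ : Measure ℝ) [IsProbabilityMeasure μ] (Q W : Finset V) (Es : Finset E)
    (b : V → E → Bool) :
    ((Measure.pi fun _ : V × (V × E) => μ).prod (Measure.pi fun _ : V => μ)).map
      (fun z => graft Q W Es b z.2 z.1) = Measure.pi fun _ : V => Measure.pi fun _ : V × E => μ := by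
  set e : ((_ : V) × (V × E)) → (V × (V × E)) ⊕ V := fun s =>
    if owner Q b s.2.2 = some s.1 ∧ pick Q W Es b s.2.1 = some s.2.2 then Sum.inr s.2.1
    else Sum.inl (s.1, s.2) with he
  have hinj : Function.Injective e := by
    rintro ⟨i, v, k⟩ ⟨i', v', k'⟩ h
    simp only [he] at h
    split_ifs at h with h1 h2 h2
    · obtain rfl : v = v' := Sum.inr.inj h
      obtain rfl : k = k' := Option.some.inj (h1.2.symm.trans h2.2)
      obtain rfl : i = i' := Option.some.inj (h1.1.symm.trans h2.1)
      rfl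
    · have := Sum.inl.inj h
      simp only [Prod.mk.injEq] at this
      obtain ⟨rfl, rfl, rfl⟩ := this
      rfl
  have h1 := (measurePreserving_sumPiEquivProdPi fun _ : (V × (V × E)) ⊕ V => μ).map_eq
  rw [← map_sigma_pi, ← map_comp_pi μ hinj, ← h1, Measure.map_map (measurable_graft Q W Es b)
    (MeasurableEquiv.measurable _), Measure.map_map (by fun_prop) (by fun_prop)]
  congr 1
  funext x i q
  simp only [Function.comp_apply, graft, he]
  split_ifs <;> rfl

end Selection

/-! ### From the reduced system to independent cavity fields. -/

section InductionStep

variable {V E : Type*} [Fintype V] [Fintype E] [DecidableEq V] [DecidableEq E]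

lemma slots_congr_sites {Q W : Finset V} {Es : Finset E} {b b' : V → E → Bool}
    (h : slots Q W Es b = slots Q W Es b') : sites Q W Es b = sites Q W Es b' ∧
      pick Q W Es b = pick Q W Es b' := by
  refine ⟨by rw [sites, sites, h], ?_⟩
  funext s
  simp only [pick, h]

lemma map_cavityField {p : unitInterval} {u : ℝ → ℝ} (hum : Measurable u) (W : Finset V)
    (Es : Finset E) (μ : Measure ℝ) [IsProbabilityMeasure μ] :
    Measurable (fun (z : (V → V × E → Bool × ℝ) × (V → V × E → ℝ)) (i : V) =>
      cavityField u i W Es (z.1 i) (z.2 i)) ∧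
    ((Measure.pi fun _ : V => arrayLaw V E p).prod (Measure.pi fun _ : V =>
      Measure.pi fun _ : V × E => μ)).map (fun z i => cavityField u i W Es (z.1 i) (z.2 i)) =
    Measure.pi fun i => cavityLaw p u i W Es μ := by
  have := fun i => isProbabilityMeasure_cavityLaw p hum i W Es μ
  have hm : Measurable fun (w : V → (V × E → Bool × ℝ) × (V × E → ℝ)) i =>
      cavityField u i W Es (w i).1 (w i).2 :=
    measurable_pi_lambda _ fun i => (measurable_cavityField hum i W Es).comp (measurable_pi_apply i)
  have h1 : (Measure.pi fun i => cavityLaw p u i W Es μ) =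
      (Measure.pi fun _ : V => (arrayLaw V E p).prod (Measure.pi fun _ : V × E => μ)).map
        fun w i => cavityField u i W Es (w i).1 (w i).2 :=
    (Measure.pi_map_pi fun i => (measurable_cavityField hum i W Es).aemeasurable).symm
  refine ⟨hm.comp (f := fun (z : (V → V × E → Bool × ℝ) × (V → V × E → ℝ)) (i : V) =>
    (z.1 i, z.2 i)) (by fun_prop), ?_⟩
  rw [h1, ← map_prod_pi_zip, Measure.map_map hm (by fun_prop)]
  rfl

/-- The comparison with the cavity fields, in terms of the copies `d`, `y₀`. -/
lemma sum_abs_sysMag_sel_sub_le {u : ℝ → ℝ} {U c : ℝ≥0} (hu : ∀ t, |u t| ≤ U)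
    (hc : (c : ℝ) = (Real.exp (2 * U) - 1) / 2) {Vs Q : Finset V} (hQ : Q ⊆ Vs) (Es : Finset E)
    (z : (V → V × E → Bool × ℝ) × (V × E → Bool × ℝ)) {z₀ : V × (V × E) → ℝ} {ζ : V → ℝ}
    (hz₀ : ∀ q, |z₀ q| ≤ 1) (hζ : ∀ v, |ζ v| ≤ 1) {b : V → E → Bool}
    (hb : b = selBits Q fun i => bools (z.1 i)) :
    ∑ i ∈ Q, ENNReal.ofReal |sysMag u Vs Es (sel Q z) i -
      cavityField u i (Vs \ Q) Es (z.1 i) (graft Q (Vs \ Q) Es b ζ z₀ i)| ≤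
      (errorTerm U c Q (Vs \ Q) Es (bools (sel Q z)) : ℝ≥0∞) +
      c * ∑ s ∈ sites Q (Vs \ Q) Es b,
        ENNReal.ofReal |sysMag u (Vs \ Q) (Es \ touched Q Es b) z.2 s - ζ s| := by
  have hQW : Disjoint Q (Vs \ Q) := Finset.disjoint_sdiff
  subst hb
  have hsl := slots_selBits hQW Es z
  have hto := touched_selBits (Q := Q) Es z
  have how : ∀ k, owner Q (selBits Q fun i => bools (z.1 i)) k = owner Q (bools (sel Q z)) k :=
    fun k => (owner_selBits Q z k).trans (owner_sel Q z k).symm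
  have hsp := slots_congr_sites hsl
  -- A clause that is not touched has no owner, so outside `Q` it is taken from the fresh array: the
  -- reduced system involves only `z.2`.
  have hXX : sysMag u (Vs \ Q) (Es \ touched Q Es (bools (sel Q z))) (sel Q z) =
      sysMag u (Vs \ Q) (Es \ touched Q Es (bools (sel Q z))) z.2 := by
    refine sysMag_congr fun v hv k hk => ?_
    refine sel_of_owner_none z (Finset.disjoint_right.1 hQW hv) ?_
    rw [← owner_sel]
    refine Option.eq_none_iff_forall_not_mem.2 fun i hi => ?_
    obtain ⟨hiQ, hik, -⟩ := owner_spec hi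
    obtain ⟨hkE, hkt⟩ := Finset.mem_sdiff.1 hk
    exact hkt (Finset.mem_filter.2 ⟨hkE, i, hiQ, hik⟩)
  have hmain := sum_abs_sysMag_sub_cavityField_le hu hc hQ (Es := Es) (sel Q z) z.1
    (graft Q (Vs \ Q) Es (selBits Q fun i => bools (z.1 i)) ζ z₀) ζ
    (fun i hi k => sel_of_mem z hi k)
    (fun i k hik v hv => sel_of_owner z (Finset.disjoint_right.1 hQW hv)
      ((owner_sel Q z k).symm.trans hik))
    (fun i q => by
      unfold graft
      split_ifs
      exacts [hζ _, hz₀ _])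
    (fun i s k hik hp => by
      unfold graft
      rw [if_pos ⟨(how k).trans hik, by rw [hsp.2]; exact hp⟩])
  rw [hXX, ← hsp.1, ← hto] at hmain
  rw [← ENNReal.ofReal_sum_of_nonneg fun i _ => abs_nonneg _]
  refine (ENNReal.ofReal_le_ofReal hmain).trans_eq ?_
  rw [ENNReal.ofReal_add (NNReal.coe_nonneg _) (mul_nonneg c.coe_nonneg
    (Finset.sum_nonneg fun s _ => abs_nonneg _)), ENNReal.ofReal_coe_nnreal,
    ENNReal.ofReal_mul c.coe_nonneg, ENNReal.ofReal_coe_nnreal,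
    ENNReal.ofReal_sum_of_nonneg fun s _ => abs_nonneg _]

section Mixture

variable {A C C' T : Type*} [MeasurableSpace A] [MeasurableSpace C] [MeasurableSpace C'] [Fintype T]
  [MeasurableSpace T] [MeasurableSingletonClass T] (P : Measure A) [IsProbabilityMeasure P]
  {f : A → T}

lemma map_restrict_prod (t : T) (N : Measure C) [IsProbabilityMeasure N] {g : C → C'}
    (hg : Measurable g) : ((P.restrict (f ⁻¹' {t})).prod N).map (fun w => (w.1, g w.2)) =
      (P.restrict (f ⁻¹' {t})).prod (N.map g) := by
  have := Measure.map_prod_map (P.restrict (f ⁻¹' {t})) N measurable_id hg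
  rw [Measure.map_id] at this
  exact this.symm

lemma sum_restrict_prod (hf : Measurable f) (N : Measure C) [IsProbabilityMeasure N] :
    Measure.sum (fun t => (P.restrict (f ⁻¹' {t})).prod N) = P.prod N := by
  rw [← Measure.prod_sum_left, Measure.sum_fintype, sum_restrict_preimage P hf]

lemma sum_map_restrict_prod (hf : Measurable f) (N : T → Measure C)
    [∀ t, IsProbabilityMeasure (N t)] {g : T → C → C'} (hg : ∀ t, Measurable (g t))
    {ν : Measure C'} [IsProbabilityMeasure ν] (h : ∀ t, (N t).map (g t) = ν) {X : Type*}
    [MeasurableSpace X] {F : A × C' → X} (hF : Measurable F) :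
    Measure.sum (fun t => ((P.restrict (f ⁻¹' {t})).prod (N t)).map fun w => F (w.1, g t w.2)) =
      (P.prod ν).map F := by
  rw [← sum_restrict_prod P hf ν, Measure.map_sum hF.aemeasurable]
  congr 1
  funext t
  have hm : Measurable fun w : A × C => (w.1, g t w.2) :=
    measurable_fst.prodMk ((hg t).comp measurable_snd)
  rw [← h t, ← map_restrict_prod P t (N t) (hg t), Measure.map_map hF hm]
  rfl

lemma ae_restrict_prod (hf : Measurable f) (t : T) (N : Measure C) [IsProbabilityMeasure N]
    {q : C → Prop} (hq : ∀ᵐ x ∂N, q x) :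
    ∀ᵐ w ∂(P.restrict (f ⁻¹' {t})).prod N, f w.1 = t ∧ q w.2 :=
  ((Measure.quasiMeasurePreserving_fst (μ := P.restrict (f ⁻¹' {t})) (ν := N)).ae
    (ae_restrict_mem (hf (MeasurableSet.singleton t)))).and
    ((Measure.quasiMeasurePreserving_snd (μ := P.restrict (f ⁻¹' {t})) (ν := N)).ae hq)

/-- On each event `f = t` a different law `N t` drives the second component. The images `ν₁` and
`ν₂` do not depend on `t`, so summing the pieces gives a coupling with the desired marginals. -/
lemma hasCoupling_mixture (hf : Measurable f) (N : T → Measure C) [∀ t, IsProbabilityMeasure (N t)]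
    {C₁ C₂ Z ι : Type*} [MeasurableSpace C₁] [MeasurableSpace C₂] [MeasurableSpace Z]
    {ν₁ : Measure C₁} [IsProbabilityMeasure ν₁] {ν₂ : Measure C₂} [IsProbabilityMeasure ν₂]
    {φ : A × C₁ → Z} (hφ : Measurable φ) {g₁ : C → C₁} (hg₁ : Measurable g₁)
    (h₁ : ∀ t, (N t).map g₁ = ν₁) {ψ : A × C₂ → ι → ℝ} (hψ : Measurable ψ) {g₂ : T → C → C₂}
    (hg₂ : ∀ t, Measurable (g₂ t)) (h₂ : ∀ t, (N t).map (g₂ t) = ν₂) {X : Z → ι → ℝ}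
    (hX : ∀ i, Measurable fun z => X z i) {Q : Finset ι} {G : Z → ℝ≥0∞} (hG : Measurable G)
    (hcost : ∀ t, ∫⁻ w, ∑ i ∈ Q, ENNReal.ofReal |X (φ (w.1, g₁ w.2)) i - ψ (w.1, g₂ t w.2) i|
      ∂((P.restrict (f ⁻¹' {t})).prod (N t)) ≤
      ∫⁻ z, G (φ z) ∂((P.restrict (f ⁻¹' {t})).prod ν₁)) :
    HasCoupling ((P.prod ν₁).map φ) X ((P.prod ν₂).map ψ) Q (∫⁻ z, G z ∂(P.prod ν₁).map φ) := by
  have hY : Measurable fun w : A × C => φ (w.1, g₁ w.2) :=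
    hφ.comp (measurable_fst.prodMk (hg₁.comp measurable_snd))
  have hR : ∀ t, Measurable fun w : A × C => ψ (w.1, g₂ t w.2) := fun t =>
    hψ.comp (measurable_fst.prodMk ((hg₂ t).comp measurable_snd))
  refine ⟨Measure.sum fun t => ((P.restrict (f ⁻¹' {t})).prod (N t)).map fun w =>
    (φ (w.1, g₁ w.2), ψ (w.1, g₂ t w.2)), ?_, ?_, ?_⟩
  · rw [Measure.map_sum measurable_fst.aemeasurable,
      ← sum_map_restrict_prod P hf N (fun _ => hg₁) h₁ hφ]
    congr 1
    funext t
    rw [Measure.map_map measurable_fst (hY.prodMk (hR t))]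
    rfl
  · rw [Measure.map_sum measurable_snd.aemeasurable,
      ← sum_map_restrict_prod P hf N hg₂ h₂ hψ]
    congr 1
    funext t
    rw [Measure.map_map measurable_snd (hY.prodMk (hR t))]
    rfl
  · have hm : Measurable fun q : Z × (ι → ℝ) => ∑ i ∈ Q, ENNReal.ofReal |X q.1 i - q.2 i| :=
      Finset.measurable_fun_sum _ fun i _ => measurable_ofReal_abs_sub
        ((hX i).comp measurable_fst) ((measurable_pi_apply i).comp measurable_snd)
    rw [lintegral_sum_measure]
    have hbound := fun t => (lintegral_map hm (hY.prodMk (hR t))).trans_le (hcost t)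
    refine (ENNReal.tsum_le_tsum hbound).trans_eq ?_
    rw [← lintegral_sum_measure, sum_restrict_prod _ hf, lintegral_map hG hφ]

end Mixture

/-- The copies of the array. -/
abbrev copiesLaw (V E : Type*) [Fintype V] [Fintype E] (p : unitInterval) :
    Measure (V → V × E → Bool × ℝ) := Measure.pi fun _ : V => arrayLaw V E p

/-- The bits of the copies. -/
def copyBits (d : V → V × E → Bool × ℝ) (i : V) : V → E → Bool := bools (d i)

lemma measurable_copyBits : Measurable (copyBits : (V → V × E → Bool × ℝ) → V → V → E → Bool) :=
  measurable_pi_lambda _ fun i => measurable_bools.comp (measurable_pi_apply i)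

/-- On the event that the copies have bits `t`, the sites and the reduced set of clauses are
constants, and the coupling `π` of that deterministic subsystem is used with the fresh array as its
first component. -/
lemma lintegral_sysMag_sel_sub_le (p : unitInterval) {u : ℝ → ℝ} (hum : Measurable u) {U c : ℝ≥0}
    (hu : ∀ t, |u t| ≤ U) (hc : (c : ℝ) = (Real.exp (2 * U) - 1) / 2) (μ : Measure ℝ)
    [IsProbabilityMeasure μ] (hμ : Supp μ) {Vs Q : Finset V} (hQ : Q ⊆ Vs) (Es : Finset E)
    (D : Finset V → Finset E → ℝ≥0) (t : V → V → E → Bool)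
    (π : Measure ((V × E → Bool × ℝ) × (V → ℝ))) (hπ1 : π.map Prod.fst = arrayLaw V E p)
    (hπ2 : π.map Prod.snd = Measure.pi fun _ => μ)
    (hπ3 : ∫⁻ q, ∑ s ∈ sites Q (Vs \ Q) Es (selBits Q t), ENNReal.ofReal
      |sysMag u (Vs \ Q) (Es \ touched Q Es (selBits Q t)) q.1 s - q.2 s| ∂π ≤
      D (sites Q (Vs \ Q) Es (selBits Q t)) (Es \ touched Q Es (selBits Q t))) :
    ∫⁻ w, ∑ i ∈ Q, ENNReal.ofReal |sysMag u Vs Es (sel Q (w.1, w.2.2.1)) i -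
      cavityField u i (Vs \ Q) Es (w.1 i) (graft Q (Vs \ Q) Es (selBits Q t) w.2.2.2 w.2.1 i)|
      ∂(((copiesLaw V E p).restrict (copyBits ⁻¹' {t})).prod
        ((Measure.pi fun _ : V × (V × E) => μ).prod π)) ≤
    ∫⁻ z, ((errorTerm U c Q (Vs \ Q) Es (bools (sel Q z)) + c * D (sites Q (Vs \ Q) Es
      (bools (sel Q z))) (Es \ touched Q Es (bools (sel Q z))) : ℝ≥0) : ℝ≥0∞)
      ∂(((copiesLaw V E p).restrict (copyBits ⁻¹' {t})).prod (arrayLaw V E p)) := by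
  have hQW : Disjoint Q (Vs \ Q) := Finset.disjoint_sdiff
  have : IsProbabilityMeasure π := isProbabilityMeasure_of_map measurable_fst hπ1
  set P₀ := Measure.pi fun _ : V × (V × E) => μ
  set X : (V × E → Bool × ℝ) × (V → ℝ) → ℝ≥0∞ := fun q =>
    ∑ s ∈ sites Q (Vs \ Q) Es (selBits Q t), ENNReal.ofReal
      |sysMag u (Vs \ Q) (Es \ touched Q Es (selBits Q t)) q.1 s - q.2 s| with hX
  have hXm : Measurable X := Finset.measurable_fun_sum _ fun i _ =>
    measurable_ofReal_abs_sub ((measurable_sysMag hum _ _ i).comp measurable_fst) (by fun_prop)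
  have hz0 : ∀ᵐ w ∂P₀.prod π, (∀ q, |w.1 q| ≤ 1) ∧ ∀ v, |w.2.2 v| ≤ 1 := by
    refine ((Measure.quasiMeasurePreserving_fst (μ := P₀) (ν := π)).ae
        ((ae_pi_mem (ι := V × (V × E)) μ hμ).mono fun x hx q => abs_le.2 (hx q))).and
      ((Measure.quasiMeasurePreserving_snd (μ := P₀) (ν := π)).ae
        (ae_of_ae_map (f := Prod.snd) (p := fun x : V → ℝ => ∀ v, |x v| ≤ 1)
          measurable_snd.aemeasurable ?_))
    rw [hπ2]
    exact (ae_pi_mem (ι := V) μ hμ).mono fun x hx q => abs_le.2 (hx q)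
  have hpt := ae_restrict_prod (copiesLaw V E p) measurable_copyBits t (P₀.prod π) hz0
  have hGm : ∀ F : (V → E → Bool) → ℝ≥0, Measurable fun z : (V → V × E → Bool × ℝ) ×
      (V × E → Bool × ℝ) => (F (bools (sel Q z)) : ℝ≥0∞) := fun F =>
    ((measurable_comp_bools F).comp (sel_map p Q).1).coe_nnreal_ennreal
  have hproj : Measurable fun w : (V → V × E → Bool × ℝ) × ((V × (V × E) → ℝ) ×
      ((V × E → Bool × ℝ) × (V → ℝ))) => (w.1, w.2.2.1) := by fun_prop
  have hXm' : Measurable fun w : (V → V × E → Bool × ℝ) × ((V × (V × E) → ℝ) ×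
      ((V × E → Bool × ℝ) × (V → ℝ))) => X w.2.2 := hXm.comp (by fun_prop)
  have hE : Measurable fun w : (V → V × E → Bool × ℝ) × ((V × (V × E) → ℝ) ×
      ((V × E → Bool × ℝ) × (V → ℝ))) =>
      (errorTerm U c Q (Vs \ Q) Es (bools (sel Q (w.1, w.2.2.1))) : ℝ≥0∞) :=
    (hGm (errorTerm U c Q (Vs \ Q) Es)).comp hproj
  have hpw : ∀ᵐ w ∂(((copiesLaw V E p).restrict (copyBits ⁻¹' {t})).prod (P₀.prod π)),
      ∑ i ∈ Q, ENNReal.ofReal |sysMag u Vs Es (sel Q (w.1, w.2.2.1)) i -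
        cavityField u i (Vs \ Q) Es (w.1 i) (graft Q (Vs \ Q) Es (selBits Q t) w.2.2.2 w.2.1 i)|
      ≤ (errorTerm U c Q (Vs \ Q) Es (bools (sel Q (w.1, w.2.2.1))) : ℝ≥0∞) + c * X w.2.2 := by
    filter_upwards [hpt] with w hw
    have hb : selBits Q t = selBits Q fun i => bools (w.1 i) := congrArg (selBits Q) hw.1.symm
    exact sum_abs_sysMag_sel_sub_le hu hc hQ Es (w.1, w.2.2.1) hw.2.1 hw.2.2 hb
  refine (lintegral_mono_ae hpw).trans ?_
  rw [lintegral_add_left hE]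
  have e1 : ∫⁻ w, (errorTerm U c Q (Vs \ Q) Es (bools (sel Q (w.1, w.2.2.1))) : ℝ≥0∞)
      ∂(((copiesLaw V E p).restrict (copyBits ⁻¹' {t})).prod (P₀.prod π)) =
      ∫⁻ z, (errorTerm U c Q (Vs \ Q) Es (bools (sel Q z)) : ℝ≥0∞)
      ∂(((copiesLaw V E p).restrict (copyBits ⁻¹' {t})).prod (arrayLaw V E p)) := by
    have h := map_restrict_prod (copiesLaw V E p) (f := copyBits) t (P₀.prod π)
      (g := fun w => w.2.1) (by fun_prop)
    have e : (P₀.prod π).map (fun w => w.2.1) = arrayLaw V E p := by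
      change (P₀.prod π).map (Prod.fst ∘ Prod.snd) = _
      rw [← Measure.map_map measurable_fst measurable_snd, Measure.map_snd_prod, measure_univ,
        one_smul, hπ1]
    rw [← e, ← h, lintegral_map (hGm _) hproj]
  -- Both sides factor through the mass of the event, times the cost of `π` on the left and a
  -- constant on the right.
  have e2 : ∫⁻ w, X w.2.2 ∂(((copiesLaw V E p).restrict (copyBits ⁻¹' {t})).prod (P₀.prod π)) ≤
      ∫⁻ z, (D (sites Q (Vs \ Q) Es (bools (sel Q z)))
        (Es \ touched Q Es (bools (sel Q z))) : ℝ≥0∞)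
        ∂(((copiesLaw V E p).restrict (copyBits ⁻¹' {t})).prod (arrayLaw V E p)) := by
    have hl : ∫⁻ w, X w.2.2 ∂(((copiesLaw V E p).restrict (copyBits ⁻¹' {t})).prod
        (P₀.prod π)) = (∫⁻ q, X q ∂π) * (copiesLaw V E p).restrict (copyBits ⁻¹' {t}) Set.univ := by
      have h0 : ∫⁻ w, X w.2 ∂P₀.prod π = ∫⁻ q, X q ∂π := by
        have hX2 : Measurable fun w : (V × (V × E) → ℝ) × ((V × E → Bool × ℝ) × (V → ℝ)) =>
          X w.2 := hXm.comp measurable_snd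
        rw [lintegral_prod _ hX2.aemeasurable]
        simp only [lintegral_const, measure_univ, mul_one]
      rw [lintegral_prod _ hXm'.aemeasurable]
      simp only [h0, lintegral_const]
    have hr : ∫⁻ z, (D (sites Q (Vs \ Q) Es (bools (sel Q z)))
        (Es \ touched Q Es (bools (sel Q z))) : ℝ≥0∞)
        ∂(((copiesLaw V E p).restrict (copyBits ⁻¹' {t})).prod (arrayLaw V E p)) =
        D (sites Q (Vs \ Q) Es (selBits Q t)) (Es \ touched Q Es (selBits Q t)) *
          (copiesLaw V E p).restrict (copyBits ⁻¹' {t}) Set.univ := by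
      have hae : ∀ᵐ z ∂(((copiesLaw V E p).restrict (copyBits ⁻¹' {t})).prod (arrayLaw V E p)),
          (D (sites Q (Vs \ Q) Es (bools (sel Q z)))
            (Es \ touched Q Es (bools (sel Q z))) : ℝ≥0∞) =
          D (sites Q (Vs \ Q) Es (selBits Q t)) (Es \ touched Q Es (selBits Q t)) := by
        filter_upwards [ae_restrict_prod (copiesLaw V E p) measurable_copyBits t (arrayLaw V E p)
          (q := fun _ => True) (ae_of_all _ fun _ => trivial)] with z hz
        have hz1 : selBits Q t = selBits Q fun i => bools (z.1 i) :=
          congrArg (selBits Q) hz.1.symm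
        rw [hz1, (slots_congr_sites (slots_selBits hQW Es z)).1, touched_selBits]
      rw [lintegral_congr_ae hae, lintegral_const, ← Set.univ_prod_univ, Measure.prod_prod,
        measure_univ (μ := arrayLaw V E p), mul_one]
    rw [hl, hr]
    gcongr
  calc _ ≤ _ := add_le_add e1.le ((lintegral_const_mul _ hXm').le.trans (mul_le_mul_right e2 _))
    _ = _ := by
      rw [← lintegral_const_mul _ (hGm fun b => D (sites Q (Vs \ Q) Es b) (Es \ touched Q Es b)),
        ← lintegral_add_left (hGm _)]
      simp only [ENNReal.coe_add, ENNReal.coe_mul]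

/-- One step of the induction: the magnetizations are coupled with independent cavity fields,
if the magnetizations of the smaller systems are coupled with independent variables. -/
theorem hasCoupling_cavityLaw (p : unitInterval) {u : ℝ → ℝ} (hum : Measurable u) {U c : ℝ≥0}
    (hu : ∀ t, |u t| ≤ U) (hc : (c : ℝ) = (Real.exp (2 * U) - 1) / 2) (μ : Measure ℝ)
    [IsProbabilityMeasure μ] (hμ : Supp μ) {Vs Q : Finset V} (hQ : Q ⊆ Vs) (Es : Finset E)
    (D : Finset V → Finset E → ℝ≥0)
    (hD : ∀ Q' ⊆ Vs \ Q, ∀ Es' ⊆ Es, HasCoupling (arrayLaw V E p) (sysMag u (Vs \ Q) Es')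
      (Measure.pi fun _ => μ) Q' (D Q' Es')) :
    HasCoupling (arrayLaw V E p) (sysMag u Vs Es)
      (Measure.pi fun i => cavityLaw p u i (Vs \ Q) Es μ) Q
      (ex p fun b => errorTerm U c Q (Vs \ Q) Es b +
        c * D (sites Q (Vs \ Q) Es b) (Es \ touched Q Es b)) := by
  have hsub : ∀ b, sites Q (Vs \ Q) Es b ⊆ Vs \ Q := fun b s hs => by
    obtain ⟨q, hq, rfl⟩ := Finset.mem_image.1 hs
    exact (mem_slots.1 hq).1.1
  -- One coupling for each pattern `t` of bits of the copies; the sites are spins outside `Q`, so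
  -- the assumption on the smaller system applies.
  choose π hπ1 hπ2 hπ3 using fun t => hD (sites Q (Vs \ Q) Es (selBits Q t)) (hsub _)
    (Es \ touched Q Es (selBits Q t)) Finset.sdiff_subset
  have hπp : ∀ t, IsProbabilityMeasure (π t) := fun t =>
    isProbabilityMeasure_of_map measurable_fst (hπ1 t)
  set P₀ := Measure.pi fun _ : V × (V × E) => μ
  have hsel := sel_map (E := E) p Q
  have hcav := map_cavityField (p := p) hum (Vs \ Q) Es μ
  have hgm : ∀ t, Measurable fun w : (V × (V × E) → ℝ) × ((V × E → Bool × ℝ) × (V → ℝ)) =>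
      graft Q (Vs \ Q) Es (selBits Q t) w.2.2 w.1 := fun t =>
    (measurable_graft Q (Vs \ Q) Es (selBits Q t)).comp (f := fun w : (V × (V × E) → ℝ) ×
      ((V × E → Bool × ℝ) × (V → ℝ)) => (w.1, w.2.2)) (by fun_prop)
  have hy : ∀ t, (P₀.prod (π t)).map (fun w => w.2.1) = arrayLaw V E p := by
    intro t
    change (P₀.prod (π t)).map (Prod.fst ∘ Prod.snd) = _
    rw [← Measure.map_map measurable_fst measurable_snd, Measure.map_snd_prod, measure_univ,
      one_smul, hπ1]
  have hz : ∀ t, (P₀.prod (π t)).map (fun w => graft Q (Vs \ Q) Es (selBits Q t) w.2.2 w.1) =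
      Measure.pi fun _ : V => Measure.pi fun _ : V × E => μ := by
    intro t
    have e0 := Measure.map_prod_map P₀ (π t) (f := id) (g := Prod.snd) measurable_id measurable_snd
    rw [hπ2, Measure.map_id] at e0
    rw [← map_graft μ Q (Vs \ Q) Es (selBits Q t), e0,
      Measure.map_map (measurable_graft Q (Vs \ Q) Es (selBits Q t)) (by fun_prop)]
    rfl
  have h := hasCoupling_mixture (copiesLaw V E p) measurable_copyBits (fun t => P₀.prod (π t))
    hsel.1 (g₁ := fun w => w.2.1) (by fun_prop) hy hcav.1 hgm hz (Q := Q)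
    (fun i => measurable_sysMag hum Vs Es i)
    (measurable_comp_bools fun b => errorTerm U c Q (Vs \ Q) Es b +
      c * D (sites Q (Vs \ Q) Es b) (Es \ touched Q Es b)).coe_nnreal_ennreal
    (fun t => lintegral_sysMag_sel_sub_le p hum hu hc μ hμ hQ Es D t (π t) (hπ1 t) (hπ2 t) (hπ3 t))
  rw [hsel.2, hcav.2] at h
  exact h

end InductionStep

/-! ### Closing the induction with explicit constants. -/

section Induction

variable {V E : Type*} [Fintype V] [Fintype E] [DecidableEq V] [DecidableEq E]

/-- With `card E = α N` and `p = γ / N` every contribution is of order `(m + m ^ 2) / N`, where `m =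
Q.card`. The form `m + m ^ 2` absorbs the first and the second powers together. -/
lemma ex_errorTerm_le {p : unitInterval} {U c α γ : ℝ≥0} {Q W : Finset V} (hQW : Disjoint Q W)
    (Es : Finset E) (hN : (Fintype.card V : ℝ≥0) ≠ 0)
    (hM : (Fintype.card E : ℝ≥0) = α * Fintype.card V)
    (hp : unitInterval.toNNReal p = γ / Fintype.card V) (hcb : c * (α * γ ^ 2) ≤ 1 / 2) :
    ex p (fun b => errorTerm U c Q W Es b) ≤
      (((2 * (α * γ ^ 2) + 4 * c * U * (α ^ 2 * γ ^ 4) * (1 + γ) + 2 * c * (α ^ 2 * γ ^ 4)) *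
        (Q.card + Q.card ^ 2) / Fintype.card V : ℝ≥0) : ℝ≥0∞) := by
  have hc' : c * (Fintype.card E * Fintype.card V * unitInterval.toNNReal p ^ 2) ≤ 1 / 2 := by
    refine le_of_eq_of_le ?_ hcb
    rw [hM, hp]
    field_simp
  simp only [errorTerm, ex_add, ex_const_mul]
  refine (add_le_add_three (mul_le_mul_right (ex_not_isolated_le p Q Es) _)
    (mul_le_mul_right (ex_perturbed_le p Q W Es hc' hQW) _)
    (mul_le_mul_right (ex_card_slots_sub_sites_le p Es hQW) _)).trans ?_
  rw [← ENNReal.coe_mul, ← ENNReal.coe_mul, ← ENNReal.coe_mul, ← ENNReal.coe_add,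
    ← ENNReal.coe_add, ENNReal.coe_le_coe, hM, hp]
  set N : ℝ≥0 := ((Fintype.card V : ℕ) : ℝ≥0)
  set m : ℝ≥0 := ((Q.card : ℕ) : ℝ≥0)
  have e : (2 * (m ^ 2 * (α * N) * (γ / N) ^ 2) + c * (m * (α * N) * N * (α * N * (2 * U *
      (m * (2 * (γ / N) ^ 4) + N * (2 * (γ / N) ^ 5)))))) + 2 * c * (m ^ 2 * (α * N) ^ 2 * N *
      (γ / N) ^ 4) = (2 * (α * γ ^ 2) * m ^ 2 + 4 * c * U * (α ^ 2 * γ ^ 4) * (m ^ 2 + m * γ) +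
      2 * c * (α ^ 2 * γ ^ 4) * m ^ 2) / N := by
    field_simp
    ring
  rw [e]
  gcongr
  have h1 : m ^ 2 ≤ m + m ^ 2 := le_add_self
  calc _ ≤ 2 * (α * γ ^ 2) * (m + m ^ 2) + 4 * c * U * (α ^ 2 * γ ^ 4) *
        ((m + m ^ 2) + (m + m ^ 2) * γ) + 2 * c * (α ^ 2 * γ ^ 4) * (m + m ^ 2) := by
        gcongr
        exact le_self_add
    _ = _ := by ring

/-- The first two moments of the number of slots enter: `h1` controls the coefficient of `m` and
`h2` that of `m ^ 2`. Both `A` and the coefficient of `Δ` come back halved, while the loss from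
removing `Q` and its clauses goes into a separate term with `B`. -/
lemma ex_cost_le {p : unitInterval} {c α γ A B Δ : ℝ≥0} {Q W : Finset V} (hQW : Disjoint Q W)
    (Es : Finset E) (hN : (Fintype.card V : ℝ≥0) ≠ 0)
    (hM : (Fintype.card E : ℝ≥0) = α * Fintype.card V)
    (hp : unitInterval.toNNReal p = γ / Fintype.card V)
    (h1 : c * (2 * (α * γ ^ 2) + α * γ ^ 3) ≤ 1 / 2) (h2 : c * (α * γ ^ 2) ^ 2 ≤ 1 / 2) :
    ex p (fun b => c * ((A * ((slots Q W Es b).card + (slots Q W Es b).card ^ 2) +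
        B * (slots Q W Es b).card * (Δ + Q.card + (touched Q Es b).card)) / Fintype.card V)) ≤
      (((A * (Q.card + Q.card ^ 2) / 2 + B * Q.card * Δ / 2 + B * (c * (α * γ ^ 2 + α ^ 2 * γ ^ 3))
        * (Q.card + Q.card ^ 2)) / Fintype.card V : ℝ≥0) : ℝ≥0∞) := by
  set N : ℝ≥0 := ((Fintype.card V : ℕ) : ℝ≥0)
  set m : ℝ≥0 := ((Q.card : ℕ) : ℝ≥0)
  have e : (fun b : V → E → Bool => c * ((A * ((slots Q W Es b).card + (slots Q W Es b).card ^ 2) +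
      B * (slots Q W Es b).card * (Δ + m + (touched Q Es b).card)) / N)) = fun b =>
      (c / N) * ((A + B * (Δ + m)) * (slots Q W Es b).card + A * (slots Q W Es b).card ^ 2 +
        B * ((slots Q W Es b).card * (touched Q Es b).card)) := by
    funext b
    ring
  rw [e]
  simp only [ex_add, ex_const_mul]
  refine (mul_le_mul_right (add_le_add_three (mul_le_mul_right (ex_card_slots_le p Es hQW) _)
    (mul_le_mul_right (ex_card_slots_sq_le p Es hQW) _)
    (mul_le_mul_right (ex_card_slots_mul_touched_le p Es hQW) _)) _).trans ?_
  rw [← ENNReal.coe_mul, ← ENNReal.coe_mul, ← ENNReal.coe_mul, ← ENNReal.coe_add,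
    ← ENNReal.coe_add, ← ENNReal.coe_mul, ENNReal.coe_le_coe, hM, hp]
  have e' : (c / N) * ((A + B * (Δ + m)) * (m * (α * N) * N * (γ / N) ^ 2) + A * (m ^ 2 *
      (α * N) ^ 2 * N ^ 2 * (γ / N) ^ 4 + m * (α * N) * N ^ 2 * (γ / N) ^ 3 +
      m * (α * N) * N * (γ / N) ^ 2) + B * (m ^ 2 * (α * N) ^ 2 * N * (γ / N) ^ 3 +
      m * (α * N) * N * (γ / N) ^ 2)) =
      (A * (m * (c * (2 * (α * γ ^ 2) + α * γ ^ 3)) + m ^ 2 * (c * (α * γ ^ 2) ^ 2)) +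
        B * m * Δ * (c * (α * γ ^ 2)) +
        B * c * (α * γ ^ 2 * (m + m ^ 2) + α ^ 2 * γ ^ 3 * m ^ 2)) / N := by
    field_simp
    ring
  rw [e']
  have h3 : c * (α * γ ^ 2) ≤ 1 / 2 := by
    refine le_trans ?_ h1
    gcongr
    calc α * γ ^ 2 ≤ α * γ ^ 2 + (α * γ ^ 2 + α * γ ^ 3) := le_self_add
      _ = _ := by ring
  gcongr ?_ / N
  calc _ ≤ A * (m * (1 / 2) + m ^ 2 * (1 / 2)) + B * m * Δ * (1 / 2) +
        B * c * (α * γ ^ 2 * (m + m ^ 2) + α ^ 2 * γ ^ 3 * (m + m ^ 2)) := by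
        gcongr
        exact le_add_self
    _ = _ := by ring

/-- The terms `α * γ ^ 2` and `α * γ ^ 3` come from the Poisson approximation. The others come from
the missing spins and clauses: a missing spin costs `α * γ ^ 2 / N`, a missing clause `γ / N`, and
the factor `2` is the diameter of `[-1, 1]`. -/
lemma near_cavityLaw_le {p : unitInterval} {u : ℝ → ℝ} (hum : Measurable u) {U : ℝ≥0}
    (hu : ∀ t, |u t| ≤ U) {α γ : ℝ≥0} {μ : Measure ℝ} (hμ : IsFixedLaw u α γ μ) {Vs Q : Finset V}
    (Es : Finset E) (hN : (Fintype.card V : ℝ≥0) ≠ 0)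
    (hM : (Fintype.card E : ℝ≥0) = α * Fintype.card V)
    (hp : unitInterval.toNNReal p = γ / Fintype.card V) {i : V} (hi : i ∈ Q) :
    Near (cavityLaw p u i (Vs \ Q) Es μ) μ (((2 * (α * γ ^ 2 + α * γ ^ 3 +
      α * γ ^ 2 * (Vsᶜ.card + Q.card) + γ * Esᶜ.card)) / Fintype.card V : ℝ≥0) : ℝ≥0∞) := by
  have hNr : (Fintype.card V : ℝ) ≠ 0 := by exact_mod_cast hN
  have hN0 : (0 : ℝ) < Fintype.card V := by positivity
  have hpr : (p : ℝ) = γ / Fintype.card V := by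
    have := congrArg NNReal.toReal hp
    simpa using this
  have hMr : (Fintype.card E : ℝ) = α * Fintype.card V := by exact_mod_cast hM
  have hW : (((Vs \ Q).card : ℕ) : ℝ) + (Vs \ Q)ᶜ.card = Fintype.card V := by
    exact_mod_cast Finset.card_add_card_compl (Vs \ Q)
  have hW' : ((Vs \ Q)ᶜ.card : ℝ) ≤ Vsᶜ.card + Q.card := by
    have : (Vs \ Q)ᶜ ⊆ Vsᶜ ∪ Q := fun v hv => by
      simp only [Finset.mem_compl, Finset.mem_sdiff, Finset.mem_union] at hv ⊢
      tauto
    exact_mod_cast (Finset.card_le_card this).trans (Finset.card_union_le _ _)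
  have hE : ((Es.card : ℕ) : ℝ) + Esᶜ.card = Fintype.card E := by
    exact_mod_cast Finset.card_add_card_compl Es
  have hNp : (Fintype.card V : ℝ) * p = γ := by rw [hpr]; field_simp
  have hMp : (Fintype.card E : ℝ) * p = α * γ := by rw [hpr, hMr]; field_simp
  have hp0 : (0 : ℝ) ≤ p := p.2.1
  have hα : (0 : ℝ) ≤ α := α.coe_nonneg
  have hγ : (0 : ℝ) ≤ γ := γ.coe_nonneg
  have h1 : ((Vs \ Q).card : ℝ) * p ≤ γ := by
    rw [← hNp, ← hW]
    gcongr
    exact le_add_of_nonneg_right (Nat.cast_nonneg _)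
  have h2 : (Es.card : ℝ) * p ≤ α * γ := by
    rw [← hMp, ← hE]
    gcongr
    exact le_add_of_nonneg_right (Nat.cast_nonneg _)
  refine (near_cavityLaw p hum hu hα hγ hμ (fun h => (Finset.mem_sdiff.1 h).2 hi) h1 h2).mono ?_
  rw [← ENNReal.ofReal_ofNat 2, ← ENNReal.ofReal_mul (by norm_num), ← ENNReal.ofReal_coe_nnreal]
  refine ENNReal.ofReal_le_ofReal ?_
  push_cast
  have e1 : (γ : ℝ) - (Vs \ Q).card * p = (Vs \ Q)ᶜ.card * p := by
    rw [← hNp, ← hW]; ring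
  have e2 : (α : ℝ) * γ - Es.card * p = Esᶜ.card * p := by
    rw [← hMp, ← hE]; ring
  have e3 : (Es.card : ℝ) ≤ α * Fintype.card V := by
    rw [← hMr, ← hE]
    exact le_add_of_nonneg_right (Nat.cast_nonneg _)
  have e4 : ((Vs \ Q).card : ℝ) ≤ Fintype.card V := by
    rw [← hW]
    exact le_add_of_nonneg_right (Nat.cast_nonneg _)
  rw [e1, e2, mul_div_assoc]
  refine mul_le_mul_of_nonneg_left ?_ (by norm_num)
  calc _ ≤ α * Fintype.card V * ((p : ℝ) ^ 2 + p * (Fintype.card V * p ^ 2 +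
        (Vsᶜ.card + Q.card) * p)) + Esᶜ.card * p := by gcongr
    _ = _ := by
      rw [hpr]
      field_simp
      ring

/-- The magnetizations of a subset of the spins of a subsystem are close to independent variables
with the law `μ_{α,γ}`. -/
theorem hasCoupling_sysMag (p : unitInterval) {u : ℝ → ℝ} (hum : Measurable u) {U c : ℝ≥0}
    (hu : ∀ t, |u t| ≤ U) (hc : (c : ℝ) = (Real.exp (2 * U) - 1) / 2) {α γ : ℝ≥0} {μ : Measure ℝ}
    (hμ : IsFixedLaw u α γ μ) (hM : (Fintype.card E : ℝ≥0) = α * Fintype.card V)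
    (hp : unitInterval.toNNReal p = γ / Fintype.card V)
    (h1 : c * (2 * (α * γ ^ 2) + α * γ ^ 3) ≤ 1 / 2) (h2 : c * (α * γ ^ 2) ^ 2 ≤ 1 / 2)
    {A B : ℝ≥0} (hB : 4 * (α * γ ^ 2 + γ) ≤ B)
    (hA : 2 * (2 * (α * γ ^ 2) + 4 * c * U * (α ^ 2 * γ ^ 4) * (1 + γ) + 2 * c * (α ^ 2 * γ ^ 4) +
      B * (c * (α * γ ^ 2 + α ^ 2 * γ ^ 3)) + 2 * (α * γ ^ 2 + α * γ ^ 3)) ≤ A)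
    (Vs Q : Finset V) (hQ : Q ⊆ Vs) (Es : Finset E) :
    HasCoupling (arrayLaw V E p) (sysMag u Vs Es) (Measure.pi fun _ : V => μ) Q
      (((A * (Q.card + Q.card ^ 2) + B * Q.card * (Vsᶜ.card + Esᶜ.card)) / Fintype.card V : ℝ≥0) :
        ℝ≥0∞) := by
  have := hμ.prob
  induction Vs using Finset.strongInduction generalizing Q Es with
  | H Vs ih =>
  rcases Q.eq_empty_or_nonempty with rfl | hne
  · exact ⟨(arrayLaw V E p).prod (Measure.pi fun _ : V => μ), by simp, by simp, by simp⟩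
  have hN : (Fintype.card V : ℝ≥0) ≠ 0 := by
    obtain ⟨v, -⟩ := hne
    have : Nonempty V := ⟨v⟩
    exact Nat.cast_ne_zero.2 Fintype.card_ne_zero
  have hQW : Disjoint Q (Vs \ Q) := Finset.disjoint_sdiff
  have hlt : Vs \ Q ⊂ Vs := Finset.sdiff_ssubset hQ hne
  have h3 : c * (α * γ ^ 2) ≤ 1 / 2 := by
    refine le_trans ?_ h1
    gcongr
    calc α * γ ^ 2 ≤ α * γ ^ 2 + (α * γ ^ 2 + α * γ ^ 3) := le_self_add
      _ = _ := by ring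
  have hstep := hasCoupling_cavityLaw p hum hu hc μ hμ.supp hQ Es (fun Q' Es' =>
    (A * (Q'.card + Q'.card ^ 2) + B * Q'.card * ((Vs \ Q)ᶜ.card + Es'ᶜ.card)) / Fintype.card V)
    (fun Q' hQ' Es' _ => ih (Vs \ Q) hlt Q' hQ' Es')
  have hcav := fun i => isProbabilityMeasure_cavityLaw p hum i (Vs \ Q) Es μ
  -- The cost is summed over `Q` only, so outside `Q` any coupling will do, and the trivial cost `2`
  -- is used.
  have hpi := HasCoupling.pi (fun i => cavityLaw p u i (Vs \ Q) Es μ) (fun _ => μ) Q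
    (c := fun i => if i ∈ Q then (((2 * (α * γ ^ 2 + α * γ ^ 3 +
      α * γ ^ 2 * (Vsᶜ.card + Q.card) + γ * Esᶜ.card)) / Fintype.card V : ℝ≥0) : ℝ≥0∞) else 2)
    (fun i => by
      split_ifs with hi
      · exact near_cavityLaw_le hum hu hμ Es hN hM hp hi
      · exact near_prod (supp_cavityLaw p hum i (Vs \ Q) Es μ) hμ.supp)
  refine (hstep.trans (measurable_sysMag hum Vs Es) hpi).mono ?_
  rw [ex_add, Finset.sum_congr rfl fun i hi => if_pos hi, Finset.sum_const, nsmul_eq_mul]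
  have hVc : ((Vs \ Q)ᶜ.card : ℝ≥0) ≤ Vsᶜ.card + Q.card := by
    have : (Vs \ Q)ᶜ ⊆ Vsᶜ ∪ Q := fun v hv => by
      simp only [Finset.mem_compl, Finset.mem_sdiff, Finset.mem_union] at hv ⊢
      tauto
    exact_mod_cast (Finset.card_le_card this).trans (Finset.card_union_le _ _)
  have hEc : ∀ T : Finset E, ((Es \ T)ᶜ.card : ℝ≥0) ≤ Esᶜ.card + T.card := fun T => by
    have : (Es \ T)ᶜ ⊆ Esᶜ ∪ T := fun v hv => by
      simp only [Finset.mem_compl, Finset.mem_sdiff, Finset.mem_union] at hv ⊢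
      tauto
    exact_mod_cast (Finset.card_le_card this).trans (Finset.card_union_le _ _)
  have hD : ex p (fun b : V → E → Bool => c * ((A * ((sites Q (Vs \ Q) Es b).card +
      (sites Q (Vs \ Q) Es b).card ^ 2) + B * (sites Q (Vs \ Q) Es b).card *
      ((Vs \ Q)ᶜ.card + (Es \ touched Q Es b)ᶜ.card)) / Fintype.card V)) ≤ _ :=
    (ex_mono p fun b => by
      have hs : ((sites Q (Vs \ Q) Es b).card : ℝ≥0) ≤ (slots Q (Vs \ Q) Es b).card :=
        Nat.cast_le.2 Finset.card_image_le
      have hd : ((Vs \ Q)ᶜ.card : ℝ≥0) + (Es \ touched Q Es b)ᶜ.card ≤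
          (Vsᶜ.card + Esᶜ.card : ℝ≥0) + Q.card + (touched Q Es b).card :=
        (add_le_add hVc (hEc _)).trans_eq (by ring)
      gcongr).trans (ex_cost_le (A := A) (B := B) (Δ := Vsᶜ.card + Esᶜ.card) hQW Es hN hM hp h1 h2)
  refine (add_le_add (add_le_add (ex_errorTerm_le hQW Es hN hM hp h3) hD) le_rfl).trans ?_
  rw [← ENNReal.coe_natCast, ← ENNReal.coe_mul, ← ENNReal.coe_add, ← ENNReal.coe_add,
    ENNReal.coe_le_coe, ← mul_div_assoc, ← add_div, ← add_div]
  gcongr ?_ / _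
  set m : ℝ≥0 := ((Q.card : ℕ) : ℝ≥0)
  set x : ℝ≥0 := ((Vsᶜ.card : ℕ) : ℝ≥0)
  set y : ℝ≥0 := ((Esᶜ.card : ℕ) : ℝ≥0)
  have hx : γ * m * y + α * γ ^ 2 * m * x ≤ (α * γ ^ 2 + γ) * m * (x + y) := by
    calc _ ≤ (γ * m * y + α * γ ^ 2 * m * x) + (γ * m * x + α * γ ^ 2 * m * y) := le_self_add
      _ = _ := by ring
  have hm : (α * γ ^ 2 + α * γ ^ 3) * m + α * γ ^ 2 * m ^ 2 ≤
      (α * γ ^ 2 + α * γ ^ 3) * (m + m ^ 2) := by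
    calc _ ≤ ((α * γ ^ 2 + α * γ ^ 3) * m + α * γ ^ 2 * m ^ 2) + α * γ ^ 3 * m ^ 2 := le_self_add
      _ = _ := by ring
  set R : ℝ≥0 := 2 * (α * γ ^ 2) + 4 * c * U * (α ^ 2 * γ ^ 4) * (1 + γ) + 2 * c * (α ^ 2 * γ ^ 4)
  -- The previous stage returns half of `A` and half of `B`. The assumptions `hA` and `hB` say
  -- exactly that the other halves absorb the new errors.
  calc R * (m + m ^ 2) + (A * (m + m ^ 2) / 2 + B * m * (x + y) / 2 +
        B * (c * (α * γ ^ 2 + α ^ 2 * γ ^ 3)) * (m + m ^ 2)) +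
        m * (2 * (α * γ ^ 2 + α * γ ^ 3 + α * γ ^ 2 * (x + m) + γ * y))
      = (R + B * (c * (α * γ ^ 2 + α ^ 2 * γ ^ 3))) * (m + m ^ 2) + A * (m + m ^ 2) / 2 +
        B * m * (x + y) / 2 + 2 * ((α * γ ^ 2 + α * γ ^ 3) * m + α * γ ^ 2 * m ^ 2) +
        2 * (γ * m * y + α * γ ^ 2 * m * x) := by ring
    _ ≤ (R + B * (c * (α * γ ^ 2 + α ^ 2 * γ ^ 3))) * (m + m ^ 2) + A * (m + m ^ 2) / 2 +
        B * m * (x + y) / 2 + 2 * ((α * γ ^ 2 + α * γ ^ 3) * (m + m ^ 2)) +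
        2 * ((α * γ ^ 2 + γ) * m * (x + y)) := by gcongr
    _ = (2 * (R + B * (c * (α * γ ^ 2 + α ^ 2 * γ ^ 3)) + 2 * (α * γ ^ 2 + α * γ ^ 3))) *
        (m + m ^ 2) / 2 + A * (m + m ^ 2) / 2 + B * m * (x + y) / 2 +
        (4 * (α * γ ^ 2 + γ)) * m * (x + y) / 2 := by field_simp; ring
    _ ≤ A * (m + m ^ 2) / 2 + A * (m + m ^ 2) / 2 + B * m * (x + y) / 2 +
        B * m * (x + y) / 2 := by gcongr
    _ = _ := by field_simp; ring

end Induction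

/-! ### From arrays back to the given disorder variables. -/

section Transfer

lemma magnetization_eq_sysMag {N M : ℕ} (u : ℝ → ℝ) (g b : Fin N → Fin M → ℝ)
    (h : ∀ i k, b i k = 1 ∨ b i k = 0) (i : Fin N) :
    magnetization u (fun _ => 1) g b i =
      sysMag u Finset.univ Finset.univ (fun q => (decide (b q.1 q.2 = 1), g q.1 q.2)) i := by
  have hw : ∀ σ, Real.exp (negHamiltonian u (fun _ => 1) g b σ) = prodWeight Finset.univ
      (factor u Finset.univ fun q : Fin N × Fin M => (decide (b q.1 q.2 = 1), g q.1 q.2)) σ := by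
    intro σ
    simp only [negHamiltonian, prodWeight, factor, Real.exp_sum, one_mul]
    refine Finset.prod_congr rfl fun k _ => ?_
    congr 2
    rw [Finset.sum_filter]
    refine Finset.sum_congr rfl fun v _ => ?_
    rcases h v k with h | h <;> simp [h]
  simp only [magnetization, gibbsAverage, partitionFunction, sysMag, mag, avg, hw]
  rw [div_eq_inv_mul]

lemma map_sum_pi_eq_arrayLaw {V E : Type*} [Fintype V] [Fintype E] [DecidableEq V] [DecidableEq E]
    (p : unitInterval) :
    (Measure.pi fun j : (V × E) ⊕ (V × E) => Sum.elim (fun _ => gaussianReal 0 1)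
      (fun _ => bernoulliMeasure (1 : ℝ) 0 p) j).map
      (fun x q => (decide (x (Sum.inr q) = 1), x (Sum.inl q))) = arrayLaw V E p := by
  have hprob : ∀ j : (V × E) ⊕ (V × E), IsProbabilityMeasure (Sum.elim
      (fun _ => gaussianReal 0 1) (fun _ => bernoulliMeasure (1 : ℝ) 0 p) j) := by
    rintro (j | j) <;> simp only [Sum.elim_inl, Sum.elim_inr] <;> infer_instance
  have hd : Measurable fun x : ℝ => decide (x = 1) :=
    measurable_to_bool (by
      have : (fun x : ℝ => decide (x = 1)) ⁻¹' {true} = {1} := by ext; simp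
      rw [this]
      exact measurableSet_singleton _)
  have h1 := (measurePreserving_sumPiEquivProdPi (fun j : (V × E) ⊕ (V × E) =>
    Sum.elim (fun _ => gaussianReal 0 1) (fun _ => bernoulliMeasure (1 : ℝ) 0 p) j)).map_eq
  simp only [Sum.elim_inl, Sum.elim_inr] at h1
  have h2 : siteLaw p = ((bernoulliMeasure (1 : ℝ) 0 p).prod (gaussianReal 0 1)).map
      (Prod.map (fun x => decide (x = 1)) id) := by
    rw [← Measure.map_prod_map _ _ hd measurable_id, Measure.map_id,
      map_bernoulliMeasure' (1 : ℝ) 0 hd, siteLaw]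
    simp
  have hdi : Measurable (Prod.map (fun x : ℝ => decide (x = 1)) (id : ℝ → ℝ)) :=
    hd.prodMap measurable_id
  have hz : Measurable fun (z : (V × E → ℝ) × (V × E → ℝ)) (q : V × E) => (z.1 q, z.2 q) := by
    fun_prop
  have hg : Measurable fun (w : V × E → ℝ × ℝ) (q : V × E) =>
      Prod.map (fun x : ℝ => decide (x = 1)) (id : ℝ → ℝ) (w q) :=
    measurable_pi_lambda _ fun q => hdi.comp (measurable_pi_apply q)
  have h3 := Measure.pi_map_pi (μ := fun _ : V × E => (bernoulliMeasure (1 : ℝ) 0 p).prod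
    (gaussianReal 0 1)) (f := fun _ => Prod.map (fun x : ℝ => decide (x = 1)) (id : ℝ → ℝ))
    fun _ => hdi.aemeasurable
  rw [arrayLaw, h2, ← h3, ← map_prod_pi_zip, ← Measure.prod_swap, ← h1,
    Measure.map_map measurable_swap (MeasurableEquiv.measurable _),
    Measure.map_map hz (measurable_swap.comp (MeasurableEquiv.measurable _)),
    Measure.map_map hg (hz.comp (measurable_swap.comp (MeasurableEquiv.measurable _)))]
  rfl

/-- The array of the disorder variables. -/
lemma exists_array {Ω : Type*} [MeasurableSpace Ω] (P : Measure Ω) [IsProbabilityMeasure P]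
    {N M : ℕ} {p : unitInterval} {g b : Fin N → Fin M → Ω → ℝ} (h : IsDisorder P p g b)
    (u : ℝ → ℝ) : ∃ y : Ω → Fin N × Fin M → Bool × ℝ, Measurable y ∧
      P.map y = arrayLaw (Fin N) (Fin M) p ∧
      ∀ᵐ ω ∂P, ∀ i, magnetization u (fun _ => 1) (fun j k => g j k ω) (fun j k => b j k ω) i =
        sysMag u Finset.univ Finset.univ (y ω) i := by
  set F : (Fin N × Fin M) ⊕ (Fin N × Fin M) → Ω → ℝ := fun j =>
    Sum.elim (fun q => g q.1 q.2) (fun q => b q.1 q.2) j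
  have hlaw : ∀ j, HasLaw (F j) (Sum.elim (fun _ => gaussianReal 0 1)
      (fun _ => bernoulliMeasure (1 : ℝ) 0 p) j) P := by
    rintro (q | q)
    exacts [h.gaussian _ _, h.bernoulli _ _]
  have hF : ∀ j, AEMeasurable (F j) P := fun j => (hlaw j).aemeasurable
  -- The disorder variables are only almost everywhere measurable, so they are replaced by
  -- measurable versions.
  set G : Ω → (Fin N × Fin M) ⊕ (Fin N × Fin M) → ℝ := fun ω j => (hF j).mk _ ω
  have hGm : Measurable G := measurable_pi_lambda _ fun j => (hF j).measurable_mk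
  have hFG : ∀ᵐ ω ∂P, ∀ j, F j ω = G ω j := ae_all_iff.2 fun j => (hF j).ae_eq_mk
  have hd : Measurable fun x : ℝ => decide (x = 1) :=
    measurable_to_bool (by
      have : (fun x : ℝ => decide (x = 1)) ⁻¹' {true} = {1} := by ext; simp
      rw [this]
      exact measurableSet_singleton _)
  have hZ : Measurable fun (x : (Fin N × Fin M) ⊕ (Fin N × Fin M) → ℝ) (q : Fin N × Fin M) =>
      (decide (x (Sum.inr q) = 1), x (Sum.inl q)) :=
    measurable_pi_lambda _ fun q => (hd.comp (measurable_pi_apply _)).prodMk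
      (measurable_pi_apply _)
  refine ⟨fun ω q => (decide (G ω (Sum.inr q) = 1), G ω (Sum.inl q)), hZ.comp hGm, ?_, ?_⟩
  · have hmap : P.map G = Measure.pi fun j => Sum.elim (fun _ => gaussianReal 0 1)
        (fun _ => bernoulliMeasure (1 : ℝ) 0 p) j := by
      rw [← Measure.map_congr (f := fun ω j => F j ω) (hFG.mono fun ω hω => funext hω),
        (iIndepFun_iff_map_fun_eq_pi_map hF).1 h.indep]
      exact congrArg _ (funext fun j => (hlaw j).map_eq)
    rw [← map_sum_pi_eq_arrayLaw, ← hmap, Measure.map_map hZ hGm]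
    rfl
  · have hb : ∀ᵐ ω ∂P, ∀ q : Fin N × Fin M, b q.1 q.2 ω = 1 ∨ b q.1 q.2 ω = 0 := by
      refine ae_all_iff.2 fun q => ?_
      have hq := h.bernoulli q.1 q.2
      refine ae_of_ae_map (p := fun x : ℝ => x = 1 ∨ x = 0) hq.aemeasurable ?_
      rw [hq.map_eq, bernoulliMeasure_def, ae_add_measure_iff]
      exact ⟨Measure.ae_smul_measure (by simp [ae_dirac_eq]) _,
        Measure.ae_smul_measure (by simp [ae_dirac_eq]) _⟩
    filter_upwards [hFG, hb] with ω hω hbω i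
    rw [magnetization_eq_sysMag u _ _ (fun i k => hbω (i, k))]
    congr 1
    funext q
    rw [← hω, ← hω]
    rfl

/-- A coupling of the law of `y` can be realized on an enlargement of the probability space. -/
lemma exists_enlargement {Ω Y Z : Type*} [MeasurableSpace Ω] [MeasurableSpace Y]
    [MeasurableSpace Z] [StandardBorelSpace Z] [Nonempty Z] (P : Measure Ω)
    [IsProbabilityMeasure P] {y : Ω → Y} (hy : Measurable y) (π : Measure (Y × Z))
    (hπ : π.map Prod.fst = P.map y) :
    ∃ P' : Measure (Ω × Z), IsProbabilityMeasure P' ∧ P'.map Prod.fst = P ∧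
      P'.map (fun w => (y w.1, w.2)) = π := by
  have : IsProbabilityMeasure (P.map y) := Measure.isProbabilityMeasure_map hy.aemeasurable
  have : IsProbabilityMeasure π := isProbabilityMeasure_of_map measurable_fst hπ
  refine ⟨P ⊗ₘ (π.condKernel.comap y hy), inferInstance, ?_, ?_⟩
  · exact Measure.fst_compProd _ _
  · rw [map_compProd_comap, ← hπ]
    exact π.disintegrate π.condKernel

end Transfer

/-! ### Realization of the coupling and the smallness conditions. -/

section Transfer

lemma exists_coupling_first {N M m : ℕ} (hm : m ≤ N) {p : unitInterval} {u : ℝ → ℝ}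
    {μ : Measure ℝ} [IsProbabilityMeasure μ] {c : ℝ≥0∞}
    (h : HasCoupling (arrayLaw (Fin N) (Fin M) p) (sysMag u Finset.univ Finset.univ)
      (Measure.pi fun _ => μ) (Finset.univ.map (Fin.castLEEmb hm)) c) (hum : Measurable u) :
    ∃ π : Measure ((Fin N × Fin M → Bool × ℝ) × (Fin m → ℝ)),
      π.map Prod.fst = arrayLaw (Fin N) (Fin M) p ∧ π.map Prod.snd = Measure.pi (fun _ => μ) ∧
      ∫⁻ q, ENNReal.ofReal (∑ i, |sysMag u Finset.univ Finset.univ q.1 (Fin.castLE hm i) - q.2 i|) ∂π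
        ≤ c := by
  obtain ⟨π, h1, h2, h3⟩ := h
  have hr : Measurable fun (q : (Fin N × Fin M → Bool × ℝ) × (Fin N → ℝ)) =>
      (q.1, q.2 ∘ Fin.castLE hm) :=
    measurable_fst.prodMk (measurable_pi_lambda _ fun i =>
      (measurable_pi_apply (Fin.castLE hm i)).comp measurable_snd)
  have hr2 : Measurable fun x : Fin N → ℝ => x ∘ Fin.castLE hm :=
    measurable_pi_lambda _ fun i => measurable_pi_apply (Fin.castLE hm i)
  refine ⟨π.map fun q => (q.1, q.2 ∘ Fin.castLE hm), ?_, ?_, ?_⟩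
  · rw [Measure.map_map measurable_fst hr]
    exact h1
  · rw [← map_comp_pi μ (Fin.castLE_injective hm), ← h2, Measure.map_map hr2 measurable_snd,
      Measure.map_map measurable_snd hr]
    rfl
  · rw [lintegral_map _ hr]
    · refine le_trans (le_of_eq (lintegral_congr fun q => ?_)) h3
      rw [Finset.sum_map, ENNReal.ofReal_sum_of_nonneg fun _ _ => abs_nonneg _]
      rfl
    · refine ENNReal.measurable_ofReal.comp (Finset.measurable_fun_sum _ fun i _ => ?_)
      refine Measurable.abs (((measurable_sysMag hum _ _ _).comp measurable_fst).sub ?_)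
      exact (measurable_pi_apply i).comp measurable_snd

/-- A coupling of the law of a function of `y` with a product measure is realized by independent
variables on an enlargement of the probability space. -/
lemma exists_iIndepFun_of_coupling {Ω : Type v} [MeasurableSpace Ω] {P : Measure Ω}
    [IsProbabilityMeasure P] {Y : Type*} [MeasurableSpace Y] {m : ℕ} {μ : Measure ℝ}
    [IsProbabilityMeasure μ] {y : Ω → Y} (hy : Measurable y) {S : Y → Fin m → ℝ}
    (hS : Measurable S) {X : Ω → Fin m → ℝ} (hX : ∀ᵐ ω ∂P, X ω = S (y ω))
    {π : Measure (Y × (Fin m → ℝ))} (h1 : π.map Prod.fst = P.map y)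
    (h2 : π.map Prod.snd = Measure.pi fun _ => μ) {r : ℝ} (hr : 0 ≤ r)
    (h3 : ∫⁻ q, ENNReal.ofReal (∑ i, |S q.1 i - q.2 i|) ∂π ≤ ENNReal.ofReal r) :
    (∃ (Ω' : Type v) (_ : MeasurableSpace Ω') (P' : Measure Ω') (φ : Ω' → Ω)
        (z : Fin m → Ω' → ℝ),
      IsProbabilityMeasure P' ∧ MeasurePreserving φ P' P ∧
      (∀ i, HasLaw (z i) μ P') ∧ iIndepFun z P' ∧
      Integrable (fun ω => ∑ i, |X (φ ω) i - z i ω|) P' ∧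
      ∫ ω, ∑ i, |X (φ ω) i - z i ω| ∂P' ≤ r) ∧
    transportDist (P.map X) (Measure.pi fun _ : Fin m => μ) ≤ ENNReal.ofReal r := by
  have hc : Measurable fun q : Y × (Fin m → ℝ) => ∑ i, |S q.1 i - q.2 i| := by fun_prop
  constructor
  · obtain ⟨P', hP', hfst, hpair⟩ := exists_enlargement P hy π h1
    have hφ : MeasurePreserving (Prod.fst : Ω × (Fin m → ℝ) → Ω) P' P := ⟨measurable_fst, hfst⟩
    have hyz : Measurable fun w : Ω × (Fin m → ℝ) => (y w.1, w.2) :=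
      (hy.comp measurable_fst).prodMk measurable_snd
    have hsnd : P'.map Prod.snd = Measure.pi fun _ : Fin m => μ := by
      rw [← h2, ← hpair, Measure.map_map measurable_snd hyz]
      rfl
    have hzm : ∀ i, Measurable fun w : Ω × (Fin m → ℝ) => w.2 i := fun i =>
      (measurable_pi_apply i).comp measurable_snd
    have hz : ∀ i, P'.map (fun w => w.2 i) = μ := by
      intro i
      rw [← (measurePreserving_eval (fun _ : Fin m => μ) i).map_eq, ← hsnd,
        Measure.map_map (measurable_pi_apply i) measurable_snd]
      rfl
    have hae : (fun ω : Ω × (Fin m → ℝ) => ∑ i, |S (y ω.1) i - ω.2 i|) =ᵐ[P'] fun ω =>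
        ∑ i, |X ω.1 i - ω.2 i| :=
      (hφ.quasiMeasurePreserving.ae hX).mono fun ω hω => by simp only [hω]
    have hcm : Measurable fun ω : Ω × (Fin m → ℝ) => ∑ i, |S (y ω.1) i - ω.2 i| := hc.comp hyz
    have hcost : ∫⁻ ω, ENNReal.ofReal (∑ i, |S (y ω.1) i - ω.2 i|) ∂P' ≤ ENNReal.ofReal r := by
      rw [← hpair, lintegral_map hc.ennreal_ofReal hyz] at h3
      exact h3
    have hnn : ∀ ω : Ω × (Fin m → ℝ), 0 ≤ ∑ i, |S (y ω.1) i - ω.2 i| := fun ω =>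
      Finset.sum_nonneg fun i _ => abs_nonneg _
    have hint : Integrable (fun ω : Ω × (Fin m → ℝ) => ∑ i, |S (y ω.1) i - ω.2 i|) P' :=
      ⟨hcm.aestronglyMeasurable, by
        rw [hasFiniteIntegral_iff_ofReal (ae_of_all _ hnn)]
        exact hcost.trans_lt ENNReal.ofReal_lt_top⟩
    refine ⟨Ω × (Fin m → ℝ), inferInstance, P', Prod.fst, fun i w => w.2 i, hP', hφ,
      fun i => ⟨(hzm i).aemeasurable, hz i⟩, ?_, hint.congr hae, ?_⟩
    · rw [iIndepFun_iff_map_fun_eq_pi_map fun i => (hzm i).aemeasurable]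
      simp only [hz]
      exact hsnd
    · rw [← integral_congr_ae hae, integral_eq_lintegral_of_nonneg_ae (ae_of_all _ hnn)
        hcm.aestronglyMeasurable]
      exact ENNReal.toReal_le_of_le_ofReal hr hcost
  · have hSq : Measurable fun q : Y × (Fin m → ℝ) => (S q.1, q.2) :=
      (hS.comp measurable_fst).prodMk measurable_snd
    have hfst : (π.map fun q => (S q.1, q.2)).map Prod.fst = P.map X := by
      rw [Measure.map_congr hX, Measure.map_map measurable_fst hSq]
      change π.map (S ∘ Prod.fst) = P.map (S ∘ y)
      rw [← Measure.map_map hS measurable_fst, h1, Measure.map_map hS hy]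
    have hsnd : (π.map fun q => (S q.1, q.2)).map Prod.snd = Measure.pi fun _ : Fin m => μ := by
      rw [Measure.map_map measurable_snd hSq]
      exact h2
    refine (iInf₂_le (π.map fun q => (S q.1, q.2)) ⟨hfst, hsnd⟩).trans ?_
    rw [lintegral_map (by fun_prop) hSq]
    exact h3

theorem coupling_of_hasCoupling {Ω : Type v} [MeasurableSpace Ω] {P : Measure Ω}
    [IsProbabilityMeasure P] {N M m : ℕ} (hm : m ≤ N) {p : unitInterval}
    {g b : Fin N → Fin M → Ω → ℝ} (hgb : IsDisorder P p g b) {u : ℝ → ℝ} (hum : Measurable u)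
    {μ : Measure ℝ} [IsProbabilityMeasure μ] {r : ℝ} (hr : 0 ≤ r)
    (h : HasCoupling (arrayLaw (Fin N) (Fin M) p) (sysMag u Finset.univ Finset.univ)
      (Measure.pi fun _ => μ) (Finset.univ.map (Fin.castLEEmb hm)) (ENNReal.ofReal r)) :
    (∃ (Ω' : Type v) (_ : MeasurableSpace Ω') (P' : Measure Ω') (φ : Ω' → Ω)
        (z : Fin m → Ω' → ℝ),
      IsProbabilityMeasure P' ∧ MeasurePreserving φ P' P ∧
      (∀ i, HasLaw (z i) μ P') ∧ iIndepFun z P' ∧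
      Integrable (fun ω => ∑ i, |magnetizations u (fun _ => 1) g b hm (φ ω) i - z i ω|) P' ∧
      ∫ ω, ∑ i, |magnetizations u (fun _ => 1) g b hm (φ ω) i - z i ω| ∂P' ≤ r) ∧
    transportDist (P.map (magnetizations u (fun _ => 1) g b hm)) (Measure.pi fun _ : Fin m => μ)
      ≤ ENNReal.ofReal r := by
  obtain ⟨y, hy, hyP, hmag⟩ := exists_array P hgb u
  obtain ⟨π, h1, h2, h3⟩ := exists_coupling_first hm h hum
  set S : (Fin N × Fin M → Bool × ℝ) → Fin m → ℝ := fun a i =>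
    sysMag u Finset.univ Finset.univ a (Fin.castLE hm i)
  have hS : Measurable S := measurable_pi_lambda _ fun i => measurable_sysMag hum _ _ _
  have hmag' : ∀ᵐ ω ∂P, magnetizations u (fun _ => 1) g b hm ω = S (y ω) :=
    hmag.mono fun ω hω => funext fun i => hω _
  exact exists_iIndepFun_of_coupling hy hS hmag' (h1.trans hyP.symm) h2 hr h3

/-- The bound `c ≤ U * exp (4 * U)` compares `c` with the hypothesis. All exponential factors not
needed for this are at least `1` and can be dropped, after which both claims compare terms of an
expanded sum. -/
lemma smallness {U α γ₀ : ℝ} (hU0 : 0 ≤ U) (hα : 0 < α) (hγ₀ : 0 < γ₀)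
    (hU : 4 * U * α * γ₀ ^ 2 * Real.exp (4 * U) * Real.exp (α * γ₀ * (Real.exp (4 * U) - 1)) *
        (3 + 2 * γ₀ + α * (γ₀ ^ 2 + γ₀ ^ 3) * Real.exp (4 * U)) < 1) :
    (Real.exp (2 * U) - 1) / 2 * (2 * (α * γ₀ ^ 2) + α * γ₀ ^ 3) ≤ 1 / 2 ∧
    (Real.exp (2 * U) - 1) / 2 * (α * γ₀ ^ 2) ^ 2 ≤ 1 / 2 := by
  -- Multiplying `1 - 2 * U ≤ exp (-(2 * U))` by `exp (2 * U)` gives `exp (2 * U) - 1 ≤ 2 * U * exp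
  -- (2 * U)`.
  have hc : (Real.exp (2 * U) - 1) / 2 ≤ U * Real.exp (4 * U) := by
    have h1 : 1 - 2 * U ≤ Real.exp (-(2 * U)) := by linarith [Real.add_one_le_exp (-(2 * U))]
    have h2 : Real.exp (2 * U) * Real.exp (-(2 * U)) = 1 := by rw [← Real.exp_add]; simp
    have h3 : Real.exp (2 * U) ≤ Real.exp (4 * U) := Real.exp_le_exp.2 (by linarith)
    have h4 := mul_le_mul_of_nonneg_left h1 (Real.exp_pos (2 * U)).le
    have h5 := mul_le_mul_of_nonneg_left h3 hU0
    nlinarith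
  have hE1 : 1 ≤ Real.exp (4 * U) := Real.one_le_exp (by linarith)
  have hE2 : 1 ≤ Real.exp (α * γ₀ * (Real.exp (4 * U) - 1)) :=
    Real.one_le_exp (mul_nonneg (by positivity) (by linarith))
  have hU' : 4 * U * α * γ₀ ^ 2 * Real.exp (4 * U) * 1 *
      (3 + 2 * γ₀ + α * (γ₀ ^ 2 + γ₀ ^ 3) * 1) < 1 := by
    refine lt_of_le_of_lt ?_ hU
    gcongr
  set w := U * Real.exp (4 * U)
  have hw : 0 ≤ w := by positivity
  have hw3 : 0 ≤ w * (α * γ₀ ^ 2) := by positivity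
  have hw4 : 0 ≤ w * (α * γ₀ ^ 3) := by positivity
  have hw5 : 0 ≤ w * (α * γ₀ ^ 2) ^ 2 := by positivity
  have hw6 : 0 ≤ w * (α * γ₀ ^ 2) * (α * γ₀ ^ 3) := by positivity
  have hexp : 4 * U * α * γ₀ ^ 2 * Real.exp (4 * U) * 1 *
      (3 + 2 * γ₀ + α * (γ₀ ^ 2 + γ₀ ^ 3) * 1) = 4 * (3 * (w * (α * γ₀ ^ 2)) +
        2 * (w * (α * γ₀ ^ 3)) + w * (α * γ₀ ^ 2) ^ 2 + w * (α * γ₀ ^ 2) * (α * γ₀ ^ 3)) := by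
    simp only [w]
    ring
  rw [hexp] at hU'
  constructor
  · refine (mul_le_mul_of_nonneg_right hc (by positivity)).trans ?_
    nlinarith
  · refine (mul_le_mul_of_nonneg_right hc (by positivity)).trans ?_
    linarith

end Transfer

end DilutedPerceptron

end

theorem theorem3p3 (u : BoundedContinuousFunction ℝ ℝ) (α γ₀ C₀ : ℝ)
    (hα : 0 < α) (hα' : α < 1) (hγ₀ : 0 < γ₀)
    (hU : 4 * ‖u‖ * α * γ₀ ^ 2 * Real.exp (4 * ‖u‖) *
        Real.exp (α * γ₀ * (Real.exp (4 * ‖u‖) - 1)) *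
        (3 + 2 * γ₀ + α * (γ₀ ^ 2 + γ₀ ^ 3) * Real.exp (4 * ‖u‖)) < 1)
    (hC₀ : 0 < C₀) (hU' : C₀ * α * γ₀ ^ 6 * ‖u‖ * Real.exp (2 * ‖u‖) ≤ 1) :
    ∃ K : ℝ, 0 < K ∧ ∀ γ : ℝ, 0 ≤ γ → γ ≤ γ₀ →
      -- the law `μ_{α,γ}`: the unique fixed point of `T`
      ∃ μ : Measure ℝ, DilutedPerceptron.IsFixedLaw u α γ μ ∧
        (∀ ν : Measure ℝ, DilutedPerceptron.IsFixedLaw u α γ ν → ν = μ) ∧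
        -- the model with `N` spins, `M = α N`, all `η_k = 1`, Bernoulli parameter `γ / N`
        ∀ (N M m : ℕ), 0 < N → (M : ℝ) = α * N → ∀ (hm : m ≤ N) (p : unitInterval),
          (p : ℝ) = γ / N →
          ∀ (Ω : Type v) [MeasurableSpace Ω] (P : Measure Ω) [IsProbabilityMeasure P]
            (g b : Fin N → Fin M → Ω → ℝ), DilutedPerceptron.IsDisorder P p g b →
            -- on an enlargement of the probability space there are i.i.d. `z_i` of law `μ_{α,γ}`
            (∃ (Ω' : Type v) (_ : MeasurableSpace Ω') (P' : Measure Ω') (φ : Ω' → Ω)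
                (z : Fin m → Ω' → ℝ),
              IsProbabilityMeasure P' ∧ MeasurePreserving φ P' P ∧
              (∀ i, HasLaw (z i) μ P') ∧ iIndepFun z P' ∧
              Integrable (fun ω => ∑ i,
                |DilutedPerceptron.magnetizations u (fun _ => 1) g b hm (φ ω) i - z i ω|) P' ∧
              ∫ ω, ∑ i,
                |DilutedPerceptron.magnetizations u (fun _ => 1) g b hm (φ ω) i - z i ω| ∂P'
                ≤ K * (m : ℝ) ^ 3 / N) ∧
            DilutedPerceptron.transportDist
                (P.map (DilutedPerceptron.magnetizations u (fun _ => 1) g b hm))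
                (Measure.pi (fun _ : Fin m => μ))
              ≤ ENNReal.ofReal (K * (m : ℝ) ^ 3 / N) := by
  obtain ⟨hs1, hs2⟩ := DilutedPerceptron.smallness (norm_nonneg u) hα hγ₀ hU
  have hum : Measurable u := u.continuous.measurable
  have hc0 : 0 ≤ (Real.exp (2 * ‖u‖) - 1) / 2 := by
    have := Real.one_le_exp (mul_nonneg zero_le_two (norm_nonneg u))
    linarith
  lift α to ℝ≥0 using hα.le
  lift γ₀ to ℝ≥0 using hγ₀.le
  obtain ⟨c, hc⟩ : ∃ c : ℝ≥0, (c : ℝ) = (Real.exp (2 * ‖u‖₊) - 1) / 2 := ⟨⟨_, hc0⟩, rfl⟩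
  rw [coe_nnnorm] at hc
  have hu : ∀ t, |u t| ≤ (‖u‖₊ : ℝ≥0) := fun t => u.norm_coe_le_norm t
  rw [← hc] at hs1 hs2
  have h1₀ : c * (2 * (α * γ₀ ^ 2) + α * γ₀ ^ 3) ≤ 1 / 2 := by exact_mod_cast hs1
  have h2₀ : c * (α * γ₀ ^ 2) ^ 2 ≤ 1 / 2 := by exact_mod_cast hs2
  -- `B` and `A` are the values at `γ₀`; all the expressions increase with `γ`, so they serve every
  -- `γ ≤ γ₀`.
  obtain ⟨B, hB⟩ : ∃ B : ℝ≥0, B = 4 * (α * γ₀ ^ 2 + γ₀) := ⟨_, rfl⟩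
  obtain ⟨A, hA⟩ : ∃ A : ℝ≥0, A = 2 * (2 * (α * γ₀ ^ 2) + 4 * c * ‖u‖₊ * (α ^ 2 * γ₀ ^ 4) *
      (1 + γ₀) + 2 * c * (α ^ 2 * γ₀ ^ 4) + B * (c * (α * γ₀ ^ 2 + α ^ 2 * γ₀ ^ 3)) +
      2 * (α * γ₀ ^ 2 + α * γ₀ ^ 3)) := ⟨_, rfl⟩
  -- The factor `2` comes from `m + m ^ 2 ≤ 2 * m ^ 3`, and the added `1` makes the constant
  -- positive.
  refine ⟨2 * A + 1, by positivity, fun γ hγ hγγ₀ => ?_⟩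
  lift γ to ℝ≥0 using hγ
  replace hγγ₀ : γ ≤ γ₀ := by exact_mod_cast hγγ₀
  have h1 : c * (2 * (α * γ ^ 2) + α * γ ^ 3) ≤ 1 / 2 := le_trans (by gcongr) h1₀
  have h2 : c * (α * γ ^ 2) ^ 2 ≤ 1 / 2 := le_trans (by gcongr) h2₀
  have hlt : (c : ℝ≥0∞) * ENNReal.ofReal (α * γ ^ 2) < 1 := by
    have h3 : c * (α * γ ^ 2) < 1 := by
      refine lt_of_le_of_lt ?_ (half_lt_self one_pos)
      refine le_trans ?_ h1
      gcongr
      calc α * γ ^ 2 ≤ α * γ ^ 2 + (α * γ ^ 2 + α * γ ^ 3) := le_self_add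
        _ = _ := by ring
    have e : ENNReal.ofReal (α * γ ^ 2) = ((α * γ ^ 2 : ℝ≥0) : ℝ≥0∞) := by
      rw [← ENNReal.ofReal_coe_nnreal]
      push_cast
      rfl
    rw [e]
    exact_mod_cast h3
  obtain ⟨μ, hμ⟩ := DilutedPerceptron.exists_isFixedLaw hum hu hc α.coe_nonneg γ.coe_nonneg hlt
  refine ⟨μ, hμ, fun ν hν => DilutedPerceptron.isFixedLaw_unique hum hu hc α.coe_nonneg
    γ.coe_nonneg hlt hν hμ, fun N M m hN hM hm p hp Ω _ P _ g b hgb => ?_⟩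
  have := hμ.prob
  refine DilutedPerceptron.coupling_of_hasCoupling hm hgb hum (by positivity) ?_
  have hM' : (Fintype.card (Fin M) : ℝ≥0) = α * Fintype.card (Fin N) := by
    rw [Fintype.card_fin, Fintype.card_fin]
    exact_mod_cast hM
  have hp' : unitInterval.toNNReal p = γ / Fintype.card (Fin N) := by
    rw [Fintype.card_fin]
    refine NNReal.eq ?_
    push_cast
    exact hp
  refine (DilutedPerceptron.hasCoupling_sysMag p hum hu hc hμ hM' hp' h1 h2 (A := A) (B := B)
    (by rw [hB]; gcongr) (by rw [hA]; gcongr) Finset.univ (Finset.univ.map (Fin.castLEEmb hm))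
    (Finset.subset_univ _) Finset.univ).mono ?_
  rw [← ENNReal.ofReal_coe_nnreal]
  refine ENNReal.ofReal_le_ofReal ?_
  -- The full system has no missing spins or clauses, so the term with `B` disappears.
  simp only [Finset.card_map, Finset.card_univ, Fintype.card_fin, Finset.compl_univ,
    Finset.card_empty, Nat.cast_zero, add_zero, mul_zero]
  push_cast
  gcongr ?_ / _
  have hm1 : (m : ℝ) + m ^ 2 ≤ 2 * m ^ 3 := by
    have : m + m ^ 2 ≤ 2 * m ^ 3 := by
      have h3 : m ≤ m ^ 3 := Nat.le_self_pow (by norm_num) m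
      have h4 : m ^ 2 ≤ m ^ 3 := by
        rcases Nat.eq_zero_or_pos m with rfl | h
        · simp
        · exact Nat.pow_le_pow_right h (by norm_num)
      omega
    exact_mod_cast this
  have hm3 : (0 : ℝ) ≤ (m : ℝ) ^ 3 := by positivity
  have := mul_le_mul_of_nonneg_left hm1 A.coe_nonneg
  linarith
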